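/- Let $k$ be an arbitrary field with algebraic closure $\overline{k}$, let $H$ be a finite-dimensional Hopf algebra over $k$ with antipode $S$, and let $n \ge 1$ be an integer. For $m \ge 0$ let $P^{(m)} : H \to H$ be the $m$-th convolution power of $\mathrm{id}_H$ (the Sweedler power map: $P^{(0)}(h) = \varepsilon(h)1$ and $P^{(m)}(h) = h_{(1)} h_{(2)} \cdots h_{(m)}$), and define the $n$-th indicator of $H$ by $\nu_n(H) = \mathrm{Tr}(S \circ P^{(n-1)}) \in k$. Let $H^{*\mathrm{cop}}$ be the dual Hopf algebra of $H$ with opposite comultiplication, and let $D(H)$ be the Drinfeld double of $H$, i.e. the Hopf algebra with underlying coalgebra $H^{*\mathrm{cop}} \otimes H$, unit $\varepsilon \otimes 1$ and multiplication $$(f \otimes h)(f' \otimes h') = f \, f'\bigl(S^{-1}(h_{(3)})\, ? \, h_{(1)}\bigr) \otimes h_{(2)} h' .$$ Let $N = n \cdot (\text{order of } S^2)$, and let $\mathcal{O}_N \subset \overline{k}$ be the subring generated by the roots of $X^N - 1$. By the conjugation of $\mathcal{O}_N$ we mean a ring automorphism $z \mapsto \overline{z}$ of $\mathcal{O}_N$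 with $\overline{\omega} = \omega^{-1}$ whenever $\omega^N = 1$, so that $\overline{a_1 \omega_1 + \dotsb + a_m \omega_m} = a_1 \omega_1^{-1} + \dotsb + a_m \omega_m^{-1}$ for $a_i \in \mathbb{Z}$ and $\omega_i^N = 1$; and we put $|z|^2 = z \cdot \overline{z}$. Then: (1) If $k$ has characteristic $0$, the conjugation of $\mathcal{O}_N$ exists and is unique. (2) $\nu_n(H) \in \mathcal{O}_N$, and, over a field $k$ of any characteristic for which the conjugation of $\mathcal{O}_N$ exists (in particular whenever $k$ has characteristic $0$), $$\nu_n(D(H)) = |\nu_n(H)|^2 .$$ (3) Over any field $k$, there are finitely many $\omega_1, \dotsc, \omega_m \in \overline{k}$ with $\omega_i^N = 1$ such that $$\nu_n(H) = \sum_{i} \omega_i, \qquad \nu_n(H^{*\mathrm{cop}}) = \sum_i \omega_i^{-1}, \qquad \nu_n(D(H)) = \Bigl(\sum_{i} \omega_i\Bigr)\Bigl(\sum_{i} \omega_i^{-1}\Bigr).$$ -/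

import Mathlib

noncomputable section

namespace HopfDouble

open TensorProduct Coalgebra

universe u v

variable {k : Type u} {H : Type v} [Field k] [Ring H] [HopfAlgebra k H]

open HopfAlgebra WithConv

section

lemma sum_smul_counit {h : H} {ι : Type*} (r : Coalgebra.Repr k h ι) :
    ∑ i ∈ r.index, counit (R := k) (r.right i) • r.left i = h := by
  have h1 := congr(TensorProduct.rid k H $(sum_tmul_counit_eq (R := k) r))
  simpa only [map_sum, TensorProduct.rid_tmul, one_smul] using h1

/-- `hit g z = z₍₁₎ g(z₍₂₎)`. -/
def hit (g : Module.Dual k H) : H →ₗ[k] H :=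
  (TensorProduct.rid k H).toLinearMap ∘ₗ g.lTensor H ∘ₗ comul

lemma hit_repr (g : Module.Dual k H) {z : H} {ι : Type*} (r : Coalgebra.Repr k z ι) :
    hit g z = ∑ i ∈ r.index, g (r.right i) • r.left i := by
  simp [hit, ← r.eq]

/-- The functional `x ↦ g(h x)`. -/
def lshift (g : Module.Dual k H) (h : H) : Module.Dual k H := g ∘ₗ LinearMap.mulLeft k h

@[simp] lemma lshift_apply (g : Module.Dual k H) (h x : H) : lshift g h x = g (h * x) := rfl

/-- For fixed `g` and `t`, the linear map `h ↦ t₍₁₎ g(h t₍₂₎)`. -/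
def hitShift (g : Module.Dual k H) (t : H) : H →ₗ[k] H where
  toFun h := hit (lshift g h) t
  map_add' x y := by simp [hit_repr _ (ℛ k t), add_mul, add_smul, Finset.sum_add_distrib]
  map_smul' c x := by simp [hit_repr _ (ℛ k t), mul_smul, Finset.smul_sum]

lemma hitShift_apply (g : Module.Dual k H) (t h : H) : hitShift g t h = hit (lshift g h) t := rfl

lemma id_conv_hitShift (g : Module.Dual k H) (t : H) :
    toConv (LinearMap.id : H →ₗ[k] H) * toConv (hitShift g t) =
      toConv (hit g ∘ₗ LinearMap.mulRight k t) := by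
  ext h
  simp only [LinearMap.convMul_apply, hit, LinearMap.comp_apply, LinearMap.mulRight_apply,
    Bialgebra.comul_mul]
  hopf_tensor_induction comul (R := k) h with a b
  simp only [map_tmul, LinearMap.mul'_apply, hitShift_apply, hit, LinearMap.comp_apply]
  hopf_tensor_induction comul (R := k) t with c d
  simp

lemma hitShift_eq (g : Module.Dual k H) (t : H) :
    toConv (hitShift g t) = toConv (antipode k) * toConv (hit g ∘ₗ LinearMap.mulRight k t) := by
  rw [← id_conv_hitShift, ← mul_assoc, LinearMap.antipode_mul_id, one_mul]

lemma hitShift_repr (g : Module.Dual k H) (t : H) {h : H} {ι : Type*} (r : Coalgebra.Repr k h ι) :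
    hit (lshift g h) t = ∑ i ∈ r.index, antipode k (r.left i) * hit g (r.right i * t) := by
  have := congr($(hitShift_eq g t) h)
  rwa [r.convMul_apply] at this

lemma hit_lshift_of_integral (g : Module.Dual k H) {t : H}
    (ht : ∀ h : H, h * t = counit (R := k) h • t) (h : H) :
    hit (lshift g h) t = antipode k h * hit g t := by
  conv_rhs => rw [← sum_smul_counit (ℛ k h)]
  simp [hitShift_repr g t (ℛ k h), ht, Finset.sum_mul]

lemma basis_sum' {ι : Type*} [Fintype ι] (b : Module.Basis ι k H) (g : Module.Dual k H) (y : H) :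
    ∑ j, b.coord j y * g (b j) = g y := by
  conv_rhs => rw [← b.sum_repr y]
  simp only [map_sum, map_smul, smul_eq_mul, Module.Basis.coord_apply]

lemma basis_sum {ι : Type*} [Fintype ι] (b : Module.Basis ι k H) (g : Module.Dual k H) (y c : H) :
    ∑ j, b.coord j y * g (b j * c) = g (y * c) := by
  exact basis_sum' b (g ∘ₗ LinearMap.mulRight k c) y

/-- `z₍₁₎ g(S(z₍₂₎) z₍₃₎) = g(1) z`, with the middle term expanded in a basis. -/
lemma sum_hit_hit {ι : Type*} [Fintype ι] (b : Module.Basis ι k H) (g : Module.Dual k H) (z : H) :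
    ∑ j, hit (b.coord j ∘ₗ antipode k) (hit (lshift g (b j)) z) = g 1 • z := by
  let Φ : H ⊗[k] (H ⊗[k] H) →ₗ[k] H := (TensorProduct.rid k H).toLinearMap ∘ₗ
    (g ∘ₗ LinearMap.mul' k H ∘ₗ (antipode k).rTensor H).lTensor H
  have h1 : ∑ j, hit (b.coord j ∘ₗ antipode k) (hit (lshift g (b j)) z) =
      Φ (TensorProduct.assoc k H H H (comul.rTensor H (comul z))) := by
    simp only [hit, LinearMap.comp_apply]
    induction comul (R := k) z using TensorProduct.induction_on with
    | zero => simp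
    | add x y hx hy => simp only [map_add, Finset.sum_add_distrib, hx, hy]
    | tmul a c =>
      simp only [LinearMap.lTensor_tmul, LinearEquiv.coe_coe, TensorProduct.rid_tmul, map_smul,
        LinearMap.rTensor_tmul, lshift_apply]
      induction comul (R := k) a using TensorProduct.induction_on with
      | zero => simp
      | add x y hx hy => simp only [map_add, Finset.sum_add_distrib, hx, hy, add_tmul, smul_add]
      | tmul p q =>
        simp only [LinearMap.lTensor_tmul, LinearEquiv.coe_coe, TensorProduct.rid_tmul, smul_smul,
          LinearMap.comp_apply, ← Finset.sum_smul, TensorProduct.assoc_tmul,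
          LinearMap.rTensor_tmul, LinearMap.mul'_apply, Φ, mul_comm (g _), basis_sum b g _ c]
  rw [h1, coassoc_apply]
  have h2 : Φ ∘ₗ (comul (R := k) (A := H)).lTensor H =
      (TensorProduct.rid k H).toLinearMap ∘ₗ (g 1 • counit (R := k) (A := H)).lTensor H := by
    simp only [Φ, LinearMap.comp_assoc, ← LinearMap.lTensor_comp, mul_antipode_rTensor_comul]
    congr 2
    ext x
    simp [Algebra.algebraMap_eq_smul_one, mul_comm]
  refine congr($h2 (comul z)).trans ?_
  simp [LinearMap.lTensor_smul]

lemma nondeg_of_integral [FiniteDimensional k H] {t : H} (ht0 : t ≠ 0)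
    (ht : ∀ h : H, h * t = counit (R := k) h • t) {g : Module.Dual k H} (hg : hit g t = 0) :
    g = 0 := by
  have hl : ∀ h, hit (lshift g h) t = 0 := fun h => by rw [hit_lshift_of_integral g ht, hg, mul_zero]
  have key : ∀ g : Module.Dual k H, (∀ h, hit (lshift g h) t = 0) → g 1 = 0 := by
    intro g hg
    have := sum_hit_hit (Module.finBasis k H) g t
    simp only [hg, map_zero, Finset.sum_const_zero] at this
    exact (smul_eq_zero.1 this.symm).resolve_right ht0
  ext h
  have := key (lshift g h) (fun h' => by
    have : lshift (lshift g h) h' = lshift g (h * h') := by ext; simp [mul_assoc]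
    rw [this, hl])
  simpa using this

/-- The element `∑ᵢ eᵢ₍₁₎ eⁱ(S²(eᵢ₍₂₎) x)`, a left integral. -/
def integralOf {ι : Type*} [Fintype ι] (b : Module.Basis ι k H) (x : H) : H :=
  ∑ i, hit (b.coord i ∘ₗ LinearMap.mulRight k x ∘ₗ antipode k ∘ₗ antipode k) (b i)

lemma sum_coord_integralOf {ι : Type*} [Fintype ι] (b : Module.Basis ι k H) :
    ∑ j, b.coord j (integralOf b (antipode k (b j))) = 1 := by
  have h1 : ∀ f : Module.Dual k H, ∀ y : H,
      ∑ j, b.coord j (hit (f ∘ₗ LinearMap.mulRight k (antipode k (b j)) ∘ₗ antipode k ∘ₗ antipode k) y)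
        = counit (R := k) y * f 1 := by
    intro f y
    have e1 : ∀ p q : H, ∑ j, f (antipode k (antipode k q) * antipode k (b j)) * b.coord j p
        = f (antipode k (p * antipode k q)) := by
      intro p q
      rw [antipode_mul_antidistrib]
      simp only [mul_comm (f _)]
      exact basis_sum' b (f ∘ₗ LinearMap.mulLeft k _ ∘ₗ antipode k) p
    simp only [hit_repr _ (ℛ k y), map_sum, map_smul, smul_eq_mul, LinearMap.comp_apply,
      LinearMap.mulRight_apply]
    rw [Finset.sum_comm]
    simp only [e1]
    rw [← map_sum, ← map_sum, sum_mul_antipode_eq_smul]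
    simp
  simp only [integralOf, map_sum]
  rw [Finset.sum_comm]
  simp only [h1]
  have : ∑ i, counit (R := k) (b i) * b.coord i 1 = counit (R := k) (1 : H) := by
    simp only [mul_comm (counit _)]
    exact basis_sum' b counit 1
  rw [this, Bialgebra.counit_one]

lemma hit_sum_smul {ι : Type*} [Fintype ι] (c : ι → k) (g : ι → Module.Dual k H) (z : H) :
    hit (∑ i, c i • g i) z = ∑ i, c i • hit (g i) z := by
  simp only [hit_repr _ (ℛ k z), LinearMap.sum_apply, LinearMap.smul_apply, Finset.smul_sum,
    Finset.sum_smul, smul_eq_mul, mul_smul]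
  rw [Finset.sum_comm]

lemma sum_move {ι : Type*} [Fintype ι] (b : Module.Basis ι k H) (A : H →ₗ[k] H) (p : H) :
    ∑ i, hit (b.coord i ∘ₗ A) (p * b i) = ∑ i, hit (b.coord i ∘ₗ LinearMap.mulLeft k p ∘ₗ A) (b i) := by
  have h1 : ∀ i, p * b i = ∑ j, b.coord j (p * b i) • b j := fun i => (b.sum_repr (p * b i)).symm
  have h2 : ∀ j, b.coord j ∘ₗ LinearMap.mulLeft k p ∘ₗ A =
      ∑ i, b.coord j (p * b i) • (b.coord i ∘ₗ A) := by
    intro j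
    ext y
    have := basis_sum' b (b.coord j ∘ₗ LinearMap.mulLeft k p) (A y)
    simp only [LinearMap.comp_apply, LinearMap.mulLeft_apply] at this ⊢
    rw [← this]
    simp [mul_comm]
  calc _ = ∑ i, hit (b.coord i ∘ₗ A) (∑ j, b.coord j (p * b i) • b j) := by simp only [← h1]
    _ = _ := by
      simp only [map_sum, map_smul]
      rw [Finset.sum_comm]
      simp only [h2, hit_sum_smul]

lemma mul_integralOf {ι : Type*} [Fintype ι] (b : Module.Basis ι k H) (x h : H) :
    h * integralOf b x = counit (R := k) h • integralOf b x := by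
  let A (u : H) : H →ₗ[k] H :=
    LinearMap.mulLeft k u ∘ₗ LinearMap.mulRight k x ∘ₗ antipode k ∘ₗ antipode k
  have hA : ∀ u v, LinearMap.mulLeft k u ∘ₗ A v = A (u * v) := by
    intro u v; ext y; simp [A]
  -- `T (p ⊗ q ⊗ r) = ∑ᵢ p eᵢ₍₁₎ eⁱ(S(S(q) r) S²(eᵢ₍₂₎) x)`
  let B : H →ₗ[k] H →ₗ[k] H := LinearMap.mk₂ k (fun p u => ∑ i, p * hit (b.coord i ∘ₗ A u) (b i))
    (by intros; simp [add_mul, Finset.sum_add_distrib])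
    (by intros; simp [Finset.smul_sum])
    (by intros; simp [A, hit_repr _ (ℛ k (b _)), add_mul, add_smul, mul_add, Finset.sum_add_distrib])
    (by intros; simp [A, hit_repr _ (ℛ k (b _)), mul_smul, Finset.smul_sum, Finset.mul_sum])
  let V : H ⊗[k] H →ₗ[k] H := antipode k ∘ₗ LinearMap.mul' k H ∘ₗ (antipode k).rTensor H
  let T : H ⊗[k] (H ⊗[k] H) →ₗ[k] H := TensorProduct.lift B ∘ₗ V.lTensor H
  have e1 : T (comul.lTensor H (comul h)) = h * integralOf b x := by
    have h2 : V ∘ₗ (comul (R := k) (A := H)) = Algebra.linearMap k H ∘ₗ counit := by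
      simp only [V, LinearMap.comp_assoc, mul_antipode_rTensor_comul]
      ext y
      simp [Algebra.algebraMap_eq_smul_one]
    simp only [T, LinearMap.comp_apply, ← LinearMap.lTensor_comp_apply, h2]
    rw [LinearMap.lTensor_comp_apply, lTensor_counit_comul]
    simp [B, A, integralOf, Finset.mul_sum]
  have e2 : T (TensorProduct.assoc k H H H (comul.rTensor H (comul h))) =
      counit (R := k) h • integralOf b x := by
    have e3 : (T ∘ₗ (TensorProduct.assoc k H H H).toLinearMap) ∘ₗ
        (comul (R := k) (A := H)).rTensor H = B 1 ∘ₗ LinearMap.mul' k H ∘ₗ (antipode k).lTensor H := by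
      refine TensorProduct.ext' fun p r => ?_
      have h3 : B 1 (p * antipode k r) = ∑ i, hit (b.coord i ∘ₗ A (antipode k r)) (p * b i) := by
        simp [B, ← hA, sum_move]
      simp only [LinearMap.comp_apply, LinearMap.rTensor_tmul, LinearMap.lTensor_tmul,
        LinearMap.mul'_apply, h3, hit, Bialgebra.comul_mul]
      induction comul (R := k) p using TensorProduct.induction_on with
      | zero => simp
      | add x y hx hy => simp only [map_add, add_mul, Finset.sum_add_distrib, hx, hy, add_tmul]
      | tmul p q =>
        simp only [LinearEquiv.coe_coe, TensorProduct.assoc_tmul, T, B, LinearMap.comp_apply,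
          LinearMap.lTensor_tmul, TensorProduct.lift.tmul, LinearMap.mk₂_apply]
        refine Finset.sum_congr rfl fun i _ => ?_
        simp only [hit, LinearMap.comp_apply]
        induction comul (R := k) (b i) using TensorProduct.induction_on with
        | zero => simp
        | add x y hx hy => simp only [map_add, mul_add, hx, hy]
        | tmul c d =>
          simp [A, V, antipode_mul_antidistrib, mul_assoc]
    refine congr($e3 (comul h)).trans ?_
    simp only [LinearMap.comp_apply, mul_antipode_lTensor_comul_apply]
    simp [B, A, integralOf, Algebra.algebraMap_eq_smul_one]
  rw [← e1, ← e2, coassoc_apply]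

lemma exists_integral [FiniteDimensional k H] :
    ∃ t : H, t ≠ 0 ∧ ∀ h : H, h * t = counit (R := k) h • t := by
  by_contra! hc
  have h0 : ∀ x, integralOf (Module.finBasis k H) x = 0 := by
    intro x
    by_contra hx
    obtain ⟨h, hh⟩ := hc _ hx
    exact hh (mul_integralOf _ x h)
  have := sum_coord_integralOf (Module.finBasis k H)
  simp [h0] at this

lemma hit_comp (f g : Module.Dual k H) (z : H) : hit (f ∘ₗ hit g) z = hit f (hit g z) := by
  let Φ : H ⊗[k] (H ⊗[k] H) →ₗ[k] H := (TensorProduct.rid k H).toLinearMap ∘ₗ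
    (f ∘ₗ (TensorProduct.rid k H).toLinearMap ∘ₗ g.lTensor H).lTensor H
  have h1 : hit (f ∘ₗ hit g) z = Φ (comul.lTensor H (comul z)) := by
    simp only [hit, Φ, LinearMap.comp_apply, ← LinearMap.lTensor_comp_apply, LinearMap.comp_assoc]
  have h2 : hit f (hit g z) = Φ (TensorProduct.assoc k H H H (comul.rTensor H (comul z))) := by
    simp only [hit, LinearMap.comp_apply]
    hopf_tensor_induction comul (R := k) z with a c
    simp only [LinearMap.lTensor_tmul, LinearEquiv.coe_coe, TensorProduct.rid_tmul, map_smul,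
      LinearMap.rTensor_tmul]
    induction comul (R := k) a using TensorProduct.induction_on with
    | zero => simp
    | add x y hx hy => simp only [map_add, hx, hy, add_tmul, smul_add]
    | tmul p q => simp [Φ, mul_smul]
  rw [h1, h2, coassoc_apply]

/-- The antipode of a finite-dimensional Hopf algebra is bijective. -/
theorem antipode_injective [FiniteDimensional k H] :
    Function.Injective (antipode k : H →ₗ[k] H) := by
  obtain ⟨t, ht0, ht⟩ := exists_integral (k := k) (H := H)
  -- a functional `l` with `t₍₁₎ l(t₍₂₎) = 1`
  let c : Module.Dual k H →ₗ[k] H :=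
    { toFun := fun g => hit g t
      map_add' := fun f g => by simp [hit_repr _ (ℛ k t), add_smul, Finset.sum_add_distrib]
      map_smul' := fun a g => by simp [hit_repr _ (ℛ k t), mul_smul, Finset.smul_sum] }
  have hc : Function.Injective c := (injective_iff_map_eq_zero c).2
    fun g hg => nondeg_of_integral ht0 ht hg
  obtain ⟨l, hl⟩ := (LinearMap.injective_iff_surjective_of_finrank_eq_finrank
    (Subspace.dual_finrank_eq)).1 hc 1
  replace hl : hit l t = 1 := hl
  have hS : ∀ h, hit (lshift l h) t = antipode k h := fun h => by
    rw [hit_lshift_of_integral l ht, hl, mul_one]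
  -- `l` is a left integral on `H`
  have hint : ∀ z, hit l z = l z • 1 := by
    intro z
    refine sub_eq_zero.1 ((Module.forall_dual_apply_eq_zero_iff k _).1 fun φ => ?_)
    rw [map_sub, sub_eq_zero]
    have h1 : (φ ∘ₗ hit l - φ 1 • l : Module.Dual k H) = 0 := by
      refine hc ?_
      rw [map_sub, map_smul, map_zero]
      change hit (φ ∘ₗ hit l) t - φ 1 • hit l t = 0
      rw [hit_comp, hl]
      simp [hit, Algebra.TensorProduct.one_def]
    have h2 := congr($h1 z)
    simp only [LinearMap.sub_apply, LinearMap.comp_apply, LinearMap.smul_apply,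
      LinearMap.zero_apply, sub_eq_zero] at h2
    rw [h2, map_smul, smul_eq_mul, smul_eq_mul, mul_comm]
  have hnd : ∀ x, (∀ y, l (y * x) = 0) → x = 0 := by
    intro x hx
    obtain ⟨y, hy⟩ : ∃ y, l y ≠ 0 := by
      by_contra! h0
      have : l = 0 := by ext y; exact h0 y
      exact one_ne_zero (α := k) (by
        have h3 := congr(counit (R := k) $hl)
        rw [this] at h3
        simpa [hit] using h3.symm)
    have h0 : ∀ u, hit (lshift l u) x = 0 := fun u => by
      rw [hitShift_repr l x (ℛ k u)]
      simp [hint, hx]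
    have h1 := sum_hit_hit (Module.finBasis k H) (lshift l y) x
    have h2 : ∀ u, lshift (lshift l y) u = lshift l (y * u) := fun u => by ext; simp [mul_assoc]
    simp only [h2, h0, map_zero, Finset.sum_const_zero, lshift_apply, mul_one] at h1
    exact (smul_eq_zero.1 h1.symm).resolve_left hy
  refine (injective_iff_map_eq_zero _).2 fun h hh => ?_
  have h1 : lshift l h = 0 := nondeg_of_integral ht0 ht (by rw [hS, hh])
  let θ : H →ₗ[k] Module.Dual k H := (LinearMap.mul k H).flip.compr₂ l
  have hθ : Function.Injective θ := (injective_iff_map_eq_zero θ).2 fun x hx =>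
    hnd x fun y => congr($hx y)
  have hθ' := (LinearMap.injective_iff_surjective_of_finrank_eq_finrank
    (Subspace.dual_finrank_eq).symm).1 hθ
  refine (Module.forall_dual_apply_eq_zero_iff k h).1 fun φ => ?_
  obtain ⟨x, rfl⟩ := hθ' φ
  exact congr($h1 x)

end

section

lemma comul_antipode (a : H) :
    comul (R := k) (antipode k a) =
      TensorProduct.map (antipode k) (antipode k) (TensorProduct.comm k H H (comul a)) := by
  let i₁ : H →ₐ[k] H ⊗[k] H := Algebra.TensorProduct.includeLeft
  let i₂ : H →ₐ[k] H ⊗[k] H := Algebra.TensorProduct.includeRight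
  have hΔ : toConv (comul (R := k) (A := H)) = toConv i₁.toLinearMap * toConv i₂.toLinearMap := by
    ext x
    simp only [LinearMap.convMul_apply]

    symm
    hopf_tensor_induction comul (R := k) x with p q
    simp only [i₁, i₂, map_tmul, LinearMap.mul'_apply, AlgHom.toLinearMap_apply,
      Algebra.TensorProduct.includeLeft_apply, Algebra.TensorProduct.includeRight_apply,
      Algebra.TensorProduct.tmul_mul_tmul, mul_one, one_mul]
  have hG : toConv (TensorProduct.map (antipode k) (antipode k) ∘ₗ
      (TensorProduct.comm k H H).toLinearMap ∘ₗ comul) =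
      toConv (i₂.toLinearMap ∘ₗ antipode k) * toConv (i₁.toLinearMap ∘ₗ antipode k) := by
    ext x
    simp only [LinearMap.convMul_apply, LinearMap.comp_apply]
    hopf_tensor_induction comul (R := k) x with p q
    simp [i₁, i₂]
  have h1 : ∀ i : H →ₐ[k] H ⊗[k] H,
      toConv (i.toLinearMap ∘ₗ antipode k) * toConv i.toLinearMap = 1 := by
    intro i
    ext x
    have := congr($(LinearMap.algHom_comp_convMul_distrib i (toConv (antipode k))
      (toConv (LinearMap.id : H →ₗ[k] H))) x)
    rw [LinearMap.antipode_mul_id] at this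
    refine this.symm.trans ?_
    simp
  have h2 : toConv (TensorProduct.map (antipode k) (antipode k) ∘ₗ
      (TensorProduct.comm k H H).toLinearMap ∘ₗ comul) * toConv (comul (R := k) (A := H)) = 1 := by
    rw [hΔ, hG, mul_assoc, ← mul_assoc (toConv (i₁.toLinearMap ∘ₗ antipode k)), h1, one_mul, h1]
  exact congr($(left_inv_eq_right_inv h2 LinearMap.comul_right_inv) a).symm

section antipodeInv
variable [FiniteDimensional k H]

variable (k H) in
/-- The antipode of a finite-dimensional Hopf algebra as a linear automorphism. -/
def antipodeEquiv : H ≃ₗ[k] H := LinearEquiv.ofInjectiveEndo (antipode k) antipode_injective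

variable (k H) in
/-- The inverse `S⁻¹` of the antipode. -/
def antipodeInv : H →ₗ[k] H := (antipodeEquiv k H).symm.toLinearMap

@[simp] lemma antipode_antipodeInv (a : H) : antipode k (antipodeInv k H a) = a :=
  (antipodeEquiv k H).apply_symm_apply a

@[simp] lemma antipodeInv_antipode (a : H) : antipodeInv k H (antipode k a) = a :=
  (antipodeEquiv k H).symm_apply_apply a

@[simp] lemma antipodeInv_one : antipodeInv k H 1 = 1 :=
  antipode_injective (k := k) (by rw [antipode_antipodeInv, antipode_one])

lemma antipodeInv_mul (a b : H) :
    antipodeInv k H (a * b) = antipodeInv k H b * antipodeInv k H a :=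
  antipode_injective (k := k) (by simp [antipode_mul_antidistrib])

lemma counit_antipodeInv (a : H) : counit (R := k) (antipodeInv k H a) = counit a := by
  rw [← counit_antipode, antipode_antipodeInv]

lemma comul_antipodeInv (a : H) :
    comul (R := k) (antipodeInv k H a) =
      TensorProduct.map (antipodeInv k H) (antipodeInv k H)
        (TensorProduct.comm k H H (comul a)) := by
  conv_rhs => rw [← antipode_antipodeInv (k := k) a, comul_antipode]
  generalize comul (R := k) (antipodeInv k H a) = t
  symm
  hopf_tensor_induction t with p q
  simp only [map_tmul, comm_tmul, antipodeInv_antipode]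

/-- `a₍₂₎ S⁻¹(a₍₁₎) = ε(a)` -/
lemma mul_antipodeInv (a : H) :
    LinearMap.mul' k H ((antipodeInv k H).lTensor H (TensorProduct.comm k H H (comul a))) =
      algebraMap k H (counit a) := by
  apply antipode_injective (k := k)
  have h := mul_antipode_lTensor_comul_apply (R := k) a
  refine Eq.trans ?_ (h.trans ?_)
  · hopf_tensor_induction comul (R := k) a with p q
    simp [antipode_mul_antidistrib]
  · simp [Algebra.algebraMap_eq_smul_one]

/-- `S⁻¹(a₍₂₎) a₍₁₎ = ε(a)` -/
lemma antipodeInv_mul_self (a : H) :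
    LinearMap.mul' k H ((antipodeInv k H).rTensor H (TensorProduct.comm k H H (comul a))) =
      algebraMap k H (counit a) := by
  apply antipode_injective (k := k)
  have h := mul_antipode_rTensor_comul_apply (R := k) a
  refine Eq.trans ?_ (h.trans ?_)
  · hopf_tensor_induction comul (R := k) a with p q
    simp [antipode_mul_antidistrib]
  · simp [Algebra.algebraMap_eq_smul_one]

end antipodeInv

end

section

variable (k H) in
/-- The Hopf algebra `H^{*cop}` dual to a finite-dimensional Hopf algebra `H`, with opposite
comultiplication. As an algebra it is the convolution algebra `H^*`. -/
def DualCop : Type (max u v) := WithConv (H →ₗ[k] k)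

namespace DualCop

instance : Ring (DualCop k H) := inferInstanceAs (Ring (WithConv (H →ₗ[k] k)))
instance : Algebra k (DualCop k H) := inferInstanceAs (Algebra k (WithConv (H →ₗ[k] k)))

variable (k H) in
/-- The underlying functional of an element of `H^{*cop}`. -/
def pairing : DualCop k H ≃ₗ[k] Module.Dual k H := WithConv.linearEquiv k (H →ₗ[k] k)

@[ext] lemma ext {f g : DualCop k H} (h : ∀ x, pairing k H f x = pairing k H g x) : f = g :=
  (pairing k H).injective (LinearMap.ext h)

lemma pairing_mul (f g : DualCop k H) (x : H) :
    pairing k H (f * g) x =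
      LinearMap.mul' k k (TensorProduct.map (pairing k H f) (pairing k H g) (comul x)) := rfl

lemma pairing_one (x : H) : pairing k H 1 x = counit x := rfl

/-- Evaluation at `x ∈ H` of the first tensor factor. -/
def contr {M : Type*} [AddCommGroup M] [Module k M] (x : H) : DualCop k H ⊗[k] M →ₗ[k] M :=
  (TensorProduct.lid k M).toLinearMap ∘ₗ
    (Module.Dual.eval k H x ∘ₗ (pairing k H).toLinearMap).rTensor M

@[simp] lemma contr_tmul {M : Type*} [AddCommGroup M] [Module k M] (x : H) (f : DualCop k H) (m : M) :
    contr x (f ⊗ₜ[k] m) = pairing k H f x • m := by simp [contr]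

lemma contr_lTensor {M N : Type*} [AddCommGroup M] [Module k M] [AddCommGroup N] [Module k N]
    (φ : M →ₗ[k] N) (x : H) (t : DualCop k H ⊗[k] M) :
    contr x (φ.lTensor (DualCop k H) t) = φ (contr x t) := by
  hopf_tensor_induction t with f m
  simp

lemma contr_mul (s t : DualCop k H ⊗[k] DualCop k H) (x y : H) :
    pairing k H (contr x (s * t)) y = ∑ i ∈ (ℛ k x).index, ∑ j ∈ (ℛ k y).index,
      pairing k H (contr ((ℛ k x).left i) s) ((ℛ k y).left j) *
      pairing k H (contr ((ℛ k x).right i) t) ((ℛ k y).right j) := by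
  induction s using TensorProduct.induction_on with
  | zero => simp
  | add s s' hs hs' =>
    simp only [add_mul, map_add, hs, hs', LinearMap.add_apply, Finset.sum_add_distrib]
  | tmul a b =>
    induction t using TensorProduct.induction_on with
    | zero => simp
    | add s s' hs hs' =>
      simp only [mul_add, map_add, hs, hs', LinearMap.add_apply, Finset.sum_add_distrib]
    | tmul c d =>
      simp only [Algebra.TensorProduct.tmul_mul_tmul, contr_tmul, map_smul, LinearMap.smul_apply,
        pairing_mul, ← (ℛ k x).eq, ← (ℛ k y).eq, map_sum, map_tmul, LinearMap.mul'_apply,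
        smul_eq_mul, Finset.sum_mul_sum]
      refine Finset.sum_congr rfl fun i _ => Finset.sum_congr rfl fun j _ => by ring

variable [FiniteDimensional k H]

instance : Module.Finite k (DualCop k H) := Module.Finite.equiv (pairing k H).symm

lemma contr_ext {M : Type*} [AddCommGroup M] [Module k M] {t s : DualCop k H ⊗[k] M}
    (h : ∀ x : H, contr x t = contr x s) : t = s := by
  let b := Module.finBasis k H
  have key : ∀ t : DualCop k H ⊗[k] M,
      t = ∑ i, (pairing k H).symm (b.coord i) ⊗ₜ[k] contr (b i) t := by
    intro t
    induction t using TensorProduct.induction_on with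
    | zero => simp
    | add x y hx hy =>
      conv_lhs => rw [hx, hy]
      simp only [map_add, tmul_add, Finset.sum_add_distrib]
    | tmul f m =>
      simp only [contr_tmul, ← smul_tmul, ← sum_tmul]
      congr 1
      ext y
      simp only [map_sum, map_smul, LinearEquiv.apply_symm_apply, LinearMap.sum_apply,
        LinearMap.smul_apply, smul_eq_mul]
      simp only [mul_comm (pairing k H f _)]
      exact (basis_sum' b _ y).symm
  rw [key t, key s]
  simp only [h]

instance : CoalgebraStruct k (DualCop k H) where
  comul := TensorProduct.map (pairing k H).symm.toLinearMap (pairing k H).symm.toLinearMap ∘ₗ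
    (TensorProduct.dualDistribEquiv k H H).symm.toLinearMap ∘ₗ
    (LinearMap.mul' k H ∘ₗ (TensorProduct.comm k H H).toLinearMap).dualMap ∘ₗ
    (pairing k H).toLinearMap
  counit := Module.Dual.eval k H 1 ∘ₗ (pairing k H).toLinearMap

lemma counit_apply (f : DualCop k H) : counit (R := k) f = pairing k H f 1 := rfl

/-- The comultiplication of `H^{*cop}` is characterized by `f₍₁₎(x) f₍₂₎(y) = f(y x)`. -/
lemma pairing_comul (f : DualCop k H) (x y : H) :
    pairing k H (contr x (comul (R := k) f)) y = pairing k H f (y * x) := by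
  have h : ∀ t : Module.Dual k H ⊗[k] Module.Dual k H,
      pairing k H (contr x (TensorProduct.map (pairing k H).symm.toLinearMap
        (pairing k H).symm.toLinearMap t)) y = TensorProduct.dualDistrib k H H t (x ⊗ₜ y) := by
    intro t
    induction t using TensorProduct.induction_on with
    | zero => simp
    | add s s' hs hs' => simp only [map_add, LinearMap.add_apply, hs, hs']
    | tmul a b => rfl
  have h2 : TensorProduct.dualDistrib k H H ((TensorProduct.dualDistribEquiv k H H).symm
    ((LinearMap.mul' k H ∘ₗ (TensorProduct.comm k H H).toLinearMap).dualMap (pairing k H f))) = _ :=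
    (TensorProduct.dualDistribEquiv k H H).apply_symm_apply _
  refine (h _).trans ?_
  refine (congr($h2 (x ⊗ₜ[k] y))).trans ?_
  simp

lemma contr_contr_comul {M : Type*} [AddCommGroup M] [Module k M] (t : DualCop k H ⊗[k] M)
    (x y : H) :
    contr y (contr x (TensorProduct.assoc k _ _ _ ((comul (R := k)).rTensor M t))) =
      contr (y * x) t := by
  hopf_tensor_induction t with f m
  have h : ∀ t : DualCop k H ⊗[k] DualCop k H, contr y (contr x (TensorProduct.assoc k _ _ _
      (t ⊗ₜ[k] m))) = pairing k H (contr x t) y • m := by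
    intro t
    induction t using TensorProduct.induction_on with
    | zero => simp
    | add x y hx hy => simp only [map_add, add_tmul, hx, hy, LinearMap.add_apply, add_smul]
    | tmul a b => simp [mul_smul]
  simp [h, pairing_comul]

instance : Coalgebra k (DualCop k H) where
  coassoc := by
    ext f
    refine contr_ext fun x => contr_ext fun y => DualCop.ext fun z => ?_
    simp only [LinearMap.comp_apply, LinearEquiv.coe_coe, contr_contr_comul, contr_lTensor,
      pairing_comul, mul_assoc]
  rTensor_counit_comp_comul := by
    ext f
    have h : ∀ t : DualCop k H ⊗[k] DualCop k H, TensorProduct.lid k _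
        ((counit (R := k)).rTensor _ t) = contr 1 t := by
      intro t
      hopf_tensor_induction t with a b
      simp [counit_apply]
    refine (TensorProduct.lid k _).injective ?_
    ext y
    simp [h, pairing_comul]
  lTensor_counit_comp_comul := by
    ext f
    refine contr_ext fun x => ?_
    simp [contr_lTensor, counit_apply, pairing_comul]

instance : Bialgebra k (DualCop k H) := Bialgebra.mk' k (DualCop k H)
  (by simp [counit_apply, pairing_one])
  (by intro a b; simp [counit_apply, pairing_mul, Algebra.TensorProduct.one_def])
  (by
    refine contr_ext fun x => DualCop.ext fun y => ?_
    simp [pairing_comul, pairing_one, Algebra.TensorProduct.one_def, mul_comm])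
  (by
    intro a b
    refine contr_ext fun x => DualCop.ext fun y => ?_
    rw [contr_mul]
    simp only [pairing_comul, pairing_mul, Bialgebra.comul_mul]
    simp only [← (ℛ k x).eq, ← (ℛ k y).eq, Finset.sum_mul_sum, map_sum,
      Algebra.TensorProduct.tmul_mul_tmul, map_tmul, LinearMap.mul'_apply]
    rw [Finset.sum_comm])

/-- precomposition with `S⁻¹` -/
def antip : DualCop k H →ₗ[k] DualCop k H :=
  (pairing k H).symm.toLinearMap ∘ₗ (antipodeInv k H).dualMap ∘ₗ (pairing k H).toLinearMap

lemma pairing_antip (f : DualCop k H) (x : H) :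
    pairing k H (antip f) x = pairing k H f (antipodeInv k H x) := by simp [antip]

instance : HopfAlgebra k (DualCop k H) where
  antipode := antip
  mul_antipode_rTensor_comul := by
    ext f x
    have h : ∀ t : DualCop k H ⊗[k] DualCop k H,
      pairing k H (LinearMap.mul' k _ (antip.rTensor _ t)) x = ∑ i ∈ (ℛ k x).index,
        pairing k H (contr (antipodeInv k H ((ℛ k x).left i)) t) ((ℛ k x).right i) := by
      intro t
      induction t using TensorProduct.induction_on with
      | zero => simp
      | add s s' hs hs' =>
        simp only [map_add, hs, hs', LinearMap.add_apply, Finset.sum_add_distrib]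
      | tmul a b => simp [pairing_mul, ← (ℛ k x).eq, pairing_antip]
    have h2 := congr(pairing k H f $(mul_antipodeInv (k := k) x))
    simp only [← (ℛ k x).eq, map_sum, comm_tmul, LinearMap.lTensor_tmul, LinearMap.mul'_apply] at h2
    simp only [LinearMap.comp_apply, h, pairing_comul, h2]
    simp [Algebra.algebraMap_eq_smul_one, pairing_one, counit_apply, mul_comm]
  mul_antipode_lTensor_comul := by
    ext f x
    have h : ∀ t : DualCop k H ⊗[k] DualCop k H,
      pairing k H (LinearMap.mul' k _ (antip.lTensor _ t)) x = ∑ i ∈ (ℛ k x).index,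
        pairing k H (contr ((ℛ k x).left i) t) (antipodeInv k H ((ℛ k x).right i)) := by
      intro t
      induction t using TensorProduct.induction_on with
      | zero => simp
      | add s s' hs hs' =>
        simp only [map_add, hs, hs', LinearMap.add_apply, Finset.sum_add_distrib]
      | tmul a b => simp [pairing_mul, ← (ℛ k x).eq, pairing_antip]
    have h2 := congr(pairing k H f $(antipodeInv_mul_self (k := k) x))
    simp only [← (ℛ k x).eq, map_sum, comm_tmul, LinearMap.rTensor_tmul, LinearMap.mul'_apply] at h2
    simp only [LinearMap.comp_apply, h, pairing_comul, h2]
    simp [Algebra.algebraMap_eq_smul_one, pairing_one, counit_apply, mul_comm]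

end DualCop

end

section

open DualCop

section coassoc

variable (k H) in
/-- `h ↦ h₍₁₎ ⊗ (h₍₂₎ ⊗ h₍₃₎)` -/
def comul₃ : H →ₗ[k] H ⊗[k] (H ⊗[k] H) := comul.lTensor H ∘ₗ comul

variable (k H) in
/-- `p ⊗ (q ⊗ r) ↦ (p ⊗ q₍₁₎) ⊗ (q₍₂₎ ⊗ r)` -/
def splitMid : H ⊗[k] (H ⊗[k] H) →ₗ[k] (H ⊗[k] H) ⊗[k] (H ⊗[k] H) :=
  (TensorProduct.assoc k H H (H ⊗[k] H)).symm.toLinearMap ∘ₗ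
    ((TensorProduct.assoc k H H H).toLinearMap ∘ₗ comul.rTensor H).lTensor H

lemma splitMid_comul₃ (h : H) :
    splitMid k H (comul₃ k H h) = TensorProduct.map comul comul (comul (R := k) h) := by
  have h1 : splitMid k H (comul₃ k H h) = (TensorProduct.assoc k H H (H ⊗[k] H)).symm
      ((comul.lTensor H).lTensor H (TensorProduct.assoc k H H H (comul.rTensor H (comul h)))) := by
    rw [coassoc_apply]
    simp only [splitMid, comul₃, LinearMap.comp_apply, ← LinearMap.lTensor_comp_apply,
      LinearMap.comp_assoc, Coalgebra.coassoc]
    rfl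
  rw [h1]
  hopf_tensor_induction comul (R := k) h with a b
  simp only [LinearMap.rTensor_tmul, map_tmul]
  hopf_tensor_induction comul (R := k) a with c d
  simp

end coassoc

/-- Left multiplication by `f ∈ H^*` on the double. -/
def leftDual : DualCop k H →ₗ[k] Module.End k (DualCop k H ⊗[k] H) :=
  LinearMap.rTensorHom H ∘ₗ LinearMap.mul k (DualCop k H)

@[simp] lemma leftDual_tmul (f g : DualCop k H) (y : H) :
    leftDual f (g ⊗ₜ[k] y) = (f * g) ⊗ₜ y := rfl

lemma leftDual_mul (f g : DualCop k H) : leftDual (f * g) = leftDual f * leftDual g := by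
  ext; simp [mul_assoc]

lemma leftDual_one : leftDual (1 : DualCop k H) = 1 := by
  ext; simp

lemma comul₃_mul (h h' : H) : comul₃ k H (h * h') = comul₃ k H h * comul₃ k H h' := by
  simp only [comul₃, LinearMap.comp_apply, Bialgebra.comul_mul]
  generalize comul (R := k) h = s
  generalize comul (R := k) h' = t
  induction s using TensorProduct.induction_on with
  | zero => simp
  | add s s' hs hs' => simp only [add_mul, map_add, hs, hs']
  | tmul a b =>
    induction t using TensorProduct.induction_on with
    | zero => simp
    | add s s' hs hs' => simp only [mul_add, map_add, hs, hs']
    | tmul c d => simp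

variable [FiniteDimensional k H]

/-- `coadj p r f` is the functional `x ↦ f(S⁻¹(r) x p)`. -/
def coadj : H →ₗ[k] H →ₗ[k] Module.End k (DualCop k H) :=
  LinearMap.mk₂ k (fun p r => (pairing k H).symm.toLinearMap ∘ₗ
      (LinearMap.mulLeft k (antipodeInv k H r) ∘ₗ LinearMap.mulRight k p).dualMap ∘ₗ
      (pairing k H).toLinearMap)
    (by intros; ext; simp [mul_add]) (by intros; ext; simp)
    (by intros; ext; simp [add_mul]) (by intros; ext; simp)

lemma pairing_coadj (p r x : H) (f : DualCop k H) :
    pairing k H (coadj p r f) x = pairing k H f (antipodeInv k H r * (x * p)) := by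
  simp [coadj]

/-- The operator `f ⊗ y ↦ f(S⁻¹(r) ? p) ⊗ q y` attached to `p ⊗ (q ⊗ r)`. -/
def act₃ : H ⊗[k] (H ⊗[k] H) →ₗ[k] Module.End k (DualCop k H ⊗[k] H) :=
  TensorProduct.lift ((TensorProduct.mapBilinear (RingHom.id k) (DualCop k H) H (DualCop k H) H).compl₁₂
      (TensorProduct.lift coadj) (LinearMap.mul k H)) ∘ₗ
    (TensorProduct.assoc k H H H).symm.toLinearMap ∘ₗ
    (TensorProduct.comm k H H).toLinearMap.lTensor H

@[simp] lemma act₃_tmul (p q r y : H) (f : DualCop k H) :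
    act₃ (k := k) (p ⊗ₜ (q ⊗ₜ r)) (f ⊗ₜ y) = coadj p r f ⊗ₜ (q * y) := by simp [act₃]

/-- Left multiplication by `h ∈ H` on the double:
`f ⊗ y ↦ f(S⁻¹(h₍₃₎) ? h₍₁₎) ⊗ h₍₂₎ y`. -/
def leftH : H →ₗ[k] Module.End k (DualCop k H ⊗[k] H) := act₃ ∘ₗ comul₃ k H

variable (k H) in
/-- The multiplication of the double:
`(f ⊗ h) (f' ⊗ h') = f f'(S⁻¹(h₍₃₎) ? h₍₁₎) ⊗ h₍₂₎ h'`. -/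
def doubleMul : DualCop k H ⊗[k] H →ₗ[k] Module.End k (DualCop k H ⊗[k] H) :=
  LinearMap.mul' k _ ∘ₗ TensorProduct.map leftDual leftH

@[simp] lemma doubleMul_tmul (f : DualCop k H) (h : H) :
    doubleMul k H (f ⊗ₜ h) = leftDual f * leftH h := by simp [doubleMul]

lemma act₃_mul (s t : H ⊗[k] (H ⊗[k] H)) : act₃ (k := k) (s * t) = act₃ s * act₃ t := by
  induction s using TensorProduct.induction_on with
  | zero => simp
  | add s s' hs hs' => simp only [add_mul, map_add, hs, hs']
  | tmul p s =>
    induction s using TensorProduct.induction_on with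
    | zero => simp
    | add s s' hs hs' => simp only [add_mul, map_add, hs, hs', tmul_add]
    | tmul q r =>
      induction t using TensorProduct.induction_on with
      | zero => simp
      | add s s' hs hs' => simp only [mul_add, map_add, hs, hs']
      | tmul p' s =>
        induction s using TensorProduct.induction_on with
        | zero => simp
        | add s s' hs hs' => simp only [mul_add, map_add, hs, hs', tmul_add]
        | tmul q' r' =>
          refine TensorProduct.ext' fun f y => ?_
          simp only [Algebra.TensorProduct.tmul_mul_tmul, act₃_tmul, Module.End.mul_apply, mul_assoc]
          congr 1
          ext x
          simp [pairing_coadj, antipodeInv_mul, mul_assoc]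

lemma leftH_mul (h h' : H) : leftH (k := k) (h * h') = leftH h * leftH h' := by
  simp [leftH, comul₃_mul, act₃_mul]

lemma leftH_one : leftH (k := k) (1 : H) = 1 := by
  refine TensorProduct.ext' fun f y => ?_
  simp only [leftH, comul₃, LinearMap.comp_apply, Bialgebra.comul_one,
    Algebra.TensorProduct.one_def, LinearMap.lTensor_tmul, act₃_tmul, Module.End.one_apply, one_mul]
  congr 1
  ext x
  simp [pairing_coadj]

/-- `p₍₁₎, p₍₂₎, r₍₁₎, r₍₂₎`-expansion of the coadjoint action on a product. -/
lemma coadj_mul (p r : H) (f g : DualCop k H) :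
    coadj p r (f * g) = ∑ i ∈ (ℛ k p).index, ∑ j ∈ (ℛ k r).index,
      coadj ((ℛ k p).left i) ((ℛ k r).right j) f * coadj ((ℛ k p).right i) ((ℛ k r).left j) g := by
  ext x
  rw [pairing_coadj]
  simp only [pairing_mul, Bialgebra.comul_mul, comul_antipodeInv, map_sum, LinearMap.sum_apply]
  simp only [← (ℛ k p).eq, ← (ℛ k r).eq, ← (ℛ k x).eq, map_sum, comm_tmul, map_tmul,
    LinearMap.mul'_apply, Finset.mul_sum, Finset.sum_mul,
    Algebra.TensorProduct.tmul_mul_tmul, pairing_coadj]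
  conv_lhs => enter [2, i]; rw [Finset.sum_comm]

lemma leftH_leftDual (h : H) (f : DualCop k H) :
    leftH h * leftDual f = doubleMul k H (leftH h (f ⊗ₜ 1)) := by
  obtain ⟨Ω, hΩ⟩ : ∃ Ω : (H ⊗[k] H) ⊗[k] (H ⊗[k] (H ⊗[k] H)) →ₗ[k]
      Module.End k (DualCop k H ⊗[k] H), ∀ p₁ p₂ q r₁ r₂ : H,
      Ω ((p₁ ⊗ₜ p₂) ⊗ₜ (q ⊗ₜ (r₁ ⊗ₜ r₂))) =
        leftDual (coadj p₁ r₂ f) * act₃ (p₂ ⊗ₜ (q ⊗ₜ r₁)) :=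
    ⟨LinearMap.mul' k _ ∘ₗ
      TensorProduct.map (leftDual ∘ₗ LinearMap.applyₗ f ∘ₗ TensorProduct.lift coadj) act₃ ∘ₗ
      (TensorProduct.comm k _ _).toLinearMap ∘ₗ
      (TensorProduct.tensorTensorTensorComm k H H (H ⊗[k] H) H).toLinearMap ∘ₗ
      TensorProduct.map (TensorProduct.comm k H H).toLinearMap
        (TensorProduct.assoc k H H H).symm.toLinearMap, by intros; simp⟩
  have e1 : leftH h * leftDual f =
      Ω (TensorProduct.map comul (comul.lTensor H ∘ₗ comul) (comul (R := k) h)) := by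
    simp only [leftH, comul₃, LinearMap.comp_apply]
    induction comul (R := k) h using TensorProduct.induction_on with
    | zero => simp
    | add s s' hs hs' => simp only [map_add, add_mul, hs, hs']
    | tmul p b =>
      simp only [LinearMap.lTensor_tmul, map_tmul, LinearMap.comp_apply]
      induction comul (R := k) b using TensorProduct.induction_on with
      | zero => simp
      | add s s' hs hs' => simp only [map_add, add_mul, tmul_add, hs, hs']
      | tmul q r =>
        simp only [LinearMap.lTensor_tmul]
        refine TensorProduct.ext' fun g y => ?_
        simp only [Module.End.mul_apply, leftDual_tmul, act₃_tmul, coadj_mul, sum_tmul]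
        simp only [← (ℛ k p).eq, ← (ℛ k r).eq, sum_tmul, tmul_sum, map_sum, hΩ,
          LinearMap.sum_apply, Module.End.mul_apply, act₃_tmul, leftDual_tmul]
        exact Finset.sum_comm
  have e2 : doubleMul k H (leftH h (f ⊗ₜ 1)) =
      (Ω ∘ₗ ((TensorProduct.assoc k H H H).toLinearMap ∘ₗ comul.rTensor H).lTensor (H ⊗[k] H))
        (splitMid k H (comul₃ k H h)) := by
    simp only [leftH, LinearMap.comp_apply]
    induction comul₃ k H h using TensorProduct.induction_on with
    | zero => simp
    | add s s' hs hs' => simp only [map_add, LinearMap.add_apply, hs, hs']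
    | tmul p t =>
      induction t using TensorProduct.induction_on with
      | zero => simp
      | add s s' hs hs' => simp only [map_add, LinearMap.add_apply, tmul_add, hs, hs']
      | tmul q r =>
        simp only [act₃_tmul, mul_one, doubleMul_tmul, leftH, comul₃, splitMid,
          LinearMap.comp_apply, LinearMap.lTensor_tmul, LinearMap.rTensor_tmul]
        induction comul (R := k) q using TensorProduct.induction_on with
        | zero => simp
        | add s s' hs hs' => simp only [map_add, mul_add, add_tmul, tmul_add, hs, hs']
        | tmul q₁ q₂ =>
          simp only [LinearMap.lTensor_tmul, LinearEquiv.coe_coe, TensorProduct.assoc_tmul,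
            TensorProduct.assoc_symm_tmul, LinearMap.comp_apply, LinearMap.rTensor_tmul]
          induction comul (R := k) q₂ using TensorProduct.induction_on with
          | zero => simp
          | add s s' hs hs' => simp only [map_add, mul_add, add_tmul, tmul_add, hs, hs']
          | tmul u v => simp only [TensorProduct.assoc_tmul, hΩ]
  rw [e1, e2, splitMid_comul₃, LinearMap.comp_apply]
  congr 1
  rw [← Coalgebra.coassoc, ← LinearMap.comp_assoc, ← LinearMap.lTensor_comp_map]
  rfl

lemma doubleMul_leftDual (f : DualCop k H) (z : DualCop k H ⊗[k] H) :
    doubleMul k H (leftDual f z) = leftDual f * doubleMul k H z := by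
  induction z using TensorProduct.induction_on with
  | zero => simp
  | add s s' hs hs' => simp only [map_add, mul_add, hs, hs']
  | tmul g y => simp [leftDual_mul, mul_assoc]

lemma doubleMul_rightH (h : H) (z : DualCop k H ⊗[k] H) :
    doubleMul k H ((LinearMap.mulRight k h).lTensor _ z) = doubleMul k H z * leftH h := by
  induction z using TensorProduct.induction_on with
  | zero => simp
  | add s s' hs hs' => simp only [map_add, add_mul, hs, hs']
  | tmul g y => simp [leftH_mul, mul_assoc]

lemma leftH_tmul (h y : H) (f : DualCop k H) :
    leftH h (f ⊗ₜ[k] y) = (LinearMap.mulRight k y).lTensor _ (leftH h (f ⊗ₜ 1)) := by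
  simp only [leftH, LinearMap.comp_apply]
  induction comul₃ k H h using TensorProduct.induction_on with
  | zero => simp
  | add s s' hs hs' => simp only [map_add, LinearMap.add_apply, hs, hs']
  | tmul p t =>
    induction t using TensorProduct.induction_on with
    | zero => simp
    | add s s' hs hs' => simp only [map_add, LinearMap.add_apply, tmul_add, hs, hs']
    | tmul q r => simp

lemma doubleMul_assoc (d d' : DualCop k H ⊗[k] H) :
    doubleMul k H (doubleMul k H d d') = doubleMul k H d * doubleMul k H d' := by
  induction d using TensorProduct.induction_on with
  | zero => simp
  | add s s' hs hs' => simp only [map_add, add_mul, LinearMap.add_apply, hs, hs']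
  | tmul f h =>
    induction d' using TensorProduct.induction_on with
    | zero => simp
    | add s s' hs hs' => simp only [map_add, mul_add, hs, hs']
    | tmul f' h' =>
      rw [doubleMul_tmul, Module.End.mul_apply, doubleMul_leftDual, leftH_tmul, doubleMul_rightH,
        ← leftH_leftDual, doubleMul_tmul]
      simp only [mul_assoc]

end

section

open DualCop

lemma leftH_one_tmul [FiniteDimensional k H] (h : H) :
    leftH h ((1 : DualCop k H) ⊗ₜ[k] (1 : H)) = (1 : DualCop k H) ⊗ₜ[k] h := by
  have h1 : ∀ p r : H, coadj p r (1 : DualCop k H) = (counit (R := k) p * counit (R := k) r) • 1 := by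
    intro p r
    ext x
    simp [pairing_coadj, pairing_one, counit_antipodeInv]
    ring
  have h2 : ∀ q : H, (TensorProduct.rid k H) ((counit (R := k)).lTensor H (comul q)) = q := by
    intro q; simp
  have h3 : TensorProduct.lid k H ((counit (R := k)).rTensor H (comul (R := k) h)) = h := by simp
  conv_rhs => rw [← h3]
  simp only [leftH, LinearMap.comp_apply, comul₃]
  induction comul (R := k) h using TensorProduct.induction_on with
  | zero => simp
  | add s s' hs hs' => simp only [map_add, LinearMap.add_apply, tmul_add, hs, hs']
  | tmul p b =>
    simp only [LinearMap.rTensor_tmul, LinearMap.lTensor_tmul]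
    conv_rhs => rw [← h2 b]
    induction comul (R := k) b using TensorProduct.induction_on with
    | zero => simp
    | add s s' hs hs' => simp only [map_add, LinearMap.add_apply, tmul_add, hs, hs']
    | tmul q r => simp [h1, smul_tmul', mul_comm]

/-- Evaluation of both functional components of an element of `D(H) ⊗ D(H)`. -/
def contr₂ (x y : H) : (DualCop k H ⊗[k] H) ⊗[k] (DualCop k H ⊗[k] H) →ₗ[k] H ⊗[k] H :=
  TensorProduct.map (contr x) (contr y)

lemma contr₂_ext [FiniteDimensional k H] {s t : (DualCop k H ⊗[k] H) ⊗[k] (DualCop k H ⊗[k] H)}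
    (h : ∀ x y : H, contr₂ x y s = contr₂ x y t) : s = t := by
  have key : ∀ (x y : H) (s : (DualCop k H ⊗[k] H) ⊗[k] (DualCop k H ⊗[k] H)),
      contr y (contr x (TensorProduct.assoc k _ _ _
        (TensorProduct.tensorTensorTensorComm k (DualCop k H) H (DualCop k H) H s))) =
        contr₂ x y s := by
    intro x y s
    induction s using TensorProduct.induction_on with
    | zero => simp
    | add s s' hs hs' => simp only [map_add, hs, hs']
    | tmul d d' =>
      induction d using TensorProduct.induction_on with
      | zero => simp
      | add s s' hs hs' => simp only [map_add, add_tmul, hs, hs']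
      | tmul f a =>
        induction d' using TensorProduct.induction_on with
        | zero => simp
        | add s s' hs hs' => simp only [map_add, tmul_add, hs, hs']
        | tmul g b => simp [contr₂, smul_tmul', smul_smul, mul_comm]
  refine (TensorProduct.tensorTensorTensorComm k (DualCop k H) H (DualCop k H) H).injective
    ((TensorProduct.assoc k _ _ _).injective (contr_ext fun x => contr_ext fun y => ?_))
  rw [key, key, h]

lemma contr₂_tttc (x y : H) (s : DualCop k H ⊗[k] DualCop k H) (u : H ⊗[k] H) :
    contr₂ x y (TensorProduct.tensorTensorTensorComm k (DualCop k H) (DualCop k H) H H (s ⊗ₜ u)) =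
      pairing k H (contr x s) y • u := by
  induction s using TensorProduct.induction_on with
  | zero => simp
  | add s s' hs hs' => simp only [map_add, add_tmul, LinearMap.add_apply, add_smul, hs, hs']
  | tmul f g =>
    induction u using TensorProduct.induction_on with
    | zero => simp
    | add s s' hs hs' => simp only [map_add, tmul_add, smul_add, hs, hs']
    | tmul a b => simp [contr₂, smul_tmul', smul_smul, mul_comm, tmul_smul]

lemma contr₂_act [FiniteDimensional k H] (x y p q r p' q' r' : H)
    (s : DualCop k H ⊗[k] DualCop k H) (u : H ⊗[k] H) :
    contr₂ x y (TensorProduct.map (act₃ (p ⊗ₜ (q ⊗ₜ r))) (act₃ (p' ⊗ₜ (q' ⊗ₜ r')))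
      (TensorProduct.tensorTensorTensorComm k (DualCop k H) (DualCop k H) H H (s ⊗ₜ u))) =
      pairing k H (contr (antipodeInv k H r * (x * p)) s) (antipodeInv k H r' * (y * p')) •
        ((q ⊗ₜ q') * u) := by
  induction s using TensorProduct.induction_on with
  | zero => simp
  | add s s' hs hs' => simp only [map_add, add_tmul, LinearMap.add_apply, add_smul, hs, hs']
  | tmul f g =>
    induction u using TensorProduct.induction_on with
    | zero => simp
    | add s s' hs hs' => simp only [map_add, tmul_add, smul_add, mul_add, hs, hs']
    | tmul a b => simp [contr₂, smul_tmul', smul_smul, mul_comm, tmul_smul, pairing_coadj]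

/-- The key compatibility: `Δ(h z) = Δ(h) Δ(z)`. -/
lemma comul_leftH [FiniteDimensional k H] (h : H) (z : DualCop k H ⊗[k] H) :
    comul (R := k) (leftH h z) =
      TensorProduct.lift ((TensorProduct.mapBilinear (RingHom.id k) (DualCop k H ⊗[k] H) (DualCop k H ⊗[k] H)
        (DualCop k H ⊗[k] H) (DualCop k H ⊗[k] H)).compl₁₂ leftH leftH) (comul (R := k) h)
        (comul (R := k) z) := by
  induction z using TensorProduct.induction_on with
  | zero => simp
  | add s s' hs hs' => simp only [map_add, hs, hs']
  | tmul f v =>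
  refine contr₂_ext fun x y => ?_
  have hc : ∀ (g : DualCop k H) (w : H), comul (R := k) (g ⊗ₜ[k] w) =
      TensorProduct.tensorTensorTensorComm k (DualCop k H) (DualCop k H) H H
        (comul g ⊗ₜ comul w) := fun _ _ => rfl
  rw [hc]
  set u := comul (R := k) v with hu
  set φ := pairing k H f with hφ
  obtain ⟨K, hK⟩ : ∃ K : (H ⊗[k] (H ⊗[k] H)) ⊗[k] (H ⊗[k] (H ⊗[k] H)) →ₗ[k] H ⊗[k] H,
      ∀ p q r p' q' r' : H, K ((p ⊗ₜ (q ⊗ₜ r)) ⊗ₜ (p' ⊗ₜ (q' ⊗ₜ r'))) =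
        φ (antipodeInv k H r' * (y * p') * (antipodeInv k H r * (x * p))) • ((q ⊗ₜ q') * u) := by
    let w (x : H) : H ⊗[k] (H ⊗[k] H) →ₗ[k] H ⊗[k] H :=
      (LinearMap.mul' k H ∘ₗ (TensorProduct.comm k H H).toLinearMap ∘ₗ
        TensorProduct.map (LinearMap.mulLeft k x) (antipodeInv k H)).rTensor H ∘ₗ
      (TensorProduct.assoc k H H H).symm.toLinearMap ∘ₗ
      (TensorProduct.comm k H H).toLinearMap.lTensor H
    refine ⟨(TensorProduct.lid k _).toLinearMap ∘ₗ
      TensorProduct.map (φ ∘ₗ LinearMap.mul' k H ∘ₗ (TensorProduct.comm k H H).toLinearMap)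
        (LinearMap.mulRight k u) ∘ₗ
      (TensorProduct.tensorTensorTensorComm k H H H H).toLinearMap ∘ₗ
      TensorProduct.map (w x) (w y), ?_⟩
    intros
    simp [w]
  obtain ⟨M, hM⟩ : ∃ M : (H ⊗[k] H) ⊗[k] (H ⊗[k] H) →ₗ[k] H ⊗[k] H,
      ∀ a b c d : H, M ((a ⊗ₜ b) ⊗ₜ (c ⊗ₜ d)) =
        φ (antipodeInv k H d * (y * x * a)) • ((b ⊗ₜ c) * u) := by
    refine ⟨(TensorProduct.lid k _).toLinearMap ∘ₗ
      TensorProduct.map (φ ∘ₗ LinearMap.mul' k H ∘ₗ (TensorProduct.comm k H H).toLinearMap ∘ₗ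
        TensorProduct.map (LinearMap.mulLeft k (y * x)) (antipodeInv k H))
        (LinearMap.mulRight k u) ∘ₗ
      (TensorProduct.tensorTensorTensorComm k H H H H).toLinearMap ∘ₗ
      (TensorProduct.comm k H H).toLinearMap.lTensor _, ?_⟩
    intros
    simp [mul_assoc]
  have e1 : contr₂ x y (comul (R := k) (leftH h (f ⊗ₜ v))) =
      M (TensorProduct.map comul comul (comul (R := k) h)) := by
    rw [← splitMid_comul₃]
    simp only [leftH, LinearMap.comp_apply]
    induction comul₃ k H h using TensorProduct.induction_on with
    | zero => simp
    | add s s' hs hs' => simp only [map_add, LinearMap.add_apply, hs, hs']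
    | tmul p t =>
    induction t using TensorProduct.induction_on with
    | zero => simp
    | add s s' hs hs' => simp only [map_add, LinearMap.add_apply, tmul_add, hs, hs']
    | tmul q r =>
    rw [act₃_tmul, hc, contr₂_tttc, pairing_comul, pairing_coadj, Bialgebra.comul_mul, ← hu, ← hφ]
    simp only [splitMid, LinearMap.comp_apply, LinearMap.lTensor_tmul, LinearMap.rTensor_tmul]
    induction comul (R := k) q using TensorProduct.induction_on with
    | zero => simp
    | add s s' hs hs' => simp only [map_add, add_mul, add_tmul, tmul_add, smul_add, hs, hs']
    | tmul b c => simp [hM, mul_assoc]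
  have e2 : ∀ t : H ⊗[k] H, contr₂ x y (TensorProduct.lift ((TensorProduct.mapBilinear (RingHom.id k)
        (DualCop k H ⊗[k] H) (DualCop k H ⊗[k] H)
        (DualCop k H ⊗[k] H) (DualCop k H ⊗[k] H)).compl₁₂ leftH leftH) t
      (TensorProduct.tensorTensorTensorComm k (DualCop k H) (DualCop k H) H H
        (comul f ⊗ₜ u))) = K (TensorProduct.map (comul₃ k H) (comul₃ k H) t) := by
    intro t
    induction t using TensorProduct.induction_on with
    | zero => simp
    | add s s' hs hs' => simp only [map_add, LinearMap.add_apply, hs, hs']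
    | tmul a b =>
    simp only [leftH, map_tmul, TensorProduct.lift.tmul, LinearMap.compl₁₂_apply,
      TensorProduct.mapBilinear_apply, LinearMap.comp_apply]
    induction comul₃ k H a using TensorProduct.induction_on with
    | zero => simp
    | add s s' hs hs' => simp only [map_add, map_add_left, LinearMap.add_apply, add_tmul, hs, hs']
    | tmul p t =>
    induction t using TensorProduct.induction_on with
    | zero => simp
    | add s s' hs hs' =>
      simp only [map_add, map_add_left, LinearMap.add_apply, add_tmul, tmul_add, hs, hs']
    | tmul q r =>
    induction comul₃ k H b using TensorProduct.induction_on with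
    | zero => simp
    | add s s' hs hs' => simp only [map_add, map_add_right, LinearMap.add_apply, tmul_add, hs, hs']
    | tmul p' t =>
    induction t using TensorProduct.induction_on with
    | zero => simp
    | add s s' hs hs' => simp only [map_add, map_add_right, LinearMap.add_apply, tmul_add, hs, hs']
    | tmul q' r' =>
    rw [contr₂_act, pairing_comul, hK]
  have e3 : TensorProduct.map (comul₃ k H) (comul₃ k H) (comul (R := k) h) =
      TensorProduct.map ((TensorProduct.assoc k H H H).toLinearMap ∘ₗ comul.rTensor H)
        (comul.lTensor H) (splitMid k H (comul₃ k H h)) := by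
    have h1 : comul₃ k H = ((TensorProduct.assoc k H H H).toLinearMap ∘ₗ comul.rTensor H) ∘ₗ
      comul := by rw [LinearMap.comp_assoc, Coalgebra.coassoc]; rfl
    rw [splitMid_comul₃, TensorProduct.map_map, ← h1]
    rfl
  have e4 : ∀ p q r : H, K (TensorProduct.map ((TensorProduct.assoc k H H H).toLinearMap ∘ₗ
      comul.rTensor H) (comul.lTensor H) (splitMid k H (p ⊗ₜ (q ⊗ₜ r)))) =
      counit (R := k) q • M (comul p ⊗ₜ comul r) := by
    intro p q r
    have hq := mul_antipodeInv (k := k) q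
    simp only [← (ℛ k q).eq, map_sum, comm_tmul, LinearMap.lTensor_tmul, LinearMap.mul'_apply] at hq
    have h0 : K (TensorProduct.map ((TensorProduct.assoc k H H H).toLinearMap ∘ₗ
        comul.rTensor H) (comul.lTensor H) (splitMid k H (p ⊗ₜ (q ⊗ₜ r)))) =
        ∑ i ∈ (ℛ k q).index, K (TensorProduct.assoc k H H H (comul p ⊗ₜ (ℛ k q).left i) ⊗ₜ
          ((ℛ k q).right i ⊗ₜ comul r)) := by
      simp only [splitMid, LinearMap.comp_apply, LinearMap.lTensor_tmul, LinearMap.rTensor_tmul]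
      conv_lhs => rw [← (ℛ k q).eq]
      simp [sum_tmul, tmul_sum]
    rw [h0]
    induction comul (R := k) p using TensorProduct.induction_on with
    | zero => simp
    | add s s' hs hs' => simp only [map_add, add_tmul, smul_add, Finset.sum_add_distrib, hs, hs']
    | tmul p₁ p₂ =>
    induction comul (R := k) r using TensorProduct.induction_on with
    | zero => simp
    | add s s' hs hs' => simp only [map_add, tmul_add, smul_add, Finset.sum_add_distrib, hs, hs']
    | tmul r₁ r₂ =>
    simp only [TensorProduct.assoc_tmul, hK, hM, ← Finset.sum_smul, ← map_sum, smul_smul]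
    congr 1
    have h2 : ∀ i, antipodeInv k H r₂ * (y * (ℛ k q).right i) *
        (antipodeInv k H ((ℛ k q).left i) * (x * p₁)) = antipodeInv k H r₂ * y *
        ((ℛ k q).right i * antipodeInv k H ((ℛ k q).left i)) * (x * p₁) := by
      intro i; simp only [mul_assoc]
    simp only [h2, ← Finset.sum_mul, ← Finset.mul_sum, hq]
    simp [Algebra.algebraMap_eq_smul_one, mul_assoc]
  rw [e1, e2, e3]
  have e5 : TensorProduct.map comul comul (comul (R := k) h) = TensorProduct.map comul comul
      ((TensorProduct.lid k H).toLinearMap.lTensor H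
        (((counit (R := k)).rTensor H).lTensor H (comul₃ k H h))) := by
    simp only [comul₃, LinearMap.comp_apply, ← LinearMap.lTensor_comp_apply,
      Coalgebra.rTensor_counit_comp_comul]
    congr 1
    symm
    hopf_tensor_induction comul (R := k) h with a b
    simp
  rw [e5]
  induction comul₃ k H h using TensorProduct.induction_on with
  | zero => simp
  | add s s' hs hs' => simp only [map_add, hs, hs']
  | tmul p t =>
  induction t using TensorProduct.induction_on with
  | zero => simp
  | add s s' hs hs' => simp only [map_add, tmul_add, hs, hs']
  | tmul q r =>
  rw [e4]
  simp

end

section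

open DualCop

variable (k H) in
/-- The Drinfeld double `D(H)`, with underlying coalgebra `H^{*cop} ⊗ H`. -/
def DrinfeldDouble : Type (max u v) := DualCop k H ⊗[k] H

namespace DrinfeldDouble

instance : AddCommGroup (DrinfeldDouble k H) := inferInstanceAs (AddCommGroup (DualCop k H ⊗[k] H))
instance : Module k (DrinfeldDouble k H) := inferInstanceAs (Module k (DualCop k H ⊗[k] H))

/-- The element `f ⊗ h` of the double. -/
def tmul (f : DualCop k H) (h : H) : DrinfeldDouble k H := (f ⊗ₜ[k] h : DualCop k H ⊗[k] H)

variable [FiniteDimensional k H]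

instance : Mul (DrinfeldDouble k H) := ⟨fun d d' => doubleMul k H d d'⟩
instance : One (DrinfeldDouble k H) := ⟨tmul 1 1⟩

instance : Ring (DrinfeldDouble k H) where
  left_distrib a b c := map_add (doubleMul k H a) b c
  right_distrib a b c := congr($(map_add (doubleMul k H) a b) c)
  zero_mul a := congr($(map_zero (doubleMul k H)) a)
  mul_zero a := map_zero (doubleMul k H a)
  mul_assoc a b c := congr($(doubleMul_assoc a b) c)
  one_mul a := by
    change doubleMul k H ((1 : DualCop k H) ⊗ₜ (1 : H)) a = a
    rw [doubleMul_tmul, leftDual_one, leftH_one]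
    rfl
  mul_one a := by
    change doubleMul k H a ((1 : DualCop k H) ⊗ₜ (1 : H)) = a
    induction a using TensorProduct.induction_on with
    | zero => simp
    | add s s' hs hs' =>
      conv_rhs => rw [← hs, ← hs']
      simp only [map_add, LinearMap.add_apply]
    | tmul f h =>
      rw [doubleMul_tmul, Module.End.mul_apply, leftH_one_tmul, leftDual_tmul, mul_one]
  neg_add_cancel := neg_add_cancel
  zsmul := fun n a => n • a
  zsmul_zero' := SubNegMonoid.zsmul_zero'
  zsmul_succ' := SubNegMonoid.zsmul_succ'
  zsmul_neg' := SubNegMonoid.zsmul_neg'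
  nsmul := fun n a => n • a
  nsmul_zero := AddMonoid.nsmul_zero
  nsmul_succ := AddMonoid.nsmul_succ

instance : Algebra k (DrinfeldDouble k H) := Algebra.ofModule
  (fun r a b => congr($(map_smul (doubleMul k H) r a) b))
  (fun r a b => map_smul (doubleMul k H a) r b)

instance : Coalgebra k (DrinfeldDouble k H) :=
  inferInstanceAs (Coalgebra k (DualCop k H ⊗[k] H))

instance : Module.Finite k (DrinfeldDouble k H) :=
  inferInstanceAs (Module.Finite k (DualCop k H ⊗[k] H))

lemma tmul_mul_tmul (f f' : DualCop k H) (h h' : H) :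
    tmul f h * tmul f' h' = ∑ i ∈ (ℛ k h).index, ∑ j ∈ (ℛ k ((ℛ k h).right i)).index,
      tmul (f * coadj ((ℛ k h).left i) ((ℛ k ((ℛ k h).right i)).right j) f')
        ((ℛ k ((ℛ k h).right i)).left j * h') := by
  change doubleMul k H (f ⊗ₜ[k] h) (f' ⊗ₜ[k] h') = _
  rw [doubleMul_tmul, Module.End.mul_apply, leftH, LinearMap.comp_apply, comul₃,
    LinearMap.comp_apply]
  conv_lhs => rw [← (ℛ k h).eq]
  simp only [map_sum, LinearMap.lTensor_tmul, LinearMap.sum_apply]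
  refine Finset.sum_congr rfl fun i _ => ?_
  conv_lhs => rw [← (ℛ k ((ℛ k h).right i)).eq]
  simp only [tmul_sum, map_sum, LinearMap.sum_apply, act₃_tmul, leftDual_tmul]
  rfl

lemma one_tmul_mul (h : H) (z : DrinfeldDouble k H) :
    tmul 1 h * z = (leftH (k := k) h z : DualCop k H ⊗[k] H) := by
  change doubleMul k H ((1 : DualCop k H) ⊗ₜ h) z = _
  rw [doubleMul_tmul, leftDual_one, one_mul]

lemma tmul_one_mul_tmul (f g : DualCop k H) (y : H) : tmul f 1 * tmul g y = tmul (f * g) y := by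
  change doubleMul k H (f ⊗ₜ (1 : H)) (g ⊗ₜ y) = _
  rw [doubleMul_tmul, leftH_one, mul_one]
  rfl

lemma tmul_eq_mul (f : DualCop k H) (h : H) : tmul f h = tmul f 1 * tmul 1 h := by
  rw [tmul_one_mul_tmul, mul_one]

lemma one_tmul_mul_tmul (h h' : H) :
    (tmul 1 h * tmul 1 h' : DrinfeldDouble k H) = tmul 1 (h * h') := by
  refine (one_tmul_mul h _).trans ?_
  have := leftH_tmul (k := k) h h' 1
  rw [leftH_one_tmul] at this
  exact this

/-- The embedding of `H`. -/
def inclH : H →ₗ[k] DrinfeldDouble k H := TensorProduct.mk k (DualCop k H) H 1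

/-- The embedding of `H^{*cop}`. -/
def inclDual : DualCop k H →ₗ[k] DrinfeldDouble k H := (TensorProduct.mk k (DualCop k H) H).flip 1

@[elab_as_elim]
lemma induction_on {p : DrinfeldDouble k H → Prop} (z : DrinfeldDouble k H) (zero : p 0)
    (tmul : ∀ f h, p (tmul f h)) (add : ∀ x y, p x → p y → p (x + y)) : p z :=
  TensorProduct.induction_on (motive := p) z zero tmul add

/-- reassembling `(f ⊗ g) ⊗ (a ⊗ b)` as `(f ⊗ a) ⊗ (g ⊗ b)` -/
def tttc : (DualCop k H ⊗[k] DualCop k H) ⊗[k] (H ⊗[k] H) →ₗ[k]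
    DrinfeldDouble k H ⊗[k] DrinfeldDouble k H :=
  (TensorProduct.tensorTensorTensorComm k (DualCop k H) (DualCop k H) H H).toLinearMap

lemma tttc_tmul (f g : DualCop k H) (a b : H) :
    tttc ((f ⊗ₜ[k] g) ⊗ₜ[k] (a ⊗ₜ[k] b)) = tmul f a ⊗ₜ[k] tmul g b := rfl

lemma comul_tmul (f : DualCop k H) (h : H) :
    comul (R := k) (tmul f h) = tttc (comul (R := k) f ⊗ₜ[k] comul (R := k) h) := rfl

lemma counit_tmul (f : DualCop k H) (h : H) :
    counit (R := k) (tmul f h) = counit (R := k) f * counit (R := k) h := by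
  refine (TensorProduct.counit_tmul (R := k) (S := k) f h).trans ?_
  rw [smul_eq_mul, mul_comm]

lemma comul_one_tmul_mul (h : H) (z : DrinfeldDouble k H) :
    comul (R := k) (tmul 1 h * z) = comul (tmul 1 h) * comul z := by
  rw [comul_tmul]
  refine (congr(comul (R := k) $(one_tmul_mul h z))).trans ((comul_leftH h z).trans ?_)
  rw [Bialgebra.comul_one, Algebra.TensorProduct.one_def]
  generalize comul (R := k) h = t
  have key : ∀ w : DrinfeldDouble k H ⊗[k] DrinfeldDouble k H,
      TensorProduct.lift ((TensorProduct.mapBilinear (RingHom.id k) (DualCop k H ⊗[k] H)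
        (DualCop k H ⊗[k] H) (DualCop k H ⊗[k] H) (DualCop k H ⊗[k] H)).compl₁₂ leftH leftH) t w =
      tttc (((1 : DualCop k H) ⊗ₜ[k] (1 : DualCop k H)) ⊗ₜ[k] t) * w := by
    intro w
    induction t using TensorProduct.induction_on with
    | zero => rw [map_zero, tmul_zero, map_zero, zero_mul]; rfl
    | add s s' hs hs' =>
      rw [tmul_add, map_add, map_add, add_mul, ← hs, ← hs']
      rfl
    | tmul a b =>
    induction w using TensorProduct.induction_on with
    | zero =>
      rw [mul_zero]
      exact map_zero _
    | add s s' hs hs' =>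
      rw [mul_add, ← hs, ← hs']
      exact map_add _ s s'
    | tmul d d' =>
      rw [tttc_tmul, Algebra.TensorProduct.tmul_mul_tmul]
      exact congr_arg₂ (· ⊗ₜ[k] ·) (one_tmul_mul a d).symm (one_tmul_mul b d').symm
  exact key _

lemma comul_tmul_one_mul (f : DualCop k H) (z : DrinfeldDouble k H) :
    comul (R := k) (tmul f 1 * z) = comul (tmul f 1) * comul z := by
  induction z using induction_on with
  | zero => simp
  | add x y hx hy => simp only [map_add, mul_add, hx, hy]
  | tmul g y =>
  rw [tmul_one_mul_tmul, comul_tmul, comul_tmul, comul_tmul, Bialgebra.comul_mul, Bialgebra.comul_one,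
    Algebra.TensorProduct.one_def]
  generalize comul (R := k) f = s
  generalize comul (R := k) g = t
  generalize comul (R := k) y = u
  induction s using TensorProduct.induction_on with
  | zero => simp
  | add s s' hs hs' => simp only [map_add, add_tmul, add_mul, hs, hs']
  | tmul a b =>
  induction t using TensorProduct.induction_on with
  | zero => simp
  | add s s' hs hs' => simp only [map_add, add_tmul, mul_add, hs, hs']
  | tmul c d =>
  induction u using TensorProduct.induction_on with
  | zero => simp
  | add s s' hs hs' => simp only [map_add, tmul_add, mul_add, hs, hs']
  | tmul y z => simp only [Algebra.TensorProduct.tmul_mul_tmul, tttc_tmul, tmul_one_mul_tmul]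

lemma comul_mul (d d' : DrinfeldDouble k H) :
    comul (R := k) (d * d') = comul d * comul d' := by
  induction d using induction_on with
  | zero => simp
  | add x y hx hy => simp only [map_add, add_mul, hx, hy]
  | tmul f h =>
  rw [tmul_eq_mul, mul_assoc, comul_tmul_one_mul, comul_one_tmul_mul, comul_tmul_one_mul,
    mul_assoc]

lemma counit_mul (d d' : DrinfeldDouble k H) :
    counit (R := k) (d * d') = counit d * counit d' := by
  have h1 : ∀ (f : DualCop k H) (z : DrinfeldDouble k H),
      counit (R := k) (tmul f 1 * z) = counit f * counit z := by
    intro f z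
    induction z using induction_on with
    | zero => simp
    | add x y hx hy => simp only [map_add, mul_add, hx, hy]
    | tmul g y =>
    simp [tmul_one_mul_tmul, counit_tmul, mul_assoc]
  have h2 : ∀ (h : H) (z : DrinfeldDouble k H),
      counit (R := k) (tmul 1 h * z) = counit h * counit z := by
    intro h z
    induction z using induction_on with
    | zero => simp
    | add x y hx hy => simp only [map_add, mul_add, hx, hy]
    | tmul g y =>
    refine (congr(counit (R := k) $(one_tmul_mul h (tmul g y)))).trans ?_
    have h3 : ∀ (g : DualCop k H) (y : H), counit (R := k) (g ⊗ₜ[k] y) = counit g * counit y :=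
      counit_tmul
    change counit (R := k) (leftH h (g ⊗ₜ[k] y)) = _
    have h4 : counit (R := k) (leftH h (g ⊗ₜ[k] y)) =
        pairing k H g (LinearMap.mul' k H ((antipodeInv k H).rTensor H
          (TensorProduct.comm k H H (comul h)))) * counit y := by
      have h5 : comul (R := k) h = (TensorProduct.lid k H).toLinearMap.lTensor H
          (((counit (R := k)).rTensor H).lTensor H (comul₃ k H h)) := by
        simp only [comul₃, LinearMap.comp_apply, ← LinearMap.lTensor_comp_apply,
          Coalgebra.rTensor_counit_comp_comul]
        symm
        hopf_tensor_induction comul (R := k) h with a b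
        simp
      rw [h5]
      simp only [leftH, LinearMap.comp_apply]
      induction comul₃ k H h using TensorProduct.induction_on with
      | zero => simp
      | add s s' hs hs' => simp only [map_add, LinearMap.add_apply, add_mul, hs, hs']
      | tmul p t =>
      induction t using TensorProduct.induction_on with
      | zero => simp
      | add s s' hs hs' => simp only [map_add, tmul_add, LinearMap.add_apply, add_mul, hs, hs']
      | tmul q r =>
      rw [act₃_tmul, h3]
      simp [DualCop.counit_apply, pairing_coadj]
      ring
    rw [h4, antipodeInv_mul_self, counit_tmul, DualCop.counit_apply]
    simp [Algebra.algebraMap_eq_smul_one, mul_assoc]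
  induction d using induction_on with
  | zero => simp
  | add x y hx hy => simp only [map_add, add_mul, hx, hy]
  | tmul f h =>
  rw [tmul_eq_mul, mul_assoc, h1, h2, h1, counit_tmul, Bialgebra.counit_one, one_mul, mul_assoc]

instance : Bialgebra k (DrinfeldDouble k H) := Bialgebra.mk' k _
  (by
    change counit (R := k) (tmul (1 : DualCop k H) (1 : H)) = 1
    simp [counit_tmul])
  (fun {d d'} => counit_mul d d')
  (by
    change comul (R := k) (tmul (1 : DualCop k H) (1 : H)) = _
    simp [comul_tmul, Algebra.TensorProduct.one_def, tttc_tmul]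
    rfl)
  (fun {d d'} => comul_mul d d')

/-- `S(f ⊗ h) = S(h) S(f)`. -/
def antip : DrinfeldDouble k H →ₗ[k] DrinfeldDouble k H :=
  LinearMap.mul' k (DrinfeldDouble k H) ∘ₗ
    TensorProduct.map (inclH ∘ₗ antipode k) (inclDual ∘ₗ antipode k) ∘ₗ
    (TensorProduct.comm k (DualCop k H) H).toLinearMap

lemma antip_tmul (f : DualCop k H) (h : H) :
    antip (tmul f h) = tmul 1 (antipode k h) * tmul (antipode k f) 1 := rfl

lemma inclH_apply (h : H) : inclH (k := k) h = tmul 1 h := rfl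
lemma inclDual_apply (f : DualCop k H) : inclDual f = tmul f 1 := rfl

lemma antip_rTensor (s : DualCop k H ⊗[k] DualCop k H) (a b : H) :
    LinearMap.mul' k _ (antip.rTensor _ (tttc (s ⊗ₜ[k] (a ⊗ₜ[k] b)))) =
      tmul 1 (antipode k a) *
        (inclDual (LinearMap.mul' k _ ((antipode k).rTensor _ s)) * tmul 1 b) := by
  induction s using TensorProduct.induction_on with
  | zero => simp
  | add s s' hs hs' => simp only [map_add, add_tmul, mul_add, add_mul, hs, hs']
  | tmul f g =>
    rw [tttc_tmul, LinearMap.rTensor_tmul, LinearMap.mul'_apply, LinearMap.rTensor_tmul,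
      LinearMap.mul'_apply, antip_tmul, tmul_eq_mul g b, inclDual_apply, ← tmul_one_mul_tmul]
    simp only [mul_assoc]

lemma antip_lTensor (f g : DualCop k H) (t : H ⊗[k] H) :
    LinearMap.mul' k _ (antip.lTensor _ (tttc ((f ⊗ₜ[k] g) ⊗ₜ[k] t))) =
      tmul f 1 * (inclH (LinearMap.mul' k _ ((antipode k).lTensor _ t)) *
        tmul (antipode k g) 1) := by
  induction t using TensorProduct.induction_on with
  | zero => simp
  | add s s' hs hs' => simp only [map_add, tmul_add, mul_add, add_mul, hs, hs']
  | tmul a b =>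
    rw [tttc_tmul, LinearMap.lTensor_tmul, LinearMap.mul'_apply, LinearMap.lTensor_tmul,
      LinearMap.mul'_apply, antip_tmul, tmul_eq_mul f a, inclH_apply, ← one_tmul_mul_tmul]
    simp only [mul_assoc]

instance : HopfAlgebra k (DrinfeldDouble k H) where
  antipode := antip
  mul_antipode_rTensor_comul := by
    refine TensorProduct.ext' fun f h => ?_
    change LinearMap.mul' k _ (antip.rTensor _ (comul (R := k) (tmul f h))) =
      algebraMap k _ (counit (tmul f h))
    have e : ∀ t : H ⊗[k] H, LinearMap.mul' k _ (antip.rTensor _ (tttc (comul (R := k) f ⊗ₜ[k] t))) =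
        counit (R := k) f • inclH (LinearMap.mul' k _ ((antipode k).rTensor _ t)) := by
      intro t
      induction t using TensorProduct.induction_on with
      | zero => simp
      | add s s' hs hs' => simp only [map_add, tmul_add, smul_add, hs, hs']
      | tmul a b =>
        rw [antip_rTensor, mul_antipode_rTensor_comul_apply, Algebra.algebraMap_eq_smul_one,
          map_smul, inclDual_apply, smul_mul_assoc, mul_smul_comm, tmul_one_mul_tmul, one_mul,
          one_tmul_mul_tmul]
        rfl
    rw [comul_tmul, e, mul_antipode_rTensor_comul_apply, counit_tmul, Algebra.algebraMap_eq_smul_one,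
      Algebra.algebraMap_eq_smul_one, map_smul, smul_smul]
    rfl
  mul_antipode_lTensor_comul := by
    refine TensorProduct.ext' fun f h => ?_
    change LinearMap.mul' k _ (antip.lTensor _ (comul (R := k) (tmul f h))) =
      algebraMap k _ (counit (tmul f h))
    have e : ∀ t : DualCop k H ⊗[k] DualCop k H,
        LinearMap.mul' k _ (antip.lTensor _ (tttc (t ⊗ₜ[k] comul (R := k) h))) =
        counit (R := k) h • inclDual (LinearMap.mul' k _ ((antipode k).lTensor _ t)) := by
      intro t
      induction t using TensorProduct.induction_on with
      | zero => simp
      | add s s' hs hs' => simp only [map_add, add_tmul, smul_add, hs, hs']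
      | tmul a b =>
        rw [antip_lTensor, mul_antipode_lTensor_comul_apply, Algebra.algebraMap_eq_smul_one,
          map_smul, inclH_apply, smul_mul_assoc, mul_smul_comm, tmul_one_mul_tmul, one_mul,
          tmul_one_mul_tmul]
        rfl
    rw [comul_tmul, e, mul_antipode_lTensor_comul_apply, counit_tmul, Algebra.algebraMap_eq_smul_one,
      Algebra.algebraMap_eq_smul_one, map_smul, smul_smul, mul_comm]
    rfl

end DrinfeldDouble

end

section Indicator

variable (k H) in
/-- The `m`-th Sweedler power map `P^{(m)}`, the `m`-fold convolution power of the identity: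
`P^{(0)}(h) = ε(h) 1` and `P^{(m)}(h) = h₍₁₎ h₍₂₎ ⋯ h₍ₘ₎`. -/
def sweedlerPower (m : ℕ) : H →ₗ[k] H :=
  (WithConv.toConv (LinearMap.id : H →ₗ[k] H) ^ m).ofConv

lemma sweedlerPower_zero_apply (h : H) :
    sweedlerPower k H 0 h = algebraMap k H (counit (R := k) h) := by
  simp [sweedlerPower]

lemma sweedlerPower_succ_apply (m : ℕ) (h : H) :
    sweedlerPower k H (m + 1) h =
      ∑ i ∈ (ℛ k h).index, sweedlerPower k H m ((ℛ k h).left i) * (ℛ k h).right i := by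
  simp only [sweedlerPower, pow_succ]
  change LinearMap.mul' k H (TensorProduct.map _ _ (comul (R := k) h)) = _
  conv_lhs => rw [← (ℛ k h).eq]
  simp

variable (k H) in
/-- The `n`-th indicator `ν_n(H) = Tr(S ∘ P^{(n-1)})`, for `n ≥ 1`. -/
def indicator (n : ℕ) : k := LinearMap.trace k H (antipode k ∘ₗ sweedlerPower k H (n - 1))

variable (k) in
/-- The subring `𝒪_N` of an algebraic closure of `k` generated by the roots of `X ^ N - 1`. -/
def cyclotomicSubring (N : ℕ) : Subring (AlgebraicClosure k) :=
  Subring.closure {ω | ω ^ N = 1}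

/-- `σ` is the conjugation `z ↦ z̄` of `𝒪_N`: it is a ring automorphism and inverts the roots of
`X ^ N - 1` (hence `σ (a₁ ω₁ + ⋯ + aₘ ωₘ) = a₁ ω₁⁻¹ + ⋯ + aₘ ωₘ⁻¹` for integers `aᵢ`). -/
def IsBar {N : ℕ} (σ : cyclotomicSubring k N ≃+* cyclotomicSubring k N) : Prop :=
  ∀ z : cyclotomicSubring k N, z ^ N = 1 → (σ z : AlgebraicClosure k) = (z : AlgebraicClosure k)⁻¹

variable (k H) in
/-- `N = n · (the order of S²)`. -/
def cyclotomicOrder (n : ℕ) : ℕ :=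
  n * orderOf (antipode k ∘ₗ antipode k : Module.End k H)

end Indicator

end HopfDouble

end

/-!
The indicator `ν_n(H)` is realized as the trace of an operator of finite order. Let `n = m + 1` and
let `H` act diagonally on `H^{⊗ n}`. The coinvariants of this action are identified with `H^{⊗ m}`
by `x ⊗ w ↦ S(x) · w` (`coinvProj`), and the twisted rotation `x ⊗ w ↦ w ⊗ S²(x)` of `H^{⊗ n}`
descends to an operator `rot` on `H^{⊗ m}`. The `n`-th power of the twisted rotation is
`S² ⊗ ⋯ ⊗ S²`, so that `rot ^ N = 1` for `N = n · ord(S²)` (`rot_pow_eq_one`). Eliminating one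
tensor factor at a time gives `Tr(rot) = ν_n(H)` and `Tr(rot⁻¹) = ν_n(H^{*cop})` (`indicator_succ`,
`indicator_dualCop`). Hence the eigenvalues `ωᵢ` of `rot` are roots of `X ^ N - 1` with
`ν_n(H) = ∑ ωᵢ` and `ν_n(H^{*cop}) = ∑ ωᵢ⁻¹`, over any field.

It remains to see that `ν_n(D(H)) = ν_n(H^{*cop}) ν_n(H)` (`indicator_drinfeldDouble`). Indicators
are multiplicative for tensor products (`indicator_tensor`), and `D(H)` and `H^{*cop} ⊗ H` have the same
coalgebra, while their multiplications differ by a cocycle, the evaluation pairing of `H^*` and `H`.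
Dually, `D(H)^{*cop}` is the twist of `(H^{*cop} ⊗ H)^{*cop}` by an element `J`
(`isTwist_dualDoubleEquiv`). A twist with `S(J⁽¹⁾) J⁽²⁾ = S⁻¹(J⁽²⁾) J⁽¹⁾` does not change the trace
of `rot⁻¹` (`trace_rotInv_eq_of_isTwist`): the iterated twist `Jₘ ∈ H^{⊗ m}`, multiplied by the element
`S(J⁽¹⁾) J⁽²⁾`, intertwines the two rotations. For the double, the condition on `J` says that the
functional `f ⊗ h ↦ f(S⁻¹(h))` is invariant under the antipode. Since `Tr(rot⁻¹)` on the dual of a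
Hopf algebra is the indicator of the Hopf algebra itself, the two indicators agree.

The conjugation of `𝒪_N` in characteristic zero exists because a primitive `N`-th root of unity and
its inverse have the same minimal polynomial, provided that `N ≠ 0`, that is, that `S²` has finite
order. This is Radford's theorem (`orderOf_antipode_sq_ne_zero`). It is proved by computing the
Nakayama automorphism of the Frobenius form of `H` in two ways from the two legs of `Δ(t)`, for a
left integral `t`: this expresses `S⁴` by the modular function `α` and the distinguished group-like
element `g`, which have finite order because group-like elements are linearly independent.
-/

noncomputable section

namespace HopfDouble

open TensorProduct Coalgebra HopfAlgebra WithConv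

universe u v w

/-! ### Tensor powers and their rotations -/

section TensorPowers

variable (k : Type u) (H : Type v) [Field k] [Ring H] [Algebra k H]

/-- The tensor powers `H^{⊗ m}`, as `k`-modules, by recursion: `H^{⊗ 0} = k` and
`H^{⊗ (m + 1)} = H ⊗ H^{⊗ m}`. They are only used through `TPow.consEquiv`. -/
def TPow : ℕ → ModuleCat.{max u v} k
  | 0 => ModuleCat.of k (ULift.{v} k)
  | m + 1 => ModuleCat.of k (H ⊗[k] TPow m)

namespace TPow

/-- The identification `H^{⊗ 0} = k`. -/
def zeroEquiv : TPow k H 0 ≃ₗ[k] k := (ULift.moduleEquiv : ULift.{v} k ≃ₗ[k] k)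

/-- The identification `H ⊗ H^{⊗ m} = H^{⊗ (m + 1)}`. -/
def consEquiv (m : ℕ) : H ⊗[k] TPow k H m ≃ₗ[k] TPow k H (m + 1) :=
  LinearEquiv.refl k (H ⊗[k] TPow k H m)

/-- The identification `H^{⊗ m} ⊗ H = H^{⊗ (m + 1)}`. -/
def snocEquiv : (m : ℕ) → TPow k H m ⊗[k] H ≃ₗ[k] TPow k H (m + 1)
  | 0 => TensorProduct.comm k (TPow k H 0) H ≪≫ₗ consEquiv k H 0
  | m + 1 => TensorProduct.congr (consEquiv k H m).symm (LinearEquiv.refl k H) ≪≫ₗ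
      TensorProduct.assoc k H (TPow k H m) H ≪≫ₗ
      TensorProduct.congr (LinearEquiv.refl k H) (snocEquiv m) ≪≫ₗ consEquiv k H (m + 1)

variable {k H}

/-- `cons x (x₁ ⊗ ⋯ ⊗ xₘ) = x ⊗ x₁ ⊗ ⋯ ⊗ xₘ`. -/
def cons {m : ℕ} : H →ₗ[k] TPow k H m →ₗ[k] TPow k H (m + 1) :=
  (TensorProduct.mk k H (TPow k H m)).compr₂ (consEquiv k H m).toLinearMap

/-- `snoc (x₁ ⊗ ⋯ ⊗ xₘ) y = x₁ ⊗ ⋯ ⊗ xₘ ⊗ y`. -/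
def snoc {m : ℕ} : TPow k H m →ₗ[k] H →ₗ[k] TPow k H (m + 1) :=
  (TensorProduct.mk k (TPow k H m) H).compr₂ (snocEquiv k H m).toLinearMap

@[simp] lemma consEquiv_tmul {m : ℕ} (x : H) (w : TPow k H m) :
    consEquiv k H m (x ⊗ₜ w) = cons x w := rfl

@[simp] lemma consEquiv_symm_cons {m : ℕ} (x : H) (w : TPow k H m) :
    (consEquiv k H m).symm (cons x w) = x ⊗ₜ w := rfl

@[simp] lemma snocEquiv_tmul {m : ℕ} (w : TPow k H m) (y : H) :
    snocEquiv k H m (w ⊗ₜ y) = snoc w y := rfl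

@[simp] lemma snocEquiv_symm_snoc {m : ℕ} (w : TPow k H m) (y : H) :
    (snocEquiv k H m).symm (snoc w y) = w ⊗ₜ y :=
  (snocEquiv k H m).symm_apply_apply (w ⊗ₜ y)

@[simp] lemma snoc_cons {m : ℕ} (x : H) (w : TPow k H m) (y : H) :
    snoc (cons x w) y = cons x (snoc w y) := rfl

lemma snoc_zero (c : TPow k H 0) (y : H) : snoc c y = cons y c := rfl

lemma hom_ext_cons {m : ℕ} {M : Type*} [AddCommGroup M] [Module k M]
    {f g : TPow k H (m + 1) →ₗ[k] M} (h : ∀ x w, f (cons x w) = g (cons x w)) : f = g := by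
  have : f ∘ₗ (consEquiv k H m).toLinearMap = g ∘ₗ (consEquiv k H m).toLinearMap :=
    TensorProduct.ext' h
  ext t
  obtain ⟨t, rfl⟩ := (consEquiv k H m).surjective t
  exact congr($this t)

lemma hom_ext_snoc {m : ℕ} {M : Type*} [AddCommGroup M] [Module k M]
    {f g : TPow k H (m + 1) →ₗ[k] M} (h : ∀ w y, f (snoc w y) = g (snoc w y)) : f = g := by
  have : f ∘ₗ (snocEquiv k H m).toLinearMap = g ∘ₗ (snocEquiv k H m).toLinearMap :=
    TensorProduct.ext' h
  ext t
  obtain ⟨t, rfl⟩ := (snocEquiv k H m).surjective t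
  exact congr($this t)

lemma hom_ext_zero {M : Type*} [AddCommGroup M] [Module k M]
    {f g : TPow k H 0 →ₗ[k] M} (h : f ((zeroEquiv k H).symm 1) = g ((zeroEquiv k H).symm 1)) :
    f = g := by
  have : f ∘ₗ (zeroEquiv k H).symm.toLinearMap = g ∘ₗ (zeroEquiv k H).symm.toLinearMap :=
    LinearMap.ext_ring h
  ext t
  obtain ⟨t, rfl⟩ := (zeroEquiv k H).symm.surjective t
  exact congr($this t)

instance [FiniteDimensional k H] (m : ℕ) : FiniteDimensional k (TPow k H m) := by
  induction m with
  | zero => exact Module.Finite.equiv (zeroEquiv k H).symm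
  | succ m ih => exact Module.Finite.equiv (consEquiv k H m)

/-- The pure tensor `y 0 ⊗ y 1 ⊗ ⋯ ⊗ y (m - 1)` of a sequence `y`. -/
def pure : (m : ℕ) → (ℕ → H) → TPow k H m
  | 0, _ => (zeroEquiv k H).symm 1
  | m + 1, y => cons (y 0) (pure m fun i => y (i + 1))

lemma pure_succ (m : ℕ) (y : ℕ → H) :
    pure (k := k) (m + 1) y = cons (y 0) (pure m fun i => y (i + 1)) := rfl

lemma pure_succ' (m : ℕ) (y : ℕ → H) : pure (k := k) (m + 1) y = snoc (pure m y) (y m) := by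
  induction m generalizing y with
  | zero => rfl
  | succ m ih => rw [pure_succ, ih, pure_succ m y, snoc_cons]

lemma pure_congr {m : ℕ} {y z : ℕ → H} (h : ∀ i < m, y i = z i) :
    pure (k := k) m y = pure m z := by
  induction m generalizing y z with
  | zero => rfl
  | succ m ih =>
    rw [pure_succ, pure_succ, h 0 m.succ_pos, ih fun i hi => h _ (Nat.succ_lt_succ hi)]

lemma hom_ext_pure {m : ℕ} {M : Type*} [AddCommGroup M] [Module k M]
    {f g : TPow k H m →ₗ[k] M} (h : ∀ y, f (pure m y) = g (pure m y)) : f = g := by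
  induction m with
  | zero => exact hom_ext_zero (h 0)
  | succ m ih =>
    refine hom_ext_cons fun x w => ?_
    exact congr($(ih (f := f ∘ₗ cons x) (g := g ∘ₗ cons x) fun y =>
      h fun i => @Nat.casesOn (fun _ => H) i x y) w)

/-- The twisted rotation `x₁ ⊗ x₂ ⊗ ⋯ ⊗ xₙ ↦ x₂ ⊗ ⋯ ⊗ xₙ ⊗ φ(x₁)` of `H^{⊗ n}`, `n = m + 1`. -/
def twistedRot (φ : Module.End k H) (m : ℕ) : Module.End k (TPow k H (m + 1)) :=
  TensorProduct.lift ((snoc (k := k) (m := m)).flip ∘ₗ φ) ∘ₗ (consEquiv k H m).symm.toLinearMap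

@[simp] lemma twistedRot_cons (φ : Module.End k H) {m : ℕ} (x : H) (w : TPow k H m) :
    twistedRot φ m (cons x w) = snoc w (φ x) := by
  simp [twistedRot]

lemma twistedRot_pow_pure (φ : Module.End k H) {m : ℕ} (y : ℕ → H)
    (hy : ∀ i, y (i + (m + 1)) = φ (y i)) (j : ℕ) :
    (twistedRot φ m ^ j) (pure (m + 1) y) = pure (m + 1) fun i => y (i + j) := by
  induction j with
  | zero => rfl
  | succ j ih =>
    rw [pow_succ', Module.End.mul_apply, ih, pure_succ, twistedRot_cons, pure_succ']
    refine congr_arg₂ (fun a b => snoc a b) (pure_congr fun i _ => ?_) ?_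
    · congr 1
      omega
    · rw [← hy]
      congr 1
      omega

/-- The `n`-th power of the twisted rotation of `H^{⊗ n}` is `φ ⊗ ⋯ ⊗ φ`, so that it has finite
order as soon as `φ` does. -/
lemma twistedRot_pow_eq_one {φ : Module.End k H} {d : ℕ} (hφ : φ ^ d = 1) (m : ℕ) :
    twistedRot φ m ^ ((m + 1) * d) = 1 := by
  refine hom_ext_pure fun y => ?_
  -- the extension of `y 0, …, y m` to a sequence with `z (i + n) = φ (z i)`
  let z : ℕ → H := fun i => (φ ^ (i / (m + 1))) (y (i % (m + 1)))
  have hz (e i : ℕ) : z (i + (m + 1) * e) = (φ ^ e) (z i) := by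
    simp only [z]
    rw [Nat.add_mul_div_left _ _ m.succ_pos, Nat.add_mul_mod_self_left, add_comm, pow_add,
      Module.End.mul_apply]
  have hyz : pure (k := k) (m + 1) y = pure (m + 1) z := pure_congr fun i hi => by
    simp [z, Nat.div_eq_of_lt hi, Nat.mod_eq_of_lt hi]
  rw [hyz, twistedRot_pow_pure φ z fun i => by simpa using hz 1 i]
  simp [hz, hφ]

end TPow

end TensorPowers

/-! ### The diagonal action on tensor powers -/

section DiagonalAction

open TPow

variable {k : Type u} {H : Type v} [Field k] [Ring H]

lemma map_comul₃_left [HopfAlgebra k H] {M : Type*} [AddCommGroup M] [Module k M]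
    (Φ : H ⊗[k] (H ⊗[k] H) →ₗ[k] M) (a : H) :
    Φ (TensorProduct.assoc k H H H (comul.rTensor H (comul a))) = Φ (comul₃ k H a) := by
  rw [coassoc_apply]; rfl

variable (k H) in
/-- The diagonal action of a bialgebra `H` on `H^{⊗ m}` by left multiplication. -/
def diag [HopfAlgebra k H] : (m : ℕ) → H →ₐ[k] Module.End k (TPow k H m)
  | 0 => (Algebra.ofId k _).comp (Bialgebra.counitAlgHom k H)
  | m + 1 => ((consEquiv k H m).conjAlgEquiv k).toAlgHom.comp
      ((Module.endTensorEndAlgHom (R := k) (A := k) (S := k)).comp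
        ((Algebra.TensorProduct.map (Algebra.lmul k H) (diag m)).comp (Bialgebra.comulAlgHom k H)))

variable (k H) in
/-- The action of `H ⊗ H` on `H^{⊗ (m + 1)}`, where the first factor acts on the first component and
the second factor acts diagonally on the others. -/
def consAct [HopfAlgebra k H] (m : ℕ) : H ⊗[k] H →ₐ[k] Module.End k (TPow k H (m + 1)) :=
  ((consEquiv k H m).conjAlgEquiv k).toAlgHom.comp
      ((Module.endTensorEndAlgHom (R := k) (A := k) (S := k)).comp
        (Algebra.TensorProduct.map (Algebra.lmul k H) (diag k H m)))

variable (k H) in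
/-- The action of `H ⊗ H` on `H^{⊗ (m + 1)}`, where the second factor acts on the last component and
the first factor acts diagonally on the others. -/
def snocAct [HopfAlgebra k H] (m : ℕ) : H ⊗[k] H →ₐ[k] Module.End k (TPow k H (m + 1)) :=
  ((snocEquiv k H m).conjAlgEquiv k).toAlgHom.comp
      ((Module.endTensorEndAlgHom (R := k) (A := k) (S := k)).comp
        (Algebra.TensorProduct.map (diag k H m) (Algebra.lmul k H)))

section
variable [HopfAlgebra k H] {m : ℕ}

@[simp] lemma diag_zero (a : H) (c : TPow k H 0) : diag k H 0 a c = counit (R := k) a • c := by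
  simp [diag, Algebra.ofId_apply, Algebra.algebraMap_eq_smul_one]

lemma diag_succ (a : H) : diag k H (m + 1) a = consAct k H m (comul a) := rfl

@[simp] lemma consAct_tmul_cons (a b x : H) (w : TPow k H m) :
    consAct k H m (a ⊗ₜ b) (cons x w) = cons (a * x) (diag k H m b w) := by
  simp [consAct]
  rfl

@[simp] lemma snocAct_tmul_snoc (a b y : H) (w : TPow k H m) :
    snocAct k H m (a ⊗ₜ b) (snoc w y) = snoc (diag k H m a w) (b * y) := by
  simp [snocAct]
  rfl

lemma diag_succ' (a : H) : diag k H (m + 1) a = snocAct k H m (comul a) := by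
  induction m generalizing a with
  | zero =>
    rw [diag_succ]
    refine hom_ext_snoc fun c y => ?_
    have h1 (t : H ⊗[k] H) : consAct k H 0 t (snoc c y) =
        cons (TensorProduct.rid k H (counit.lTensor H t) * y) c := by
      induction t using TensorProduct.induction_on with
      | zero => simp
      | add s s' hs hs' => simp only [map_add, LinearMap.add_apply, add_mul, hs, hs']
      | tmul p q => simp [snoc_zero]
    have h2 (t : H ⊗[k] H) : snocAct k H 0 t (snoc c y) =
        snoc c (TensorProduct.lid k H (counit.rTensor H t) * y) := by
      induction t using TensorProduct.induction_on with
      | zero => simp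
      | add s s' hs hs' => simp only [map_add, LinearMap.add_apply, add_mul, hs, hs']
      | tmul p q => simp
    rw [h1, h2]
    simp [snoc_zero]
  | succ m ih =>
    refine hom_ext_cons fun x w => ?_
    obtain ⟨t, rfl⟩ := (snocEquiv k H m).surjective w
    hopf_tensor_induction t with w y
    let Φ : H ⊗[k] (H ⊗[k] H) →ₗ[k] TPow k H (m + 2) := (consEquiv k H (m + 1)).toLinearMap ∘ₗ
      TensorProduct.map (LinearMap.mulRight k x) ((snocEquiv k H m).toLinearMap ∘ₗ
        TensorProduct.map (LinearMap.applyₗ w ∘ₗ (diag k H m).toLinearMap) (LinearMap.mulRight k y))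
    have h1 : diag k H (m + 2) a (cons x (snoc w y)) = Φ (comul₃ k H a) := by
      rw [diag_succ]
      simp only [comul₃, LinearMap.comp_apply]
      induction comul (R := k) a using TensorProduct.induction_on with
      | zero => simp
      | add s s' hs hs' => simp only [map_add, LinearMap.add_apply, hs, hs']
      | tmul p q =>
        rw [consAct_tmul_cons, ih, LinearMap.lTensor_tmul]
        induction comul (R := k) q using TensorProduct.induction_on with
        | zero => simp
        | add s s' hs hs' => simp only [map_add, LinearMap.add_apply, tmul_add, hs, hs']
        | tmul q r => simp [Φ]
    have h2 : snocAct k H (m + 1) (comul a) (cons x (snoc w y)) =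
        Φ (TensorProduct.assoc k H H H (comul.rTensor H (comul a))) := by
      rw [← snoc_cons]
      induction comul (R := k) a using TensorProduct.induction_on with
      | zero => simp
      | add s s' hs hs' => simp only [map_add, LinearMap.add_apply, hs, hs']
      | tmul p q =>
        rw [snocAct_tmul_snoc, diag_succ, LinearMap.rTensor_tmul]
        induction comul (R := k) p using TensorProduct.induction_on with
        | zero => simp
        | add s s' hs hs' => simp only [map_add, LinearMap.add_apply, add_tmul, hs, hs']
        | tmul p r => simp [Φ]
    rw [snocEquiv_tmul, h1, h2, map_comul₃_left]

end

end DiagonalAction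

/-! ### The rotation operators on coinvariants -/

section Rotation

open TPow

variable {k : Type u} {H : Type v} [Field k] [Ring H] [HopfAlgebra k H] {m : ℕ}

variable (k H) in
/-- The projection `x ⊗ w ↦ S(x) · w` of `H^{⊗ (m + 1)}` to `H^{⊗ m}`; it identifies `H^{⊗ m}` with
the coinvariants of the diagonal action on `H^{⊗ (m + 1)}`. -/
def coinvProj (m : ℕ) : TPow k H (m + 1) →ₗ[k] TPow k H m :=
  TensorProduct.lift ((diag k H m).toLinearMap ∘ₗ antipode k) ∘ₗ (consEquiv k H m).symm.toLinearMap

@[simp] lemma coinvProj_cons (x : H) (w : TPow k H m) :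
    coinvProj k H m (cons x w) = diag k H m (antipode k x) w := by
  simp [coinvProj]

lemma coinvProj_diag (a : H) (t : TPow k H (m + 1)) :
    coinvProj k H m (diag k H (m + 1) a t) = counit (R := k) a • coinvProj k H m t := by
  refine congr($(hom_ext_cons (f := coinvProj k H m ∘ₗ diag k H (m + 1) a)
    (g := counit (R := k) a • coinvProj k H m) fun x w => ?_) t)
  have h (t : H ⊗[k] H) : coinvProj k H m (consAct k H m t (cons x w)) =
      diag k H m (antipode k x * LinearMap.mul' k H ((antipode k).rTensor H t)) w := by
    induction t using TensorProduct.induction_on with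
    | zero => simp
    | add s s' hs hs' => simp only [map_add, LinearMap.add_apply, mul_add, hs, hs']
    | tmul p q => simp [antipode_mul_antidistrib]
  rw [LinearMap.comp_apply, diag_succ, h, mul_antipode_rTensor_comul_apply]
  simp [Algebra.algebraMap_eq_smul_one]

/-- In the coinvariants, `a · w ⊗ y` equals `w ⊗ S(a) y`. -/
lemma coinvProj_snoc_diag (a y : H) (w : TPow k H m) :
    coinvProj k H m (snoc (diag k H m a w) y) = coinvProj k H m (snoc w (antipode k a * y)) := by
  let Φ : H ⊗[k] (H ⊗[k] H) →ₗ[k] TPow k H m := coinvProj k H m ∘ₗ (snocEquiv k H m).toLinearMap ∘ₗ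
    TensorProduct.map (LinearMap.applyₗ w ∘ₗ (diag k H m).toLinearMap)
      (LinearMap.mulRight k y ∘ₗ LinearMap.mul' k H ∘ₗ (antipode k).lTensor H)
  have h1 : Φ (comul₃ k H a) = coinvProj k H m (snoc (diag k H m a w) y) := by
    conv_rhs => rw [← sum_smul_counit (ℛ k a)]
    simp only [comul₃, LinearMap.comp_apply]
    conv_lhs => rw [← (ℛ k a).eq]
    simp [Φ, mul_antipode_lTensor_comul_apply, Algebra.algebraMap_eq_smul_one]
  have h2 : Φ (TensorProduct.assoc k H H H (comul.rTensor H (comul a))) =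
      coinvProj k H m (snoc w (antipode k a * y)) := by
    have h3 (p q : H) : Φ (TensorProduct.assoc k H H H (comul p ⊗ₜ q)) =
        coinvProj k H m (diag k H (m + 1) p (snoc w (antipode k q * y))) := by
      rw [diag_succ']
      induction comul (R := k) p using TensorProduct.induction_on with
      | zero => simp
      | add s s' hs hs' => simp only [map_add, LinearMap.add_apply, add_tmul, hs, hs']
      | tmul p r => simp [Φ, mul_assoc]
    have h4 := congr(TensorProduct.lid k H $(rTensor_counit_comul (R := k) a))
    simp only [TensorProduct.lid_tmul, one_smul] at h4
    conv_rhs => rw [← h4]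
    hopf_tensor_induction comul (R := k) a with p q
    simp [h3, coinvProj_diag]
  rw [← h1, ← h2, map_comul₃_left]

variable (k H) in
/-- The operator on `H^{⊗ m}` induced by the rotation `h ⊗ w ↦ w ⊗ S²(h)` of `H^{⊗ (m + 1)}` on
coinvariants. -/
def rot (m : ℕ) : Module.End k (TPow k H m) := coinvProj k H m ∘ₗ (snoc (k := k) (m := m)).flip 1

lemma rot_apply (w : TPow k H m) : rot k H m w = coinvProj k H m (snoc w 1) := rfl

lemma coinvProj_comp_twistedRot : coinvProj k H m ∘ₗ twistedRot (antipode k ∘ₗ antipode k) m =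
    rot k H m ∘ₗ coinvProj k H m := by
  refine hom_ext_cons fun x w => ?_
  simp [rot_apply, coinvProj_snoc_diag]

/-- The rotation operator has finite order as soon as `S²` does. -/
lemma rot_pow_eq_one {d : ℕ} (hd : (antipode k ∘ₗ antipode k : Module.End k H) ^ d = 1) :
    rot k H m ^ ((m + 1) * d) = 1 := by
  have h (j : ℕ) : coinvProj k H m ∘ₗ (twistedRot (antipode k ∘ₗ antipode k) m ^ j) =
      (rot k H m ^ j) ∘ₗ coinvProj k H m := by
    induction j with
    | zero => rfl
    | succ j ih =>
      rw [pow_succ, pow_succ, Module.End.mul_eq_comp, Module.End.mul_eq_comp,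
        ← LinearMap.comp_assoc, ih, LinearMap.comp_assoc, coinvProj_comp_twistedRot, LinearMap.comp_assoc]
  ext w
  have := congr($(h ((m + 1) * d)) (cons 1 w))
  rw [twistedRot_pow_eq_one hd] at this
  simpa using this.symm

variable [FiniteDimensional k H]

variable (k H) in
/-- The inverse of `rot`; on `H^{⊗ (m + 1)}` it is `w ⊗ y ↦ S⁻¹(y) · (1 ⊗ w)`. -/
def rotInv (m : ℕ) : Module.End k (TPow k H m) :=
  TensorProduct.lift (((diag k H m).toLinearMap ∘ₗ antipodeInv k H).flip) ∘ₗ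
    (snocEquiv k H m).symm.toLinearMap ∘ₗ cons 1

lemma rotInv_snoc (w : TPow k H m) (y : H) :
    rotInv k H (m + 1) (snoc w y) = diag k H (m + 1) (antipodeInv k H y) (cons 1 w) := by
  simp [rotInv, ← snoc_cons]

lemma rot_mul_rotInv : rot k H m * rotInv k H m = 1 := by
  have h (t : TPow k H (m + 1)) : rot k H m (TensorProduct.lift
      (((diag k H m).toLinearMap ∘ₗ antipodeInv k H).flip) ((snocEquiv k H m).symm t)) =
      coinvProj k H m t := by
    obtain ⟨t, rfl⟩ := (snocEquiv k H m).surjective t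
    hopf_tensor_induction t with w y
    simp [rot_apply, coinvProj_snoc_diag]
  ext w
  refine (h (cons 1 w)).trans ?_
  simp

end Rotation

/-! ### Traces of the rotation operators -/

section PartialTrace

open TPow

variable {k : Type*} [Field k] {U V H : Type*} [AddCommGroup U] [Module k U]
  [AddCommGroup V] [Module k V] [FiniteDimensional k V]
  [AddCommGroup H] [Module k H] [FiniteDimensional k H]

/-- The trace of an operator `v ⊗ y ↦ ∑ Q₁(v)(y) ⊗ Q₂(v)` on `V ⊗ H`, in which the new second
component does not depend on the old one, is the trace of `v ↦ ∑ Q₁(v)(Q₂(v))`. -/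
lemma trace_eq_trace_of_tmul (e : V ⊗[k] H ≃ₗ[k] U) (O : Module.End k U)
    (Q : V →ₗ[k] (H →ₗ[k] V) ⊗[k] H)
    (hO : ∀ v y, O (e (v ⊗ₜ y)) = e ((LinearMap.applyₗ y).rTensor H (Q v))) :
    LinearMap.trace k U O = LinearMap.trace k V (TensorProduct.lift LinearMap.id ∘ₗ Q) := by
  let D : (V →ₗ[k] (H →ₗ[k] V) ⊗[k] H) →ₗ[k] Module.End k (V ⊗[k] H) :=
    { toFun := fun Q => TensorProduct.lift
        (LinearMap.mk₂ k (fun v y => (LinearMap.applyₗ y).rTensor H (Q v))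
          (by intros; simp) (by intros; simp)
          (by intros; simp [LinearMap.rTensor_add]) (by intros; simp [LinearMap.rTensor_smul]))
      map_add' := by intros; refine TensorProduct.ext' fun v y => ?_; simp
      map_smul' := by intros; refine TensorProduct.ext' fun v y => ?_; simp }
  have hD (Q : V →ₗ[k] (H →ₗ[k] V) ⊗[k] H) (v : V) (y : H) :
      D Q (v ⊗ₜ y) = (LinearMap.applyₗ y).rTensor H (Q v) := by simp [D]
  have h1 : O = e.conj (D Q) := by
    have : O ∘ₗ e.toLinearMap = e.toLinearMap ∘ₗ D Q :=
      TensorProduct.ext' fun v y => by simpa [hD] using hO v y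
    ext t
    obtain ⟨t, rfl⟩ := e.surjective t
    simpa [LinearEquiv.conj_apply] using congr($this t)
  rw [h1, LinearMap.trace_conj']
  clear h1 hO
  obtain ⟨t, rfl⟩ := (dualTensorHomEquiv k V ((H →ₗ[k] V) ⊗[k] H)).surjective Q
  induction t using TensorProduct.induction_on with
  | zero => simp
  | add s s' hs hs' => simp only [map_add, LinearMap.comp_add, hs, hs']
  | tmul ξ u =>
    induction u using TensorProduct.induction_on with
    | zero => simp
    | add s s' hs hs' => simp only [tmul_add, map_add, LinearMap.comp_add, hs, hs']
    | tmul γ h =>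
      -- both operators factor through `A : v ⊗ y ↦ ξ(v) γ(y)` and `B : v ↦ v ⊗ h`
      let A : V ⊗[k] H →ₗ[k] V := TensorProduct.lift (ξ.smulRight γ)
      let B : V →ₗ[k] V ⊗[k] H := (TensorProduct.mk k V H).flip h
      have hAB : TensorProduct.lift LinearMap.id ∘ₗ
          dualTensorHomEquiv k V ((H →ₗ[k] V) ⊗[k] H) (ξ ⊗ₜ (γ ⊗ₜ h)) = A ∘ₗ B := by
        ext v; simp [A, B]
      have hBA : D (dualTensorHomEquiv k V ((H →ₗ[k] V) ⊗[k] H) (ξ ⊗ₜ (γ ⊗ₜ h))) = B ∘ₗ A :=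
        TensorProduct.ext' fun v y => by simp [hD, A, B, smul_tmul']
      rw [hAB, hBA, LinearMap.trace_comp_comm']

end PartialTrace

section RotationTrace

open TPow

variable {k : Type u} {H : Type v} [Field k] [Ring H] [HopfAlgebra k H] {m : ℕ}

lemma sweedlerPower_succ (m : ℕ) (h : H) : sweedlerPower k H (m + 1) h =
    LinearMap.mul' k H (TensorProduct.map (sweedlerPower k H m) LinearMap.id (comul h)) := by
  simp only [sweedlerPower, pow_succ]
  rfl

lemma sweedlerPower_succ' (m : ℕ) (h : H) : sweedlerPower k H (m + 1) h =
    LinearMap.mul' k H (TensorProduct.map LinearMap.id (sweedlerPower k H m) (comul h)) := by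
  simp only [sweedlerPower, pow_succ']
  rfl

variable (k H) in
/-- The opposite Sweedler power map `h ↦ h₍ₘ₎ ⋯ h₍₂₎ h₍₁₎`. -/
def sweedlerPowerOp : ℕ → H →ₗ[k] H
  | 0 => Algebra.linearMap k H ∘ₗ counit
  | m + 1 => LinearMap.mul' k H ∘ₗ TensorProduct.map (sweedlerPowerOp m) LinearMap.id ∘ₗ
      (TensorProduct.comm k H H).toLinearMap ∘ₗ comul

lemma sweedlerPowerOp_succ (m : ℕ) (h : H) : sweedlerPowerOp k H (m + 1) h =
    LinearMap.mul' k H (TensorProduct.map (sweedlerPowerOp k H m) LinearMap.id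
      (TensorProduct.comm k H H (comul h))) := rfl

lemma sweedlerPower_one : sweedlerPower k H 1 = LinearMap.id := by simp [sweedlerPower]

lemma sweedlerPowerOp_one : sweedlerPowerOp k H 1 = LinearMap.id := by
  ext h
  have h4 := congr(TensorProduct.rid k H $(lTensor_counit_comul (R := k) h))
  simp only [TensorProduct.rid_tmul, one_smul] at h4
  rw [sweedlerPowerOp_succ, LinearMap.id_apply]
  conv_rhs => rw [← h4]
  hopf_tensor_induction comul (R := k) h with a b
  simp [sweedlerPowerOp, Algebra.algebraMap_eq_smul_one]

lemma diag_one_cons (a x : H) (c : TPow k H 0) : diag k H 1 a (cons x c) = cons (a * x) c := by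
  have h4 := congr(TensorProduct.rid k H $(lTensor_counit_comul (R := k) a))
  simp only [TensorProduct.rid_tmul, one_smul] at h4
  rw [diag_succ]
  conv_rhs => rw [← h4]
  induction comul (R := k) a using TensorProduct.induction_on with
  | zero => simp
  | add s s' hs hs' => simp only [map_add, LinearMap.add_apply, add_mul, hs, hs']
  | tmul p q => simp

lemma trace_linearMap_comp_counit [FiniteDimensional k H] :
    LinearMap.trace k H (Algebra.linearMap k H ∘ₗ counit) = 1 := by
  rw [← LinearMap.trace_comp_comm']
  have : counit ∘ₗ Algebra.linearMap k H = LinearMap.id (R := k) (M := k) := by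
    ext; simp
  rw [this]
  simp

lemma trace_TPow_one [FiniteDimensional k H] (O : Module.End k (TPow k H 1)) (f : H →ₗ[k] H)
    (h : ∀ x c, O (cons x c) = cons (f x) c) : LinearMap.trace k _ O = LinearMap.trace k H f := by
  let e : H ≃ₗ[k] TPow k H 1 := (TensorProduct.rid k H).symm ≪≫ₗ
    TensorProduct.congr (LinearEquiv.refl k H) (zeroEquiv k H).symm ≪≫ₗ consEquiv k H 0
  have : O = e.conj f := by
    ext t
    obtain ⟨t, rfl⟩ := e.surjective t
    simp [LinearEquiv.conj_apply]
    simp [e, h]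
  rw [this, LinearMap.trace_conj']

lemma trace_TPow_zero [FiniteDimensional k H] (O : Module.End k (TPow k H 0)) (h : O = 1) :
    LinearMap.trace k _ O = 1 := by
  rw [h, LinearMap.trace_one, (zeroEquiv k H).finrank_eq]
  simp

/-- The map `w ↦ a · (w ⊗ b)` attached to `a ⊗ b`. -/
def snocShift (m : ℕ) : H ⊗[k] H →ₗ[k] (TPow k H m →ₗ[k] TPow k H (m + 1)) :=
  TensorProduct.lift (LinearMap.mk₂ k (fun a b => diag k H (m + 1) a ∘ₗ snoc.flip b)
    (by intros; ext; simp) (by intros; ext; simp) (by intros; ext; simp) (by intros; ext; simp))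

@[simp] lemma snocShift_tmul (a b : H) (w : TPow k H m) :
    snocShift m (a ⊗ₜ[k] b) w = diag k H (m + 1) a (snoc w b) := by simp [snocShift]

/-- The map `w ↦ a · (b ⊗ w)` attached to `a ⊗ b`. -/
def consShift (m : ℕ) : H ⊗[k] H →ₗ[k] (TPow k H m →ₗ[k] TPow k H (m + 1)) :=
  TensorProduct.lift (LinearMap.mk₂ k (fun a b => diag k H (m + 1) a ∘ₗ cons b)
    (by intros; ext; simp) (by intros; ext; simp) (by intros; ext; simp) (by intros; ext; simp))

@[simp] lemma consShift_tmul (a b : H) (w : TPow k H m) :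
    consShift m (a ⊗ₜ[k] b) w = diag k H (m + 1) a (cons b w) := by simp [consShift]

/-- `a ⊗ b ↦ a₍₁₎ ⊗ a₍₂₎ b` -/
def shear : H ⊗[k] H →ₗ[k] H ⊗[k] H :=
  (LinearMap.mul' k H).lTensor H ∘ₗ (TensorProduct.assoc k H H H).toLinearMap ∘ₗ comul.rTensor H

/-- `a ⊗ b ↦ a₍₂₎ ⊗ a₍₁₎ b` -/
def shearOp : H ⊗[k] H →ₗ[k] H ⊗[k] H :=
  (LinearMap.mul' k H).lTensor H ∘ₗ (TensorProduct.assoc k H H H).toLinearMap ∘ₗ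
    ((TensorProduct.comm k H H).toLinearMap ∘ₗ comul).rTensor H

variable [FiniteDimensional k H]

/-- One step of the computation of the trace of `rot`: the last component is eliminated. -/
lemma trace_snocShift_succ (Θ : H →ₗ[k] H ⊗[k] H) (m : ℕ) :
    LinearMap.trace k _ (TensorProduct.lift (snocShift (m + 1) ∘ₗ Θ) ∘ₗ
      (consEquiv k H (m + 1)).symm.toLinearMap) =
    LinearMap.trace k _ (TensorProduct.lift (snocShift m ∘ₗ shear ∘ₗ Θ) ∘ₗ
      (consEquiv k H m).symm.toLinearMap) := by
  -- `G w (a ⊗ b) = (y ↦ a · (w ⊗ y)) ⊗ b`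
  let G : TPow k H m →ₗ[k] H ⊗[k] H →ₗ[k] (H →ₗ[k] TPow k H (m + 1)) ⊗[k] H :=
    LinearMap.rTensorHom H ∘ₗ LinearMap.mk₂ k (fun w a => diag k H (m + 1) a ∘ₗ snoc w)
      (by intros; ext; simp) (by intros; ext; simp) (by intros; ext; simp) (by intros; ext; simp)
  have hG (w : TPow k H m) (a b : H) : G w (a ⊗ₜ b) = (diag k H (m + 1) a ∘ₗ snoc w) ⊗ₜ b := rfl
  have h1 (w : TPow k H m) (y : H) (u : H ⊗[k] H) : snocShift (m + 1) u (snoc w y) =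
      snocEquiv k H (m + 1) ((LinearMap.applyₗ y).rTensor H (G w (shear u))) := by
    induction u using TensorProduct.induction_on with
    | zero => simp
    | add s s' hs hs' => simp only [map_add, LinearMap.add_apply, hs, hs']
    | tmul a b =>
      simp only [snocShift_tmul, diag_succ' (m := m + 1), shear, LinearMap.comp_apply,
        LinearMap.rTensor_tmul]
      induction comul (R := k) a using TensorProduct.induction_on with
      | zero => simp
      | add s s' hs hs' => simp only [map_add, LinearMap.add_apply, add_tmul, hs, hs']
      | tmul p q => simp [hG]
  have h2 (w : TPow k H m) (u : H ⊗[k] H) :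
      TensorProduct.lift LinearMap.id (G w u) = snocShift m u w := by
    induction u using TensorProduct.induction_on with
    | zero => simp
    | add s s' hs hs' => simp only [map_add, LinearMap.add_apply, hs, hs']
    | tmul a b => simp [hG]
  rw [trace_eq_trace_of_tmul (snocEquiv k H (m + 1)) _
    (TensorProduct.lift (G.flip ∘ₗ shear ∘ₗ Θ) ∘ₗ (consEquiv k H m).symm.toLinearMap)]
  · congr 1
    refine hom_ext_cons fun x w => ?_
    simp [h2]
  · intro v y
    obtain ⟨t, rfl⟩ := (consEquiv k H m).surjective v
    induction t using TensorProduct.induction_on with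
    | zero => simp
    | add s s' hs hs' => simp only [map_add, add_tmul, hs, hs']
    | tmul x w => simp [h1]

/-- One step of the computation of the trace of `rotInv`: the first component is eliminated. -/
lemma trace_consShift_succ (Θ : H →ₗ[k] H ⊗[k] H) (m : ℕ) :
    LinearMap.trace k _ (TensorProduct.lift (consShift (m + 1) ∘ₗ Θ).flip ∘ₗ
      (snocEquiv k H (m + 1)).symm.toLinearMap) =
    LinearMap.trace k _ (TensorProduct.lift (consShift m ∘ₗ shearOp ∘ₗ Θ).flip ∘ₗ
      (snocEquiv k H m).symm.toLinearMap) := by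
  -- `G w (a ⊗ b) = (x ↦ a · (x ⊗ w)) ⊗ b`
  let G : TPow k H m →ₗ[k] H ⊗[k] H →ₗ[k] (H →ₗ[k] TPow k H (m + 1)) ⊗[k] H :=
    LinearMap.rTensorHom H ∘ₗ LinearMap.mk₂ k (fun w a => diag k H (m + 1) a ∘ₗ cons.flip w)
      (by intros; ext; simp) (by intros; ext; simp) (by intros; ext; simp) (by intros; ext; simp)
  have hG (w : TPow k H m) (a b : H) :
    G w (a ⊗ₜ b) = (diag k H (m + 1) a ∘ₗ cons.flip w) ⊗ₜ b := rfl
  let e : TPow k H (m + 1) ⊗[k] H ≃ₗ[k] TPow k H (m + 2) :=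
    TensorProduct.comm k _ _ ≪≫ₗ consEquiv k H (m + 1)
  have he (w : TPow k H (m + 1)) (x : H) : e (w ⊗ₜ x) = cons x w := rfl
  have h1 (w : TPow k H m) (x : H) (u : H ⊗[k] H) : consShift (m + 1) u (cons x w) =
      e ((LinearMap.applyₗ x).rTensor H (G w (shearOp u))) := by
    induction u using TensorProduct.induction_on with
    | zero => simp
    | add s s' hs hs' => simp only [map_add, LinearMap.add_apply, hs, hs']
    | tmul a b =>
      simp only [consShift_tmul, diag_succ (m := m + 1), shearOp, LinearMap.comp_apply,
        LinearMap.rTensor_tmul]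
      induction comul (R := k) a using TensorProduct.induction_on with
      | zero => simp
      | add s s' hs hs' => simp only [map_add, LinearMap.add_apply, add_tmul, hs, hs']
      | tmul p q => simp [hG, he]
  have h2 (w : TPow k H m) (u : H ⊗[k] H) :
      TensorProduct.lift LinearMap.id (G w u) = consShift m u w := by
    induction u using TensorProduct.induction_on with
    | zero => simp
    | add s s' hs hs' => simp only [map_add, LinearMap.add_apply, hs, hs']
    | tmul a b => simp [hG]
  rw [trace_eq_trace_of_tmul e _
    (TensorProduct.lift (G.flip ∘ₗ shearOp ∘ₗ Θ).flip ∘ₗ (snocEquiv k H m).symm.toLinearMap)]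
  · congr 1
    refine hom_ext_snoc fun w x => ?_
    simp [h2]
  · intro v y
    obtain ⟨t, rfl⟩ := (snocEquiv k H m).surjective v
    induction t using TensorProduct.induction_on with
    | zero => simp
    | add s s' hs hs' => simp only [map_add, add_tmul, hs, hs']
    | tmul w x => simp [h1, he, ← snoc_cons]

/-- The trace of `x ⊗ w ↦ ∑ a · (w ⊗ b)`, where `Θ(x) = ∑ a ⊗ b`, is the trace of
`x ↦ ∑ P^{(m + 1)}(a) b`. -/
lemma trace_snocShift (Θ : H →ₗ[k] H ⊗[k] H) (m : ℕ) :
    LinearMap.trace k _ (TensorProduct.lift (snocShift m ∘ₗ Θ) ∘ₗ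
      (consEquiv k H m).symm.toLinearMap) =
    LinearMap.trace k H (LinearMap.mul' k H ∘ₗ
      TensorProduct.map (sweedlerPower k H (m + 1)) LinearMap.id ∘ₗ Θ) := by
  induction m generalizing Θ with
  | zero =>
    refine trace_TPow_one _ _ fun x c => ?_
    have h (u : H ⊗[k] H) : snocShift 0 u c = cons (LinearMap.mul' k H
        (TensorProduct.map (sweedlerPower k H 1) LinearMap.id u)) c := by
      induction u using TensorProduct.induction_on with
      | zero => simp
      | add s s' hs hs' => simp only [map_add, LinearMap.add_apply, hs, hs']
      | tmul a b => simp [snoc_zero, diag_one_cons, sweedlerPower_one]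
    simp [h]
  | succ m ih =>
    rw [trace_snocShift_succ, ih]
    congr 1
    ext x
    simp only [LinearMap.comp_apply]
    induction Θ x using TensorProduct.induction_on with
    | zero => simp
    | add s s' hs hs' => simp only [map_add, hs, hs']
    | tmul a b =>
      simp only [shear, LinearMap.comp_apply, LinearMap.rTensor_tmul, map_tmul,
        LinearMap.mul'_apply, sweedlerPower_succ (m + 1)]
      induction comul (R := k) a using TensorProduct.induction_on with
      | zero => simp
      | add s s' hs hs' => simp only [map_add, add_tmul, add_mul, hs, hs']
      | tmul p q => simp [mul_assoc]

/-- The trace of `w ⊗ y ↦ ∑ a · (b ⊗ w)`, where `Θ(y) = ∑ a ⊗ b`, is the trace of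
`y ↦ ∑ a₍ₘ₊₁₎ ⋯ a₍₁₎ b`. -/
lemma trace_consShift (Θ : H →ₗ[k] H ⊗[k] H) (m : ℕ) :
    LinearMap.trace k _ (TensorProduct.lift (consShift m ∘ₗ Θ).flip ∘ₗ
      (snocEquiv k H m).symm.toLinearMap) =
    LinearMap.trace k H (LinearMap.mul' k H ∘ₗ
      TensorProduct.map (sweedlerPowerOp k H (m + 1)) LinearMap.id ∘ₗ Θ) := by
  induction m generalizing Θ with
  | zero =>
    refine trace_TPow_one _ _ fun x c => ?_
    have h (u : H ⊗[k] H) : consShift 0 u c = cons (LinearMap.mul' k H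
        (TensorProduct.map (sweedlerPowerOp k H 1) LinearMap.id u)) c := by
      induction u using TensorProduct.induction_on with
      | zero => simp
      | add s s' hs hs' => simp only [map_add, LinearMap.add_apply, hs, hs']
      | tmul a b => simp [diag_one_cons, sweedlerPowerOp_one]
    simp [h, ← snoc_zero]
  | succ m ih =>
    rw [trace_consShift_succ, ih]
    congr 1
    ext x
    simp only [LinearMap.comp_apply]
    induction Θ x using TensorProduct.induction_on with
    | zero => simp
    | add s s' hs hs' => simp only [map_add, hs, hs']
    | tmul a b =>
      simp only [shearOp, LinearMap.comp_apply, LinearMap.rTensor_tmul, map_tmul,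
        LinearMap.mul'_apply, sweedlerPowerOp_succ (m + 1), LinearEquiv.coe_coe]
      induction comul (R := k) a using TensorProduct.induction_on with
      | zero => simp
      | add s s' hs hs' => simp only [map_add, add_tmul, add_mul, hs, hs']
      | tmul p q => simp [mul_assoc]

variable (k H) in
/-- The trace of the rotation operator of `H` is the indicator of `H`. -/
lemma trace_rot (m : ℕ) : LinearMap.trace k _ (rot k H m) =
    LinearMap.trace k H (antipode k ∘ₗ sweedlerPower k H m) := by
  cases m with
  | zero =>
    have h : antipode k ∘ₗ sweedlerPower k H 0 = Algebra.linearMap k H ∘ₗ counit := by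
      ext; simp [sweedlerPower_zero_apply, Algebra.algebraMap_eq_smul_one]
    rw [h, trace_linearMap_comp_counit, trace_TPow_zero]
    exact hom_ext_zero (by simp [rot_apply, snoc_zero])
  | succ m =>
    have : rot k H (m + 1) = TensorProduct.lift (snocShift m ∘ₗ
        (TensorProduct.mk k H H).flip 1 ∘ₗ antipode k) ∘ₗ (consEquiv k H m).symm.toLinearMap :=
      hom_ext_cons fun x w => by simp [rot_apply]
    have h : LinearMap.mul' k H ∘ₗ TensorProduct.map (sweedlerPower k H (m + 1)) LinearMap.id ∘ₗ
        (TensorProduct.mk k H H).flip 1 ∘ₗ antipode k =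
          sweedlerPower k H (m + 1) ∘ₗ antipode k := by
      ext; simp
    rw [this, trace_snocShift, h, LinearMap.trace_comp_comm']

variable (k H) in
lemma trace_rotInv (m : ℕ) : LinearMap.trace k _ (rotInv k H m) =
    LinearMap.trace k H (antipodeInv k H ∘ₗ sweedlerPowerOp k H m) := by
  cases m with
  | zero =>
    have h : antipodeInv k H ∘ₗ sweedlerPowerOp k H 0 = Algebra.linearMap k H ∘ₗ counit := by
      ext; simp [sweedlerPowerOp, Algebra.algebraMap_eq_smul_one]
    rw [h, trace_linearMap_comp_counit, trace_TPow_zero]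
    exact hom_ext_zero (by simp [rotInv, ← snoc_zero])
  | succ m =>
    have : rotInv k H (m + 1) = TensorProduct.lift (consShift m ∘ₗ
        (TensorProduct.mk k H H).flip 1 ∘ₗ antipodeInv k H).flip ∘ₗ
          (snocEquiv k H m).symm.toLinearMap :=
      hom_ext_snoc fun w y => by simp [rotInv_snoc]
    have h : LinearMap.mul' k H ∘ₗ TensorProduct.map (sweedlerPowerOp k H (m + 1)) LinearMap.id ∘ₗ
        (TensorProduct.mk k H H).flip 1 ∘ₗ antipodeInv k H =
          sweedlerPowerOp k H (m + 1) ∘ₗ antipodeInv k H := by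
      ext; simp
    rw [this, trace_consShift, h, LinearMap.trace_comp_comm']

end RotationTrace

/-! ### Indicators of duals and of tensor products -/

section DualIndicator

open TPow DualCop

variable {k : Type u} {H : Type v} [Field k] [Ring H] [HopfAlgebra k H] [FiniteDimensional k H]

lemma pairing_antipode (f : DualCop k H) (x : H) :
    pairing k H (antipode k f) x = pairing k H f (antipodeInv k H x) := pairing_antip f x

lemma pairing_antipodeInv (f : DualCop k H) (x : H) :
    pairing k H (antipodeInv k (DualCop k H) f) x = pairing k H f (antipode k x) := by
  conv_rhs => rw [← antipode_antipodeInv (k := k) f, pairing_antipode, antipodeInv_antipode]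

lemma pairing_sweedlerPower (m : ℕ) (f : DualCop k H) (x : H) :
    pairing k H (sweedlerPower k (DualCop k H) m f) x =
      pairing k H f (sweedlerPowerOp k H m x) := by
  induction m generalizing f x with
  | zero =>
    simp [sweedlerPower_zero_apply, sweedlerPowerOp, Algebra.algebraMap_eq_smul_one, pairing_one,
      DualCop.counit_apply, mul_comm]
  | succ m ih =>
    have h (t : DualCop k H ⊗[k] DualCop k H) : pairing k H (LinearMap.mul' k _
        (TensorProduct.map LinearMap.id (sweedlerPower k (DualCop k H) m) t)) x =
        ∑ i ∈ (ℛ k x).index, pairing k H (contr ((ℛ k x).left i) t)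
          (sweedlerPowerOp k H m ((ℛ k x).right i)) := by
      induction t using TensorProduct.induction_on with
      | zero => simp
      | add s s' hs hs' =>
        simp only [map_add, hs, hs', LinearMap.add_apply, Finset.sum_add_distrib]
      | tmul a b => simp [pairing_mul, ← (ℛ k x).eq, ih]
    rw [sweedlerPower_succ', h, sweedlerPowerOp_succ]
    conv_rhs => rw [← (ℛ k x).eq]
    simp [pairing_comul]

lemma pairing_sweedlerPowerOp (m : ℕ) (f : DualCop k H) (x : H) :
    pairing k H (sweedlerPowerOp k (DualCop k H) m f) x =
      pairing k H f (sweedlerPower k H m x) := by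
  induction m generalizing f x with
  | zero =>
    simp [sweedlerPower_zero_apply, sweedlerPowerOp, Algebra.algebraMap_eq_smul_one, pairing_one,
      DualCop.counit_apply, mul_comm]
  | succ m ih =>
    have h (t : DualCop k H ⊗[k] DualCop k H) : pairing k H (LinearMap.mul' k _
        (TensorProduct.map (sweedlerPowerOp k (DualCop k H) m) LinearMap.id
          (TensorProduct.comm k _ _ t))) x =
        ∑ i ∈ (ℛ k x).index, pairing k H (contr ((ℛ k x).right i) t)
          (sweedlerPower k H m ((ℛ k x).left i)) := by
      induction t using TensorProduct.induction_on with
      | zero => simp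
      | add s s' hs hs' =>
        simp only [map_add, hs, hs', LinearMap.add_apply, Finset.sum_add_distrib]
      | tmul a b => simp [pairing_mul, ← (ℛ k x).eq, ih, mul_comm]
    rw [sweedlerPowerOp_succ, h, sweedlerPower_succ]
    conv_rhs => rw [← (ℛ k x).eq]
    simp [pairing_comul]

lemma trace_dualCop (O : Module.End k (DualCop k H)) (T : Module.End k H)
    (h : ∀ f x, pairing k H (O f) x = pairing k H f (T x)) :
    LinearMap.trace k _ O = LinearMap.trace k H T := by
  rw [← LinearMap.trace_conj' O (pairing k H), ← LinearMap.trace_transpose' T]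
  congr 1
  ext f x
  obtain ⟨f, rfl⟩ := (pairing k H).surjective f
  simp [LinearEquiv.conj_apply, h, Module.Dual.transpose_apply]

/-- The indicator of `H^{*cop}` is the trace of the inverse rotation operator of `H`. -/
lemma indicator_dualCop (m : ℕ) :
    indicator k (DualCop k H) (m + 1) = LinearMap.trace k _ (rotInv k H m) := by
  rw [trace_rotInv, indicator, LinearMap.trace_comp_comm']
  exact trace_dualCop _ _ fun f x => by
    simp [pairing_sweedlerPower, pairing_antipode]

/-- The indicator of `H` is the trace of the inverse rotation operator of `H^{*cop}`. -/
lemma indicator_eq_trace_rotInv_dualCop (m : ℕ) :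
    indicator k H (m + 1) = LinearMap.trace k _ (rotInv k (DualCop k H) m) := by
  rw [trace_rotInv, indicator, LinearMap.trace_comp_comm']
  exact (trace_dualCop _ _ fun f x => by
    simp [pairing_sweedlerPowerOp, pairing_antipodeInv]).symm

lemma indicator_succ (m : ℕ) : indicator k H (m + 1) = LinearMap.trace k _ (rot k H m) :=
  (trace_rot k H m).symm

end DualIndicator

section TensorIndicator

open TPow DualCop

variable {k : Type u} {A : Type v} {B : Type w} [Field k] [Ring A] [HopfAlgebra k A] [Ring B]
  [HopfAlgebra k B]

lemma sweedlerPower_tensor (m : ℕ) : sweedlerPower k (A ⊗[k] B) m =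
    TensorProduct.map (sweedlerPower k A m) (sweedlerPower k B m) := by
  induction m with
  | zero =>
    refine TensorProduct.ext' fun a b => ?_
    simp [sweedlerPower_zero_apply, Algebra.algebraMap_eq_smul_one, smul_tmul', smul_smul,
      tmul_smul, Algebra.TensorProduct.one_def, mul_comm]
  | succ m ih =>
    refine TensorProduct.ext' fun a b => ?_
    rw [sweedlerPower_succ, ih, map_tmul, sweedlerPower_succ, sweedlerPower_succ,
      TensorProduct.comul_tmul]
    hopf_tensor_induction comul (R := k) a with a a'
    hopf_tensor_induction comul (R := k) b with b b'
    simp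

/-- Indicators are multiplicative for tensor products of Hopf algebras. -/
lemma indicator_tensor [FiniteDimensional k A] [FiniteDimensional k B] (n : ℕ) :
    indicator k (A ⊗[k] B) n = indicator k A n * indicator k B n := by
  rw [indicator, indicator, indicator, ← LinearMap.trace_tensorProduct', sweedlerPower_tensor]
  congr 1
  refine TensorProduct.ext' fun a b => ?_
  simp

end TensorIndicator

/-! ### Invariance of the traces under twisting -/

section Twist

open TPow

variable {k : Type u} {A : Type v} {B : Type w} [Field k] [Ring A] [HopfAlgebra k A] [Ring B]
  [HopfAlgebra k B] {m : ℕ}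

/-- `J ∈ A ⊗ A` is a twist for the Hopf algebra `A`, and the isomorphism of algebras `Ψ` identifies
`B` with the twisted Hopf algebra `A^J`, that is, with `A` with the comultiplication
`a ↦ J Δ(a) J⁻¹`. -/
structure IsTwist (Ψ : A ≃ₐ[k] B) (J : A ⊗[k] A) : Prop where
  counit_map (a : A) : counit (R := k) (Ψ a) = counit (R := k) a
  comul_map (a : A) : comul (R := k) (Ψ a) * Algebra.TensorProduct.map Ψ.toAlgHom Ψ.toAlgHom J =
    Algebra.TensorProduct.map Ψ.toAlgHom Ψ.toAlgHom (J * comul a)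
  cocycle : TensorProduct.assoc k A A A ((J ⊗ₜ 1) * comul.rTensor A J) =
    (1 ⊗ₜ J) * comul.lTensor A J
  counit_left : TensorProduct.lid k A (counit.rTensor A J) = 1
  counit_right : TensorProduct.rid k A (counit.lTensor A J) = 1
  isUnit : ∃ J', J' * J = 1

/-- The linear map `x₁ ⊗ ⋯ ⊗ xₘ ↦ Ψ^{⊗ m} (Jₘ (x₁ ⊗ ⋯ ⊗ xₘ))`, where `J₁ = 1` and
`Jₘ₊₁ = (1 ⊗ Jₘ) (id ⊗ Δ^{(m)})(J)` are the iterated twists. -/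
def twistMap (Ψ : A ≃ₐ[k] B) (J : A ⊗[k] A) : (m : ℕ) → TPow k A m →ₗ[k] TPow k B m
  | 0 => (zeroEquiv k B).symm.toLinearMap ∘ₗ (zeroEquiv k A).toLinearMap
  | m + 1 => (consEquiv k B m).toLinearMap ∘ₗ TensorProduct.map Ψ.toLinearMap (twistMap Ψ J m) ∘ₗ
      (consEquiv k A m).symm.toLinearMap ∘ₗ consAct k A m J

/-- `a ⊗ (b ⊗ c) ↦ Ψ(a x) ⊗ Jₘ (b · w) ⊗ Ψ(c y)` -/
def twistTriple (Ψ : A ≃ₐ[k] B) (J : A ⊗[k] A) (x : A) (w : TPow k A m) (y : A) :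
    A ⊗[k] (A ⊗[k] A) →ₗ[k] TPow k B (m + 2) :=
  (consEquiv k B (m + 1)).toLinearMap ∘ₗ TensorProduct.map (Ψ.toLinearMap ∘ₗ LinearMap.mulRight k x)
    ((snocEquiv k B m).toLinearMap ∘ₗ TensorProduct.map
      (twistMap Ψ J m ∘ₗ LinearMap.applyₗ w ∘ₗ (diag k A m).toLinearMap)
      (Ψ.toLinearMap ∘ₗ LinearMap.mulRight k y))

@[simp] lemma twistTriple_tmul (Ψ : A ≃ₐ[k] B) (J : A ⊗[k] A) (x : A) (w : TPow k A m) (y : A)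
    (a b c : A) : twistTriple Ψ J x w y (a ⊗ₜ (b ⊗ₜ c)) =
      cons (Ψ (a * x)) (snoc (twistMap Ψ J m (diag k A m b w)) (Ψ (c * y))) := by
  simp [twistTriple]

variable {Ψ : A ≃ₐ[k] B} {J : A ⊗[k] A}

lemma twistMap_succ (t : TPow k A (m + 1)) : twistMap Ψ J (m + 1) t = consEquiv k B m
    (TensorProduct.map Ψ.toLinearMap (twistMap Ψ J m)
      ((consEquiv k A m).symm (consAct k A m J t))) := rfl

/-- The iterated twists intertwine the diagonal actions of `A` and of the twist of `A`. -/
lemma twistMap_diag (hJ : IsTwist Ψ J) (a : A) (w : TPow k A m) :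
    twistMap Ψ J m (diag k A m a w) = diag k B m (Ψ a) (twistMap Ψ J m w) := by
  induction m generalizing a with
  | zero => simp [hJ.counit_map]
  | succ m ih =>
    have h (u : A ⊗[k] A) (t : TPow k A (m + 1)) : consEquiv k B m
        (TensorProduct.map Ψ.toLinearMap (twistMap Ψ J m) ((consEquiv k A m).symm
          (consAct k A m u t))) = consAct k B m (Algebra.TensorProduct.map Ψ.toAlgHom Ψ.toAlgHom u)
        (consEquiv k B m (TensorProduct.map Ψ.toLinearMap (twistMap Ψ J m)
          ((consEquiv k A m).symm t))) := by
      obtain ⟨t, rfl⟩ := (consEquiv k A m).surjective t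
      induction t using TensorProduct.induction_on with
      | zero => simp
      | add s s' hs hs' => simp only [map_add, hs, hs']
      | tmul x w =>
        induction u using TensorProduct.induction_on with
        | zero => simp
        | add s s' hs hs' => simp only [map_add, LinearMap.add_apply, hs, hs']
        | tmul p q => simp [ih]
    rw [twistMap_succ, twistMap_succ, diag_succ, diag_succ, ← Module.End.mul_apply, ← map_mul, h,
      h, ← hJ.comul_map, map_mul, Module.End.mul_apply]

/-- The recursion for the iterated twists also holds with the last component in place of the first
one: this is the cocycle condition. -/
lemma twistMap_snoc (hJ : IsTwist Ψ J) (t : TPow k A (m + 1)) :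
    twistMap Ψ J (m + 1) t = snocEquiv k B m (TensorProduct.map (twistMap Ψ J m) Ψ.toLinearMap
      ((snocEquiv k A m).symm (snocAct k A m J t))) := by
  induction m with
  | zero =>
    obtain ⟨t, rfl⟩ := (snocEquiv k A 0).surjective t
    hopf_tensor_induction t with c y
    have h1 (t : A ⊗[k] A) : consEquiv k B 0 (TensorProduct.map Ψ.toLinearMap (twistMap Ψ J 0)
        ((consEquiv k A 0).symm (consAct k A 0 t (cons y c)))) =
        cons (Ψ (TensorProduct.rid k A (counit.lTensor A t) * y)) (twistMap Ψ J 0 c) := by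
      induction t using TensorProduct.induction_on with
      | zero => simp
      | add s s' hs hs' => simp only [map_add, LinearMap.add_apply, add_mul, hs, hs']
      | tmul p q => simp
    have h2 (t : A ⊗[k] A) : snocEquiv k B 0 (TensorProduct.map (twistMap Ψ J 0) Ψ.toLinearMap
        ((snocEquiv k A 0).symm (snocAct k A 0 t (snoc c y)))) =
        snoc (twistMap Ψ J 0 c) (Ψ (TensorProduct.lid k A (counit.rTensor A t) * y)) := by
      induction t using TensorProduct.induction_on with
      | zero => simp
      | add s s' hs hs' => simp only [map_add, LinearMap.add_apply, add_mul, hs, hs']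
      | tmul p q => simp
    rw [twistMap_succ, snocEquiv_tmul, h2, snoc_zero, h1, hJ.counit_left, hJ.counit_right,
      snoc_zero]
  | succ m ih =>
    obtain ⟨t, rfl⟩ := (consEquiv k A (m + 1)).surjective t
    hopf_tensor_induction t with x t
    obtain ⟨t, rfl⟩ := (snocEquiv k A m).surjective t
    hopf_tensor_induction t with w y
    have h1 (t u : A ⊗[k] A) : consEquiv k B (m + 1) (TensorProduct.map Ψ.toLinearMap
        ((snocEquiv k B m).toLinearMap ∘ₗ TensorProduct.map (twistMap Ψ J m) Ψ.toLinearMap ∘ₗ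
          (snocEquiv k A m).symm.toLinearMap ∘ₗ snocAct k A m t)
        ((consEquiv k A (m + 1)).symm (consAct k A (m + 1) u (cons x (snoc w y))))) =
        twistTriple Ψ J x w y ((1 ⊗ₜ t) * comul.lTensor A u) := by
      induction u using TensorProduct.induction_on with
      | zero => simp
      | add s s' hs hs' => simp only [map_add, LinearMap.add_apply, mul_add, hs, hs']
      | tmul p q =>
        simp only [consAct_tmul_cons, consEquiv_symm_cons, map_tmul, LinearMap.comp_apply,
          LinearMap.lTensor_tmul, Algebra.TensorProduct.tmul_mul_tmul, one_mul, diag_succ']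
        rw [← Module.End.mul_apply, ← map_mul]
        induction t * comul q using TensorProduct.induction_on with
        | zero => simp
        | add s s' hs hs' => simp only [map_add, LinearMap.add_apply, tmul_add, hs, hs']
        | tmul b c => simp
    have h2 (t u : A ⊗[k] A) : snocEquiv k B (m + 1) (TensorProduct.map
        ((consEquiv k B m).toLinearMap ∘ₗ TensorProduct.map Ψ.toLinearMap (twistMap Ψ J m) ∘ₗ
          (consEquiv k A m).symm.toLinearMap ∘ₗ consAct k A m t) Ψ.toLinearMap
        ((snocEquiv k A (m + 1)).symm (snocAct k A (m + 1) u (snoc (cons x w) y)))) =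
        twistTriple Ψ J x w y (TensorProduct.assoc k A A A ((t ⊗ₜ 1) * comul.rTensor A u)) := by
      induction u using TensorProduct.induction_on with
      | zero => simp
      | add s s' hs hs' => simp only [map_add, LinearMap.add_apply, mul_add, hs, hs']
      | tmul p q =>
        simp only [snocAct_tmul_snoc, snocEquiv_symm_snoc, map_tmul, LinearMap.comp_apply,
          LinearMap.rTensor_tmul, Algebra.TensorProduct.tmul_mul_tmul, one_mul, diag_succ]
        rw [← Module.End.mul_apply, ← map_mul]
        induction t * comul p using TensorProduct.induction_on with
        | zero => simp
        | add s s' hs hs' => simp only [map_add, LinearMap.add_apply, add_tmul, hs, hs']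
        | tmul b c => simp
    have h3 : twistMap Ψ J (m + 1) = (snocEquiv k B m).toLinearMap ∘ₗ
        TensorProduct.map (twistMap Ψ J m) Ψ.toLinearMap ∘ₗ
          (snocEquiv k A m).symm.toLinearMap ∘ₗ snocAct k A m J := LinearMap.ext ih
    rw [twistMap_succ, consEquiv_tmul, snocEquiv_tmul]
    conv_lhs => rw [h3, h1, ← hJ.cocycle, ← h2, snoc_cons]
    rfl

/-- `S(J⁽¹⁾) J⁽²⁾`, computed in `B`. -/
def twistElement (Ψ : A ≃ₐ[k] B) (J : A ⊗[k] A) : B :=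
  LinearMap.mul' k B ((antipode k).rTensor B (Algebra.TensorProduct.map Ψ.toAlgHom Ψ.toAlgHom J))

/-- The antipodes of `A` and of its twist are conjugate by the twist element: both sides are
convolution inverse to `Ψ`, up to that element. -/
lemma antipode_mul_twistElement (hJ : IsTwist Ψ J) (h : A) :
    antipode k (Ψ h) * twistElement Ψ J = twistElement Ψ J * Ψ (antipode k h) := by
  set q := twistElement Ψ J with hq
  let W : B ⊗[k] B →ₗ[k] B := LinearMap.mul' k B ∘ₗ (antipode k).rTensor B
  have h1 (a : B) (u : B ⊗[k] B) : W (comul a * u) = counit (R := k) a • W u := by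
    induction u using TensorProduct.induction_on with
    | zero => simp
    | add s s' hs hs' => simp only [map_add, mul_add, smul_add, hs, hs']
    | tmul p r =>
      have h2 (t : B ⊗[k] B) : W (t * (p ⊗ₜ r)) = antipode k p * W t * r := by
        hopf_tensor_induction t with c d
        simp [W, antipode_mul_antidistrib, mul_assoc]
      rw [h2]
      simp [W, mul_antipode_rTensor_comul_apply, Algebra.algebraMap_eq_smul_one]
  have h2 (t : A ⊗[k] A) : W (Algebra.TensorProduct.map Ψ.toAlgHom Ψ.toAlgHom (J * t)) =
      LinearMap.mul' k B (TensorProduct.map (LinearMap.mulRight k q ∘ₗ antipode k ∘ₗ Ψ.toLinearMap)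
        Ψ.toLinearMap t) := by
    induction t using TensorProduct.induction_on with
    | zero => simp
    | add s s' hs hs' => simp only [map_add, mul_add, hs, hs']
    | tmul a b =>
      rw [hq, twistElement, map_tmul, LinearMap.mul'_apply]
      simp only [LinearMap.comp_apply, LinearMap.mulRight_apply]
      clear hq h1 q hJ
      induction J using TensorProduct.induction_on with
      | zero => simp
      | add s s' hs hs' => simp only [map_add, mul_add, add_mul, hs, hs']
      | tmul p r => simp [W, antipode_mul_antidistrib, mul_assoc]
  let F : WithConv (A →ₗ[k] B) := toConv (LinearMap.mulRight k q ∘ₗ antipode k ∘ₗ Ψ.toLinearMap)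
  have h3 : F * toConv Ψ.toLinearMap =
      toConv (LinearMap.mulLeft k q ∘ₗ Algebra.linearMap k B ∘ₗ counit) := by
    ext a
    refine (h2 _).symm.trans ?_
    rw [← hJ.comul_map, h1, hJ.counit_map]
    simp [Algebra.algebraMap_eq_smul_one, W, hq, twistElement]
  have h4 : toConv Ψ.toLinearMap * toConv (Ψ.toLinearMap ∘ₗ antipode k) = 1 := by
    ext x
    have := congr($(LinearMap.algHom_comp_convMul_distrib Ψ.toAlgHom
      (toConv (LinearMap.id : A →ₗ[k] A)) (toConv (antipode k))) x)
    rw [LinearMap.id_mul_antipode] at this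
    refine this.symm.trans ?_
    simp
  have h5 : F = toConv (LinearMap.mulLeft k q ∘ₗ Algebra.linearMap k B ∘ₗ counit) *
      toConv (Ψ.toLinearMap ∘ₗ antipode k) := by
    rw [← h3, mul_assoc, h4, mul_one]
  have h6 (t : A ⊗[k] A) : LinearMap.mul' k B (TensorProduct.map
      (LinearMap.mulLeft k q ∘ₗ Algebra.linearMap k B ∘ₗ counit) (Ψ.toLinearMap ∘ₗ antipode k) t) =
      q * Ψ (antipode k (TensorProduct.lid k A (counit.rTensor A t))) := by
    induction t using TensorProduct.induction_on with
    | zero => simp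
    | add s s' hs hs' => simp only [map_add, mul_add, hs, hs']
    | tmul a b => simp [Algebra.algebraMap_eq_smul_one]
  refine congr($h5 h).trans ((h6 _).trans ?_)
  simp

variable [FiniteDimensional k A]

lemma twistMap_bijective (hJ : IsTwist Ψ J) (m : ℕ) : Function.Bijective (twistMap Ψ J m) := by
  induction m with
  | zero => exact ((zeroEquiv k A).trans (zeroEquiv k B).symm).bijective
  | succ m ih =>
    obtain ⟨J', hJ'⟩ := hJ.isUnit
    have h1 : Function.Injective (consAct k A m J) := fun s t hst => by
      have := congr(consAct k A m J' $hst)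
      simpa [← Module.End.mul_apply, ← map_mul, hJ'] using this
    have h2 : Function.Bijective (consAct k A m J) :=
      ⟨h1, LinearMap.injective_iff_surjective.1 h1⟩
    exact ((consEquiv k A m).symm ≪≫ₗ TensorProduct.congr Ψ.toLinearEquiv
      (LinearEquiv.ofBijective _ ih) ≪≫ₗ consEquiv k B m).bijective.comp h2

variable [FiniteDimensional k B]

/-- A twist with `S(J⁽¹⁾) J⁽²⁾ = S⁻¹(J⁽²⁾) J⁽¹⁾` does not change the trace of the inverse rotation
operators: the operators `w ↦ S(J⁽¹⁾) J⁽²⁾ · Jₘ w` intertwine the rotations. -/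
lemma trace_rotInv_eq_of_isTwist (hJ : IsTwist Ψ J)
    (hq : LinearMap.mul' k B ((antipodeInv k B).rTensor B (TensorProduct.comm k B B
      (Algebra.TensorProduct.map Ψ.toAlgHom Ψ.toAlgHom J))) = twistElement Ψ J)
    (hu : ∃ q', q' * twistElement Ψ J = 1) (m : ℕ) :
    LinearMap.trace k _ (rotInv k A m) = LinearMap.trace k _ (rotInv k B m) := by
  set q := twistElement Ψ J with hq'
  let K : TPow k A m →ₗ[k] TPow k B m := diag k B m q ∘ₗ twistMap Ψ J m
  have hK : Function.Bijective K := by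
    obtain ⟨q', hu⟩ := hu
    have h1 : Function.Injective (diag k B m q) := fun s t hst => by
      have := congr(diag k B m q' $hst)
      simpa [← Module.End.mul_apply, ← map_mul, hu] using this
    exact Function.Bijective.comp (g := diag k B m q) ⟨h1, LinearMap.injective_iff_surjective.1 h1⟩
      (twistMap_bijective hJ m)
  have h1 (t : TPow k A (m + 1)) :
      coinvProj k B m (twistMap Ψ J (m + 1) t) = K (coinvProj k A m t) := by
    obtain ⟨t, rfl⟩ := (consEquiv k A m).surjective t
    hopf_tensor_induction t with h w
    have h2 (u : A ⊗[k] A) : coinvProj k B m (consEquiv k B m (TensorProduct.map Ψ.toLinearMap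
        (twistMap Ψ J m) ((consEquiv k A m).symm (consAct k A m u (cons h w))))) =
        diag k B m (antipode k (Ψ h) * LinearMap.mul' k B ((antipode k).rTensor B
          (Algebra.TensorProduct.map Ψ.toAlgHom Ψ.toAlgHom u))) (twistMap Ψ J m w) := by
      induction u using TensorProduct.induction_on with
      | zero => simp
      | add s s' hs hs' => simp only [map_add, LinearMap.add_apply, mul_add, hs, hs']
      | tmul p r => simp [antipode_mul_antidistrib, twistMap_diag hJ]
    rw [twistMap_succ, consEquiv_tmul, h2]
    refine (congr(diag k B m $(antipode_mul_twistElement hJ h) (twistMap Ψ J m w))).trans ?_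
    simp [K, twistMap_diag hJ, hq']
  have h2 (w : TPow k A m) : coinvProj k B m (twistMap Ψ J (m + 1) (snoc w 1)) =
      rot k B m (K w) := by
    have h3 (u : A ⊗[k] A) : coinvProj k B m (snocEquiv k B m (TensorProduct.map (twistMap Ψ J m)
        Ψ.toLinearMap ((snocEquiv k A m).symm (snocAct k A m u (snoc w 1))))) =
        rot k B m (diag k B m (LinearMap.mul' k B ((antipodeInv k B).rTensor B (TensorProduct.comm
          k B B (Algebra.TensorProduct.map Ψ.toAlgHom Ψ.toAlgHom u)))) (twistMap Ψ J m w)) := by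
      induction u using TensorProduct.induction_on with
      | zero => simp
      | add s s' hs hs' => simp only [map_add, LinearMap.add_apply, hs, hs']
      | tmul p r => simp [twistMap_diag hJ, rot_apply, coinvProj_snoc_diag]
    rw [twistMap_snoc hJ, h3, hq]
    rfl
  have h3 (w : TPow k A m) : rot k B m (K w) = K (rot k A m w) := by rw [← h2, h1]; rfl
  have h4 : (LinearEquiv.ofBijective K hK).conj (rotInv k A m) = rotInv k B m := by
    ext w
    obtain ⟨w, rfl⟩ := hK.2 w
    have e1 : rot k B m * rotInv k B m = 1 := rot_mul_rotInv
    have e2 : rotInv k B m (rot k B m (K (rotInv k A m w))) = K (rotInv k A m w) :=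
      congr($(mul_eq_one_comm.1 e1) _)
    have e3 : rot k A m (rotInv k A m w) = w := congr($(rot_mul_rotInv) w)
    have e4 : (LinearEquiv.ofBijective K hK).symm (K w) = w :=
      (LinearEquiv.ofBijective K hK).symm_apply_apply w
    rw [h3, e3] at e2
    rw [LinearEquiv.conj_apply, e2]
    simp [e4]
  rw [← h4, LinearMap.trace_conj']

end Twist

/-! ### Tensor squares of dual Hopf algebras as functionals -/

section TensorPairing

open DualCop

variable {k : Type*} [Field k]
  {R₁ R₂ C₁ C₂ : Type*} [Ring R₁] [Algebra k R₁] [Ring R₂] [Algebra k R₂]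
  [AddCommGroup C₁] [Module k C₁] [AddCommGroup C₂] [Module k C₂]

/-- The pairing of `R₁ ⊗ R₂` with `C₁ ⊗ C₂` given by pairings of the factors. -/
def tensorPair (p : R₁ →ₗ[k] Module.Dual k C₁) (q : R₂ →ₗ[k] Module.Dual k C₂) :
    R₁ ⊗[k] R₂ →ₗ[k] Module.Dual k (C₁ ⊗[k] C₂) :=
  TensorProduct.dualDistrib k C₁ C₂ ∘ₗ TensorProduct.map p q

@[simp] lemma tensorPair_tmul (p : R₁ →ₗ[k] Module.Dual k C₁) (q : R₂ →ₗ[k] Module.Dual k C₂)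
    (a : R₁) (b : R₂) (x : C₁) (y : C₂) : tensorPair p q (a ⊗ₜ b) (x ⊗ₜ y) = p a x * q b y := rfl

lemma tensorPair_injective [FiniteDimensional k C₁] [FiniteDimensional k C₂]
    {p : R₁ →ₗ[k] Module.Dual k C₁} {q : R₂ →ₗ[k] Module.Dual k C₂}
    (hp : Function.Injective p) (hq : Function.Injective q) :
    Function.Injective (tensorPair p q) :=
  (TensorProduct.dualDistribEquiv k C₁ C₂).injective.comp
    (TensorProduct.map_injective_of_flat_flat p q hp hq)

variable [Coalgebra k C₁] [Coalgebra k C₂]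

/-- The pairing `p` turns the multiplication of `R` into the convolution of functionals on `C`. -/
def IsConvPairing (p : R₁ →ₗ[k] Module.Dual k C₁) : Prop :=
  ∀ a b c, p (a * b) c = LinearMap.mul' k k (TensorProduct.map (p a) (p b) (comul c))

lemma IsConvPairing.tensorPair {p : R₁ →ₗ[k] Module.Dual k C₁} {q : R₂ →ₗ[k] Module.Dual k C₂}
    (hp : IsConvPairing p) (hq : IsConvPairing q) : IsConvPairing (tensorPair p q) := by
  intro s t c
  induction s using TensorProduct.induction_on with
  | zero => simp
  | add s s' hs hs' => simp only [map_add, map_add_left, add_mul, LinearMap.add_apply, hs, hs']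
  | tmul a b =>
  induction t using TensorProduct.induction_on with
  | zero => simp
  | add s s' hs hs' => simp only [map_add, map_add_right, mul_add, LinearMap.add_apply, hs, hs']
  | tmul a' b' =>
  induction c using TensorProduct.induction_on with
  | zero => simp
  | add s s' hs hs' => simp only [map_add, hs, hs']
  | tmul x y =>
    rw [Algebra.TensorProduct.tmul_mul_tmul, tensorPair_tmul, hp, hq, TensorProduct.comul_tmul]
    induction comul (R := k) x using TensorProduct.induction_on with
    | zero => simp
    | add s s' hs hs' => simp only [map_add, add_mul, add_tmul, hs, hs']
    | tmul x x' =>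
    induction comul (R := k) y using TensorProduct.induction_on with
    | zero => simp
    | add s s' hs hs' => simp only [map_add, mul_add, tmul_add, hs, hs']
    | tmul y y' =>
      simp
      ring

end TensorPairing

section

open DualCop

variable {k : Type u} {H : Type v} [Field k] [Ring H] [HopfAlgebra k H]

variable (k H) in
/-- The pairing of `H^{*cop} ⊗ H^{*cop}` with `H ⊗ H`. -/
def pairing₂ : DualCop k H ⊗[k] DualCop k H →ₗ[k] Module.Dual k (H ⊗[k] H) :=
  tensorPair (pairing k H).toLinearMap (pairing k H).toLinearMap

@[simp] lemma pairing₂_tmul (f g : DualCop k H) (x y : H) :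
    pairing₂ k H (f ⊗ₜ g) (x ⊗ₜ y) = pairing k H f x * pairing k H g y := rfl

lemma pairing₂_eq (t : DualCop k H ⊗[k] DualCop k H) (x y : H) :
    pairing₂ k H t (x ⊗ₜ y) = pairing k H (contr x t) y := by
  induction t using TensorProduct.induction_on with
  | zero => simp
  | add s s' hs hs' => simp only [map_add, LinearMap.add_apply, hs, hs']
  | tmul f g => simp

variable (k H) in
lemma isConvPairing_pairing : IsConvPairing (pairing k H).toLinearMap := pairing_mul

variable (k H) in
lemma isConvPairing_pairing₂ : IsConvPairing (pairing₂ k H) :=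
  (isConvPairing_pairing k H).tensorPair (isConvPairing_pairing k H)

lemma pairing₂_one (x : H ⊗[k] H) : pairing₂ k H 1 x = counit x := by
  hopf_tensor_induction x with x y
  simp [Algebra.TensorProduct.one_def, pairing_one, mul_comm]

variable [FiniteDimensional k H]

lemma pairing₂_comul (f : DualCop k H) (x y : H) :
    pairing₂ k H (comul f) (x ⊗ₜ y) = pairing k H f (y * x) := by
  rw [pairing₂_eq, pairing_comul]

variable (k H) in
lemma pairing₂_injective : Function.Injective (pairing₂ k H) :=
  tensorPair_injective (pairing k H).injective (pairing k H).injective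

/-- The element of `H^{*cop} ⊗ H^{*cop}` with given values on `H ⊗ H`. -/
lemma exists_pairing₂_eq (j : Module.Dual k (H ⊗[k] H)) : ∃ J, pairing₂ k H J = j := by
  obtain ⟨t, rfl⟩ := (TensorProduct.dualDistribEquiv k H H).surjective j
  refine ⟨TensorProduct.map (pairing k H).symm.toLinearMap (pairing k H).symm.toLinearMap t, ?_⟩
  hopf_tensor_induction t with f g
  rfl

end

/-! ### The skew pairing -/

section SkewPairing

open DualCop

variable {k : Type u} {H : Type v} [Field k] [Ring H] [HopfAlgebra k H]

/-- The functional `(f ⊗ a) ⊗ (g ⊗ b) ↦ f(T b) ε(a) ε(g)` on the tensor square of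
`H^{*cop} ⊗ H`. For `T = id` it is, up to the order of its arguments, the cocycle by which the
multiplication of the double differs from that of `H^{*cop} ⊗ H`. -/
def skew (T : H →ₗ[k] H) : Module.Dual k ((DualCop k H ⊗[k] H) ⊗[k] (DualCop k H ⊗[k] H)) :=
  TensorProduct.lift (LinearMap.mk₂ k (fun x y => pairing k H
    (TensorProduct.rid k (DualCop k H) (counit.lTensor _ x)) (T (contr 1 y)))
    (by intros; simp) (by intros; simp) (by intros; simp) (by intros; simp))

@[simp] lemma skew_tmul (T : H →ₗ[k] H) (f : DualCop k H) (a : H) (y : DualCop k H ⊗[k] H) :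
    skew T ((f ⊗ₜ a) ⊗ₜ y) = counit (R := k) a * pairing k H f (T (contr 1 y)) := by
  simp [skew]

variable [FiniteDimensional k H]

/-- The convolution product of `skew T` and a functional `φ` on the coalgebra
`(H^{*cop} ⊗ H) ⊗ (H^{*cop} ⊗ H)`. -/
lemma skew_conv (T : H →ₗ[k] H)
    (φ : Module.Dual k ((DualCop k H ⊗[k] H) ⊗[k] (DualCop k H ⊗[k] H)))
    (f g : DualCop k H) (a b : H) :
    LinearMap.mul' k k (TensorProduct.map (skew T) φ
      (comul (R := k) ((f ⊗ₜ[k] a) ⊗ₜ[k] (g ⊗ₜ[k] b)))) =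
    ∑ i ∈ (ℛ k b).index, φ ((contr (T ((ℛ k b).left i)) (comul f) ⊗ₜ a) ⊗ₜ
      (g ⊗ₜ (ℛ k b).right i)) := by
  have ha := congr(TensorProduct.lid k H $(rTensor_counit_comul (R := k) a))
  have hg := congr(TensorProduct.lid k _ $(rTensor_counit_comul (R := k) g))
  simp only [TensorProduct.lid_tmul, one_smul] at ha hg
  rw [TensorProduct.comul_tmul, TensorProduct.comul_tmul, TensorProduct.comul_tmul]
  conv_rhs => rw [← ha, ← hg]
  conv_lhs => rw [← (ℛ k b).eq]
  generalize comul (R := k) f = s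
  generalize comul (R := k) a = t
  generalize comul (R := k) g = u
  induction s using TensorProduct.induction_on with
  | zero => simp
  | add s s' hs hs' => simp only [map_add, add_tmul, Finset.sum_add_distrib, hs, hs']
  | tmul f f' =>
  induction t using TensorProduct.induction_on with
  | zero => simp
  | add s s' hs hs' => simp only [map_add, add_tmul, tmul_add, Finset.sum_add_distrib, hs, hs']
  | tmul a a' =>
  induction u using TensorProduct.induction_on with
  | zero => simp
  | add s s' hs hs' => simp only [map_add, add_tmul, tmul_add, Finset.sum_add_distrib, hs, hs']
  | tmul g g' =>
  simp only [tmul_sum, map_sum]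
  refine Finset.sum_congr rfl fun i _ => ?_
  simp [DualCop.counit_apply, smul_tmul', tmul_smul, mul_comm]
  simp only [← smul_tmul', tmul_smul, map_smul, smul_eq_mul]
  ring

/-- The convolution product of a functional `φ` and `skew T` on the coalgebra
`(H^{*cop} ⊗ H) ⊗ (H^{*cop} ⊗ H)`. -/
lemma conv_skew (T : H →ₗ[k] H)
    (φ : Module.Dual k ((DualCop k H ⊗[k] H) ⊗[k] (DualCop k H ⊗[k] H)))
    (f g : DualCop k H) (a b : H) :
    LinearMap.mul' k k (TensorProduct.map φ (skew T)
      (comul (R := k) ((f ⊗ₜ[k] a) ⊗ₜ[k] (g ⊗ₜ[k] b)))) =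
    ∑ i ∈ (ℛ k b).index, φ ((contr (T ((ℛ k b).right i)) (TensorProduct.comm k _ _ (comul f)) ⊗ₜ
      a) ⊗ₜ (g ⊗ₜ (ℛ k b).left i)) := by
  have ha := congr(TensorProduct.rid k H $(lTensor_counit_comul (R := k) a))
  have hg := congr(TensorProduct.rid k _ $(lTensor_counit_comul (R := k) g))
  simp only [TensorProduct.rid_tmul, one_smul] at ha hg
  rw [TensorProduct.comul_tmul, TensorProduct.comul_tmul, TensorProduct.comul_tmul]
  conv_rhs => rw [← ha, ← hg]
  conv_lhs => rw [← (ℛ k b).eq]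
  generalize comul (R := k) f = s
  generalize comul (R := k) a = t
  generalize comul (R := k) g = u
  induction s using TensorProduct.induction_on with
  | zero => simp
  | add s s' hs hs' => simp only [map_add, add_tmul, Finset.sum_add_distrib, hs, hs']
  | tmul f f' =>
  induction t using TensorProduct.induction_on with
  | zero => simp
  | add s s' hs hs' => simp only [map_add, add_tmul, tmul_add, Finset.sum_add_distrib, hs, hs']
  | tmul a a' =>
  induction u using TensorProduct.induction_on with
  | zero => simp
  | add s s' hs hs' => simp only [map_add, add_tmul, tmul_add, Finset.sum_add_distrib, hs, hs']
  | tmul g g' =>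
  simp only [tmul_sum, map_sum]
  refine Finset.sum_congr rfl fun i _ => ?_
  simp [DualCop.counit_apply, smul_tmul', tmul_smul, mul_comm]
  simp only [← smul_tmul', tmul_smul, map_smul, smul_eq_mul]
  ring

end SkewPairing

/-! ### The multiplication of the double -/

section DoubleIsTwist

open DualCop

variable {k : Type u} {H : Type v} [Field k] [Ring H] [HopfAlgebra k H] [FiniteDimensional k H]

variable (k H) in
/-- The double and the tensor product `H^{*cop} ⊗ H` have the same underlying coalgebra. -/
def toDouble : DualCop k H ⊗[k] H ≃ₗ[k] DrinfeldDouble k H :=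
  LinearEquiv.refl k (DualCop k H ⊗[k] H)

lemma toDouble_tmul (f : DualCop k H) (h : H) :
    toDouble k H (f ⊗ₜ h) = DrinfeldDouble.tmul f h := rfl

lemma comul_toDouble (x : DualCop k H ⊗[k] H) : comul (R := k) (toDouble k H x) =
    TensorProduct.map (toDouble k H).toLinearMap (toDouble k H).toLinearMap (comul x) :=
  congr($(TensorProduct.map_id (R := k) (M := DualCop k H ⊗[k] H) (N := DualCop k H ⊗[k] H))
    (comul (R := k) x)).symm

variable (k H) in
/-- The dual algebras of `H^{*cop} ⊗ H` and of the double agree. -/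
def dualDoubleEquiv : DualCop k (DualCop k H ⊗[k] H) ≃ₐ[k] DualCop k (DrinfeldDouble k H) :=
  AlgEquiv.ofLinearEquiv
    (pairing k (DualCop k H ⊗[k] H) ≪≫ₗ (toDouble k H).symm.dualMap ≪≫ₗ
      (pairing k (DrinfeldDouble k H)).symm) rfl (fun _ _ => rfl)

@[simp] lemma pairing_dualDoubleEquiv (F : DualCop k (DualCop k H ⊗[k] H))
    (x : DualCop k H ⊗[k] H) : pairing k (DrinfeldDouble k H) (dualDoubleEquiv k H F)
      (toDouble k H x) = pairing k _ F x := rfl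

lemma pairing₂_dualDoubleEquiv
    (t : DualCop k (DualCop k H ⊗[k] H) ⊗[k] DualCop k (DualCop k H ⊗[k] H))
    (x : (DualCop k H ⊗[k] H) ⊗[k] (DualCop k H ⊗[k] H)) :
    pairing₂ k (DrinfeldDouble k H) (Algebra.TensorProduct.map (dualDoubleEquiv k H).toAlgHom
      (dualDoubleEquiv k H).toAlgHom t)
      (TensorProduct.map (toDouble k H).toLinearMap (toDouble k H).toLinearMap x) =
      pairing₂ k _ t x := by
  induction t using TensorProduct.induction_on with
  | zero => simp
  | add s s' hs hs' => simp only [map_add, LinearMap.add_apply, hs, hs']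
  | tmul F G =>
    hopf_tensor_induction x with x y
    simp

lemma comul_map_toDouble (x : (DualCop k H ⊗[k] H) ⊗[k] (DualCop k H ⊗[k] H)) :
    comul (R := k) (TensorProduct.map (toDouble k H).toLinearMap (toDouble k H).toLinearMap x) =
    TensorProduct.map (TensorProduct.map (toDouble k H).toLinearMap (toDouble k H).toLinearMap)
      (TensorProduct.map (toDouble k H).toLinearMap (toDouble k H).toLinearMap) (comul x) := by
  hopf_tensor_induction x with x y
  simp only [map_tmul, TensorProduct.comul_tmul, LinearEquiv.coe_coe, comul_toDouble]
  hopf_tensor_induction comul (R := k) x with x x'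
  hopf_tensor_induction comul (R := k) y with y y'
  simp

lemma pairing_contr_comm_comul (f : DualCop k H) (x y : H) :
    pairing k H (contr x (TensorProduct.comm k _ _ (comul f))) y = pairing k H f (x * y) := by
  rw [← pairing_comul f y x]
  induction comul (R := k) f using TensorProduct.induction_on with
  | zero => simp
  | add s s' hs hs' => simp only [map_add, LinearMap.add_apply, hs, hs']
  | tmul g h => simp [mul_comm]

/-- `∑ h₍₁₎ · (f₍₁₎ ⊗ y) f₍₂₎(h₍₂₎) = ∑ f₍₁₎(h₍₁₎) f₍₂₎ ⊗ h₍₂₎ y`, where the action on the left is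
the multiplication of the double. -/
lemma sum_leftH_contr (f : DualCop k H) (h y : H) :
    ∑ i ∈ (ℛ k h).index, leftH ((ℛ k h).left i)
      (contr ((ℛ k h).right i) (TensorProduct.comm k _ _ (comul f)) ⊗ₜ y) =
    ∑ i ∈ (ℛ k h).index, contr ((ℛ k h).left i) (comul f) ⊗ₜ[k] ((ℛ k h).right i * y) := by
  refine contr_ext fun z => ?_
  obtain ⟨Γ, hΓ⟩ : ∃ Γ : H ⊗[k] (H ⊗[k] (H ⊗[k] H)) →ₗ[k] H, ∀ p q r s, Γ (p ⊗ₜ (q ⊗ₜ (r ⊗ₜ s))) =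
      pairing k H f (s * antipodeInv k H r * (z * p)) • (q * y) := by
    let σ : H ⊗[k] (H ⊗[k] H) →ₗ[k] k := pairing k H f ∘ₗ LinearMap.mul' k H ∘ₗ
      (TensorProduct.comm k H H).toLinearMap ∘ₗ TensorProduct.map (LinearMap.mulLeft k z)
        (LinearMap.mul' k H ∘ₗ (antipodeInv k H).lTensor H ∘ₗ
          (TensorProduct.comm k H H).toLinearMap)
    refine ⟨(TensorProduct.rid k H).toLinearMap ∘ₗ TensorProduct.map (LinearMap.mulRight k y) σ ∘ₗ
      (TensorProduct.leftComm k H H (H ⊗[k] H)).toLinearMap, ?_⟩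
    intros
    simp [σ]
  -- both sides are the image of `h₍₁₎ ⊗ h₍₂₎ ⊗ h₍₃₎ ⊗ h₍₄₎` under `Γ`
  have h1 (c s : H) : contr z (leftH c (contr s (TensorProduct.comm k _ _ (comul f)) ⊗ₜ y)) =
      Γ ((TensorProduct.assoc k H H H).toLinearMap.lTensor H (TensorProduct.assoc k H _ H
        (comul₃ k H c ⊗ₜ s))) := by
    rw [leftH, LinearMap.comp_apply]
    induction comul₃ k H c using TensorProduct.induction_on with
    | zero => simp
    | add s s' hs hs' => simp only [map_add, LinearMap.add_apply, add_tmul, hs, hs']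
    | tmul p t =>
    induction t using TensorProduct.induction_on with
    | zero => simp
    | add s s' hs hs' => simp only [map_add, LinearMap.add_apply, add_tmul, tmul_add, hs, hs']
    | tmul q r =>
      simp [hΓ, pairing_coadj, pairing_contr_comm_comul, mul_assoc]
  have h2 : (TensorProduct.assoc k H H H).toLinearMap.lTensor H (TensorProduct.assoc k H _ H
        ((comul₃ k H).rTensor H (comul h))) =
      (comul.lTensor H ∘ₗ comul).lTensor H (comul h) := by
    have e1 : (comul₃ k H).rTensor H (comul h) = (comul.lTensor H).rTensor H
        ((TensorProduct.assoc k H H H).symm (comul₃ k H h)) := by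
      rw [comul₃, LinearMap.rTensor_comp_apply, LinearMap.comp_apply, ← coassoc_apply,
        LinearEquiv.symm_apply_apply]
    have e2 : (comul.lTensor H ∘ₗ comul).lTensor H (comul (R := k) h) =
        ((TensorProduct.assoc k H H H).toLinearMap ∘ₗ comul.rTensor H).lTensor H
          (comul₃ k H h) := by
      rw [comul₃, LinearMap.comp_apply, ← LinearMap.lTensor_comp_apply, LinearMap.comp_assoc,
        Coalgebra.coassoc]
    rw [e1, e2]
    induction comul₃ k H h using TensorProduct.induction_on with
    | zero => simp
    | add s s' hs hs' => simp only [map_add, hs, hs']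
    | tmul p t =>
    induction t using TensorProduct.induction_on with
    | zero => simp
    | add s s' hs hs' => simp only [map_add, tmul_add, hs, hs']
    | tmul q r =>
      simp only [TensorProduct.assoc_symm_tmul, LinearMap.rTensor_tmul, LinearMap.lTensor_tmul,
        LinearMap.comp_apply]
      generalize comul (R := k) q = t
      induction t using TensorProduct.induction_on with
      | zero => simp
      | add s s' hs hs' => simp only [map_add, tmul_add, add_tmul, hs, hs']
      | tmul a b => simp
  have h3 (p c : H) : Γ (p ⊗ₜ (comul.lTensor H (comul c))) =
      pairing k H f (z * p) • (c * y) := by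
    have hc := congr(TensorProduct.rid k H $(lTensor_counit_comul (R := k) c))
    simp only [TensorProduct.rid_tmul, one_smul] at hc
    conv_rhs => rw [← hc]
    induction comul (R := k) c using TensorProduct.induction_on with
    | zero => simp
    | add s s' hs hs' => simp only [map_add, tmul_add, add_mul, smul_add, hs, hs']
    | tmul q d =>
      have hd := mul_antipodeInv (k := k) d
      rw [LinearMap.lTensor_tmul]
      have h4 (t : H ⊗[k] H) : Γ (p ⊗ₜ (q ⊗ₜ t)) = pairing k H f (LinearMap.mul' k H
          ((antipodeInv k H).lTensor H (TensorProduct.comm k H H t)) * (z * p)) • (q * y) := by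
        induction t using TensorProduct.induction_on with
        | zero => simp
        | add s s' hs hs' => simp only [map_add, tmul_add, add_mul, add_smul, hs, hs']
        | tmul r s => simp [hΓ]
      rw [h4, hd]
      simp only [Algebra.algebraMap_eq_smul_one, smul_mul_assoc, one_mul, map_smul, smul_eq_mul,
        LinearMap.lTensor_tmul, TensorProduct.rid_tmul, mul_smul]
      rw [smul_comm]
  simp only [map_sum, h1, contr_tmul, pairing_comul]
  have h5 := congr(Γ $h2)
  conv_lhs at h5 => rw [← (ℛ k h).eq]
  conv_rhs at h5 => rw [← (ℛ k h).eq]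
  simpa [h3] using h5

open DrinfeldDouble in
/-- The multiplications of the double and of `H^{*cop} ⊗ H` are conjugate by `skew id`. -/
lemma sum_mul_toDouble (f g : DualCop k H) (a b : H) :
    ∑ i ∈ (ℛ k b).index, tmul g ((ℛ k b).left i) *
      tmul (contr ((ℛ k b).right i) (TensorProduct.comm k _ _ (comul f))) a =
    ∑ i ∈ (ℛ k b).index, tmul (g * contr ((ℛ k b).left i) (comul f)) ((ℛ k b).right i * a) := by
  have h1 (h : H) (f' : DualCop k H) :
      tmul g h * tmul f' a = tmul g 1 * toDouble k H (leftH h (f' ⊗ₜ a)) := by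
    rw [tmul_eq_mul, mul_assoc]
    exact congr_arg _ (one_tmul_mul h _)
  have h2 (h : H) (f' : DualCop k H) :
      tmul (g * f') (h * a) = tmul g 1 * toDouble k H (f' ⊗ₜ (h * a)) := by
    rw [toDouble_tmul, tmul_one_mul_tmul]
  simp only [h1, h2]
  rw [← Finset.mul_sum, ← Finset.mul_sum, ← map_sum, ← map_sum, sum_leftH_contr]

end DoubleIsTwist

/-! ### The dual of the double as a twist -/

section

open DualCop

variable {k M N P : Type*} [Field k] [AddCommGroup M] [Module k M] [AddCommGroup N] [Module k N]
  [AddCommGroup P] [Module k P]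

lemma linearMap_ext_tmul₄ {φ ψ : (M ⊗[k] N) ⊗[k] (M ⊗[k] N) →ₗ[k] P}
    (h : ∀ f a g b, φ ((f ⊗ₜ a) ⊗ₜ (g ⊗ₜ b)) = ψ ((f ⊗ₜ a) ⊗ₜ (g ⊗ₜ b))) : φ = ψ := by
  refine TensorProduct.ext (TensorProduct.ext' fun f a => TensorProduct.ext' fun g b => ?_)
  exact h f a g b

lemma linearMap_ext_tmul₆ {φ ψ : (M ⊗[k] N) ⊗[k] ((M ⊗[k] N) ⊗[k] (M ⊗[k] N)) →ₗ[k] P}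
    (h : ∀ f a g b e c, φ ((f ⊗ₜ a) ⊗ₜ ((g ⊗ₜ b) ⊗ₜ (e ⊗ₜ c))) =
      ψ ((f ⊗ₜ a) ⊗ₜ ((g ⊗ₜ b) ⊗ₜ (e ⊗ₜ c)))) : φ = ψ := by
  refine TensorProduct.ext (TensorProduct.ext' fun f a => linearMap_ext_tmul₄ fun g b e c => ?_)
  exact h f a g b e c

end

section

open DualCop

variable {k : Type u} [Field k] {C₁ C₂ : Type*} [AddCommGroup C₁] [Module k C₁] [Coalgebra k C₁]
  [AddCommGroup C₂] [Module k C₂] [Coalgebra k C₂]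

/-- Convolving with `α ⊗ ε` only affects the first variable. -/
lemma map_counit_right_comul (α : Module.Dual k C₁) (β φ : Module.Dual k (C₁ ⊗[k] C₂))
    (hβ : ∀ x y, β (x ⊗ₜ y) = α x * counit (R := k) y) (x : C₁) (y : C₂) :
    LinearMap.mul' k k (TensorProduct.map β φ (comul (x ⊗ₜ[k] y))) =
      LinearMap.mul' k k
        (TensorProduct.map α (φ ∘ₗ (TensorProduct.mk k C₁ C₂).flip y) (comul x)) := by
  have hy := congr(TensorProduct.lid k _ $(rTensor_counit_comul (R := k) y))
  simp only [TensorProduct.lid_tmul, one_smul] at hy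
  conv_rhs => rw [← hy]
  rw [TensorProduct.comul_tmul]
  induction comul (R := k) x using TensorProduct.induction_on with
  | zero => simp
  | add s s' hs hs' => simp only [map_add, add_tmul, hs, hs']
  | tmul x x' =>
  induction comul (R := k) y using TensorProduct.induction_on with
  | zero => simp
  | add s s' hs hs' =>
    simp only [map_add, tmul_add, hs, hs', LinearMap.comp_add, map_add_right, LinearMap.add_apply]
  | tmul y y' => simp [hβ, mul_assoc]

/-- Convolving with `ε ⊗ α` only affects the second variable. -/
lemma map_counit_left_comul (α : Module.Dual k C₂) (β φ : Module.Dual k (C₁ ⊗[k] C₂))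
    (hβ : ∀ x y, β (x ⊗ₜ y) = counit (R := k) x * α y) (x : C₁) (y : C₂) :
    LinearMap.mul' k k (TensorProduct.map β φ (comul (x ⊗ₜ[k] y))) =
      LinearMap.mul' k k (TensorProduct.map α (φ ∘ₗ TensorProduct.mk k C₁ C₂ x) (comul y)) := by
  have hx := congr(TensorProduct.lid k _ $(rTensor_counit_comul (R := k) x))
  simp only [TensorProduct.lid_tmul, one_smul] at hx
  conv_rhs => rw [← hx]
  rw [TensorProduct.comul_tmul]
  induction comul (R := k) x using TensorProduct.induction_on with
  | zero => simp
  | add s s' hs hs' =>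
    simp only [map_add, add_tmul, hs, hs', LinearMap.comp_add, map_add_right, LinearMap.add_apply]
  | tmul x x' =>
  induction comul (R := k) y using TensorProduct.induction_on with
  | zero => simp
  | add s s' hs hs' => simp only [map_add, tmul_add, hs, hs']
  | tmul y y' =>
    simp [hβ]
    ring

end

section

open DualCop

variable {k : Type u} {X : Type v} [Field k] [Ring X] [HopfAlgebra k X]

variable (k X) in
lemma isConvPairing_tensorPair_left :
    IsConvPairing (tensorPair (pairing₂ k X) (pairing k X).toLinearMap) :=
  (isConvPairing_pairing₂ k X).tensorPair (isConvPairing_pairing k X)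

variable (k X) in
lemma isConvPairing_tensorPair_right :
    IsConvPairing (tensorPair (pairing k X).toLinearMap (pairing₂ k X)) :=
  (isConvPairing_pairing k X).tensorPair (isConvPairing_pairing₂ k X)

lemma tensorPair_assoc (t : (DualCop k X ⊗[k] DualCop k X) ⊗[k] DualCop k X) (x y z : X) :
    tensorPair (pairing k X).toLinearMap (pairing₂ k X) (TensorProduct.assoc k _ _ _ t)
      (x ⊗ₜ (y ⊗ₜ z)) =
    tensorPair (pairing₂ k X) (pairing k X).toLinearMap t ((x ⊗ₜ y) ⊗ₜ z) := by
  induction t using TensorProduct.induction_on with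
  | zero => simp
  | add s s' hs hs' => simp only [map_add, LinearMap.add_apply, hs, hs']
  | tmul t c =>
  induction t using TensorProduct.induction_on with
  | zero => simp
  | add s s' hs hs' => simp only [map_add, LinearMap.add_apply, add_tmul, hs, hs']
  | tmul a b => simp [mul_assoc]

/-- Left multiplication by `J ⊗ 1` on the values of functionals on `X ⊗ X ⊗ X`. -/
lemma tensorPair_tmul_one_mul (J : DualCop k X ⊗[k] DualCop k X)
    (t : (DualCop k X ⊗[k] DualCop k X) ⊗[k] DualCop k X) (w : X ⊗[k] X) (z : X) :
    tensorPair (pairing₂ k X) (pairing k X).toLinearMap ((J ⊗ₜ 1) * t) (w ⊗ₜ z) =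
      LinearMap.mul' k k (TensorProduct.map (pairing₂ k X J)
        (tensorPair (pairing₂ k X) (pairing k X).toLinearMap t ∘ₗ
          (TensorProduct.mk k _ _).flip z) (comul w)) := by
  rw [isConvPairing_tensorPair_left]
  exact map_counit_right_comul _ _ _ (fun x y => rfl) w z

/-- Left multiplication by `1 ⊗ J` on the values of functionals on `X ⊗ X ⊗ X`. -/
lemma tensorPair_one_tmul_mul (J : DualCop k X ⊗[k] DualCop k X)
    (t : DualCop k X ⊗[k] (DualCop k X ⊗[k] DualCop k X)) (x : X) (w : X ⊗[k] X) :
    tensorPair (pairing k X).toLinearMap (pairing₂ k X) ((1 ⊗ₜ J) * t) (x ⊗ₜ w) =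
      LinearMap.mul' k k (TensorProduct.map (pairing₂ k X J)
        (tensorPair (pairing k X).toLinearMap (pairing₂ k X) t ∘ₗ
          TensorProduct.mk k _ _ x) (comul w)) := by
  rw [isConvPairing_tensorPair_right]
  exact map_counit_left_comul _ _ _ (fun x y => rfl) x w

variable [FiniteDimensional k X]

lemma tensorPair_comul_rTensor (t : DualCop k X ⊗[k] DualCop k X) (x y z : X) :
    tensorPair (pairing₂ k X) (pairing k X).toLinearMap (comul.rTensor _ t) ((x ⊗ₜ y) ⊗ₜ z) =
      pairing₂ k X t ((y * x) ⊗ₜ z) := by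
  induction t using TensorProduct.induction_on with
  | zero => simp
  | add s s' hs hs' => simp only [map_add, LinearMap.add_apply, hs, hs']
  | tmul a b => simp [pairing₂_comul]

lemma tensorPair_comul_lTensor (t : DualCop k X ⊗[k] DualCop k X) (x y z : X) :
    tensorPair (pairing k X).toLinearMap (pairing₂ k X) (comul.lTensor _ t) (x ⊗ₜ (y ⊗ₜ z)) =
      pairing₂ k X t (x ⊗ₜ (z * y)) := by
  induction t using TensorProduct.induction_on with
  | zero => simp
  | add s s' hs hs' => simp only [map_add, LinearMap.add_apply, hs, hs']
  | tmul a b => simp [pairing₂_comul]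

lemma pairing_lid_counit (t : DualCop k X ⊗[k] DualCop k X) (y : X) :
    pairing k X (TensorProduct.lid k _ (counit.rTensor _ t)) y = pairing₂ k X t (1 ⊗ₜ y) := by
  induction t using TensorProduct.induction_on with
  | zero => simp
  | add s s' hs hs' => simp only [map_add, LinearMap.add_apply, hs, hs']
  | tmul a b => simp [counit_apply]

lemma pairing_rid_counit (t : DualCop k X ⊗[k] DualCop k X) (x : X) :
    pairing k X (TensorProduct.rid k _ (counit.lTensor _ t)) x = pairing₂ k X t (x ⊗ₜ 1) := by
  induction t using TensorProduct.induction_on with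
  | zero => simp
  | add s s' hs hs' => simp only [map_add, LinearMap.add_apply, hs, hs']
  | tmul a b => simp [counit_apply, mul_comm]

end

section DoubleTwistElement

open DualCop

variable {k : Type u} {H : Type v} [Field k] [Ring H] [HopfAlgebra k H] [FiniteDimensional k H]
  {J : DualCop k (DualCop k H ⊗[k] H) ⊗[k] DualCop k (DualCop k H ⊗[k] H)}

/-- The comultiplication of the dual of the double is conjugate by `J` to that of the dual of
`H^{*cop} ⊗ H`; this is dual to `sum_mul_toDouble`. -/
lemma skew_comul_map (hJ : pairing₂ k (DualCop k H ⊗[k] H) J = skew LinearMap.id)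
    (F : DualCop k (DualCop k H ⊗[k] H)) :
    comul (R := k) (dualDoubleEquiv k H F) * Algebra.TensorProduct.map
      (dualDoubleEquiv k H).toAlgHom (dualDoubleEquiv k H).toAlgHom J =
    Algebra.TensorProduct.map (dualDoubleEquiv k H).toAlgHom (dualDoubleEquiv k H).toAlgHom
      (J * comul F) := by
  have key : pairing₂ k (DrinfeldDouble k H) (comul (R := k) (dualDoubleEquiv k H F) *
      Algebra.TensorProduct.map
        (dualDoubleEquiv k H).toAlgHom (dualDoubleEquiv k H).toAlgHom J) ∘ₗ
        TensorProduct.map (toDouble k H).toLinearMap (toDouble k H).toLinearMap =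
      pairing₂ k (DualCop k H ⊗[k] H) (J * comul F) := by
    refine linearMap_ext_tmul₄ fun f a g b => ?_
    have hJ' : pairing₂ k (DrinfeldDouble k H) (Algebra.TensorProduct.map
        (dualDoubleEquiv k H).toAlgHom (dualDoubleEquiv k H).toAlgHom J) ∘ₗ
        TensorProduct.map (toDouble k H).toLinearMap (toDouble k H).toLinearMap =
        skew LinearMap.id :=
      LinearMap.ext fun x => (pairing₂_dualDoubleEquiv J x).trans (by rw [hJ])
    have h := congr(pairing k (DrinfeldDouble k H) (dualDoubleEquiv k H F)
      $(sum_mul_toDouble f g a b))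
    rw [LinearMap.comp_apply, isConvPairing_pairing₂, isConvPairing_pairing₂, hJ,
      comul_map_toDouble, ← LinearMap.comp_apply (TensorProduct.map (pairing₂ _ _ _) _),
      ← TensorProduct.map_comp, hJ', conv_skew, skew_conv]
    simp only [LinearMap.comp_apply, map_tmul, LinearEquiv.coe_coe, pairing₂_comul,
      LinearMap.id_apply, Algebra.TensorProduct.tmul_mul_tmul, toDouble_tmul]
    simp only [map_sum] at h
    exact h
  refine pairing₂_injective k (DrinfeldDouble k H) (LinearMap.ext fun w => ?_)
  obtain ⟨w, rfl⟩ : ∃ x, TensorProduct.map (toDouble k H).toLinearMap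
      (toDouble k H).toLinearMap x = w := ⟨w, LinearMap.congr_fun TensorProduct.map_id w⟩
  rw [pairing₂_dualDoubleEquiv]
  exact LinearMap.congr_fun key w

/-- The cocycle condition for `J`. Both sides take the value `ε(a) h(1) g(c₍₁₎) f(c₍₂₎ b)` at
`(f ⊗ a) ⊗ (g ⊗ b) ⊗ (h ⊗ c)`. -/
lemma skew_cocycle (hJ : pairing₂ k (DualCop k H ⊗[k] H) J = skew LinearMap.id) :
    TensorProduct.assoc k _ _ _ ((J ⊗ₜ 1) * comul.rTensor _ J) =
      (1 ⊗ₜ J) * comul.lTensor (DualCop k (DualCop k H ⊗[k] H)) J := by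
  refine tensorPair_injective (pairing k _).injective (pairing₂_injective k _)
    (linearMap_ext_tmul₆ fun f a g b h c => ?_)
  rw [tensorPair_assoc, tensorPair_tmul_one_mul, tensorPair_one_tmul_mul, hJ, skew_conv, skew_conv]
  simp only [LinearMap.comp_apply, LinearMap.flip_apply, TensorProduct.mk_apply,
    tensorPair_comul_rTensor, tensorPair_comul_lTensor, hJ, Algebra.TensorProduct.tmul_mul_tmul,
    skew_tmul, contr_tmul, LinearMap.id_apply]
  have h1 (y : H) : pairing k H (g * contr y (comul f)) c = ∑ j ∈ (ℛ k c).index,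
      pairing k H g ((ℛ k c).left j) * pairing k H f ((ℛ k c).right j * y) := by
    rw [pairing_mul, ← (ℛ k c).eq]
    simp [pairing_comul]
  have h2 (y : H) : pairing k H (h * contr y (comul g)) 1 = pairing k H h 1 * pairing k H g y := by
    simp [pairing_mul, Algebra.TensorProduct.one_def, pairing_comul]
  have h3 (y : H) : pairing k H f (y * b) = ∑ i ∈ (ℛ k b).index,
      counit (R := k) ((ℛ k b).right i) * pairing k H f (y * (ℛ k b).left i) := by
    conv_lhs => rw [← sum_smul_counit (ℛ k b)]
    simp [Finset.mul_sum]
  simp only [map_smul, smul_eq_mul, h1, h2, h3, Bialgebra.counit_mul, Finset.mul_sum,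
    mul_assoc]
  rw [Finset.sum_comm]
  exact Finset.sum_congr rfl fun j _ => Finset.sum_congr rfl fun i _ => by ring

lemma skew_counit_left (hJ : pairing₂ k (DualCop k H ⊗[k] H) J = skew LinearMap.id) :
    TensorProduct.lid k _ (counit.rTensor (DualCop k (DualCop k H ⊗[k] H)) J) = 1 := by
  ext y
  rw [pairing_lid_counit, hJ, Algebra.TensorProduct.one_def, skew_tmul, pairing_one, pairing_one]
  induction y using TensorProduct.induction_on with
  | zero => simp
  | add s s' hs hs' => simp only [map_add, mul_add, hs, hs']
  | tmul g b => simp [counit_apply, mul_comm]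

lemma skew_counit_right (hJ : pairing₂ k (DualCop k H ⊗[k] H) J = skew LinearMap.id) :
    TensorProduct.rid k _ (counit.lTensor (DualCop k (DualCop k H ⊗[k] H)) J) = 1 := by
  ext x
  rw [pairing_rid_counit, hJ, Algebra.TensorProduct.one_def, pairing_one]
  induction x using TensorProduct.induction_on with
  | zero => simp
  | add s s' hs hs' => simp only [map_add, add_tmul, hs, hs']
  | tmul g b => simp [counit_apply, pairing_one]

/-- The inverse of `J` is given by the skew pairing of `S⁻¹`. -/
lemma skew_isUnit (hJ : pairing₂ k (DualCop k H ⊗[k] H) J = skew LinearMap.id) :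
    ∃ J', J' * J = 1 := by
  obtain ⟨J', hJ'⟩ := exists_pairing₂_eq (skew (antipodeInv k H))
  refine ⟨J', pairing₂_injective k _ (linearMap_ext_tmul₄ fun f a g b => ?_)⟩
  have h := congr(pairing k H f $(mul_antipodeInv (k := k) b))
  rw [← (ℛ k b).eq] at h
  rw [isConvPairing_pairing₂, hJ, hJ', pairing₂_one, skew_conv]
  simp [pairing_comul, counit_apply, Algebra.algebraMap_eq_smul_one] at h ⊢
  simp only [← Finset.mul_sum, h]
  ring

/-- The dual of the double is a twist of the dual of `H^{*cop} ⊗ H`. -/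
theorem isTwist_dualDoubleEquiv
    (hJ : pairing₂ k (DualCop k H ⊗[k] H) J = skew LinearMap.id) :
    IsTwist (dualDoubleEquiv k H) J where
  counit_map _ := rfl
  comul_map := skew_comul_map hJ
  cocycle := skew_cocycle hJ
  counit_left := skew_counit_left hJ
  counit_right := skew_counit_right hJ
  isUnit := skew_isUnit hJ

/-- The functional `f ⊗ h ↦ f(T h)` on the double. -/
def evalAlong (T : H →ₗ[k] H) : DualCop k (DrinfeldDouble k H) :=
  (pairing k _).symm (TensorProduct.lift (pairing k H).toLinearMap ∘ₗ T.lTensor _ ∘ₗ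
    (toDouble k H).symm.toLinearMap)

@[simp] lemma pairing_evalAlong (T : H →ₗ[k] H) (f : DualCop k H) (h : H) :
    pairing k _ (evalAlong T) (toDouble k H (f ⊗ₜ h)) = pairing k H f (T h) := rfl

lemma antipode_toDouble (f : DualCop k H) (h : H) :
    antipode k (toDouble k H (f ⊗ₜ h)) =
      toDouble k H (leftH (antipode k h) (antipode k f ⊗ₜ 1)) := by
  exact DrinfeldDouble.one_tmul_mul _ _

/-- The functional `f ⊗ h ↦ f(S⁻¹(h))` has the value `g(S⁻¹(a))` at the element `a · g` of the
double. -/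
lemma evalAlong_leftH (g : DualCop k H) (a : H) :
    pairing k _ (evalAlong (antipodeInv k H)) (toDouble k H (leftH a (g ⊗ₜ 1))) =
      pairing k H g (antipodeInv k H a) := by
  rw [leftH, LinearMap.comp_apply, comul₃, LinearMap.comp_apply, ← coassoc_apply]
  have h := congr(TensorProduct.lid k _ $(rTensor_counit_comul (R := k) a))
  simp only [TensorProduct.lid_tmul, one_smul] at h
  conv_rhs => rw [← h]
  induction comul (R := k) a using TensorProduct.induction_on with
  | zero => simp
  | add s s' hs hs' => simp only [map_add, LinearMap.add_apply, hs, hs']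
  | tmul c r =>
    have h1 (t : H ⊗[k] H) : pairing k _ (evalAlong (antipodeInv k H)) (toDouble k H
        (act₃ (TensorProduct.assoc k H H H (t ⊗ₜ r)) (g ⊗ₜ 1))) = pairing k H g
          (antipodeInv k H r * LinearMap.mul' k H ((antipodeInv k H).rTensor H
            (TensorProduct.comm k H H t))) := by
      induction t using TensorProduct.induction_on with
      | zero => simp
      | add s s' hs hs' => simp only [map_add, LinearMap.add_apply, add_tmul, mul_add, hs, hs']
      | tmul p q => simp [pairing_coadj]
    rw [LinearMap.rTensor_tmul, h1, antipodeInv_mul_self]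
    simp [Algebra.algebraMap_eq_smul_one]

/-- The functional `f ⊗ h ↦ f(S⁻¹(h))` on the double is invariant under the antipode. -/
lemma antipode_evalAlong :
    pairing k _ (evalAlong (antipodeInv k H)) ∘ₗ antipode k =
      pairing k (DrinfeldDouble k H) (evalAlong (antipodeInv k H)) := by
  refine LinearMap.ext fun d => ?_
  induction d using DrinfeldDouble.induction_on with
  | zero => simp
  | add x y hx hy => simp only [map_add, hx, hy]
  | tmul f h =>
    rw [LinearMap.comp_apply, ← toDouble_tmul, antipode_toDouble, evalAlong_leftH,
      antipodeInv_antipode, pairing_evalAlong, pairing_antipode]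

end DoubleTwistElement

/-! ### The twist element of the double -/

section

open DualCop

variable {k : Type u} {X : Type v} [Field k] [Ring X] [HopfAlgebra k X] [FiniteDimensional k X]

lemma pairing_mul_antipode_rTensor (s : DualCop k X ⊗[k] DualCop k X) (d : X) :
    pairing k X (LinearMap.mul' k _ ((antipode k).rTensor _ s)) d =
      pairing₂ k X s ((antipodeInv k X).rTensor X (comul d)) := by
  induction s using TensorProduct.induction_on with
  | zero => simp
  | add s s' hs hs' => simp only [map_add, LinearMap.add_apply, hs, hs']
  | tmul F G =>
    simp only [LinearMap.rTensor_tmul, LinearMap.mul'_apply, pairing_mul]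
    hopf_tensor_induction comul (R := k) d with x y
    simp [pairing_antipode]

lemma pairing_mul_antipodeInv_comm (s : DualCop k X ⊗[k] DualCop k X) (d : X) :
    pairing k X (LinearMap.mul' k _ ((antipodeInv k _).rTensor _ (TensorProduct.comm k _ _ s))) d =
      pairing₂ k X s ((antipode k).lTensor X (TensorProduct.comm k _ _ (comul d))) := by
  induction s using TensorProduct.induction_on with
  | zero => simp
  | add s s' hs hs' => simp only [map_add, LinearMap.add_apply, hs, hs']
  | tmul F G =>
    simp only [LinearMap.rTensor_tmul, LinearMap.mul'_apply, pairing_mul, comm_tmul]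
    hopf_tensor_induction comul (R := k) d with x y
    simp [pairing_antipodeInv, mul_comm]

end

section DoubleTwistElement

open DualCop

variable {k : Type u} {H : Type v} [Field k] [Ring H] [HopfAlgebra k H] [FiniteDimensional k H]
  {J : DualCop k (DualCop k H ⊗[k] H) ⊗[k] DualCop k (DualCop k H ⊗[k] H)}

variable (k H) in
/-- `p ⊗ (q ⊗ r) ↦ S⁻¹(S⁻¹(r) p) ⊗ q` -/
def coadjArgs : H ⊗[k] (H ⊗[k] H) →ₗ[k] H ⊗[k] H :=
  (TensorProduct.comm k H H).toLinearMap ∘ₗ (antipodeInv k H ∘ₗ LinearMap.mul' k H ∘ₗ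
    (TensorProduct.comm k H H).toLinearMap ∘ₗ (antipodeInv k H).lTensor H).lTensor H ∘ₗ
    (TensorProduct.leftComm k H H H).toLinearMap

@[simp] lemma coadjArgs_tmul (p q r : H) : coadjArgs k H (p ⊗ₜ (q ⊗ₜ r)) =
    antipodeInv k H (antipodeInv k H r * p) ⊗ₜ q := by simp [coadjArgs]

/-- The argument of `J` in `d ↦ J(d₍₂₎, S(d₍₁₎))`, expressed through `coadjArgs`. -/
lemma pairing_contr_act₃ (u v : DualCop k H) (t : H ⊗[k] (H ⊗[k] H)) :
    pairing k H v (contr 1 (act₃ t (antipode k u ⊗ₜ 1))) =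
      pairing₂ k H (u ⊗ₜ v) (coadjArgs k H t) := by
  induction t using TensorProduct.induction_on with
  | zero => simp
  | add s s' hs hs' => simp only [map_add, LinearMap.add_apply, hs, hs']
  | tmul p t =>
  induction t using TensorProduct.induction_on with
  | zero => simp
  | add s s' hs hs' => simp only [map_add, LinearMap.add_apply, tmul_add, hs, hs']
  | tmul q r => simp [pairing_coadj, pairing_antipode]

/-- `f₍₁₎(S⁻¹(S⁻¹(a₍₃₎) a₍₁₎)) f₍₂₎(a₍₂₎) = f(S⁻²(a))` -/
lemma pairing₂_comul_coadjArgs (f : DualCop k H) (a : H) :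
    pairing₂ k H (comul f) (coadjArgs k H (comul₃ k H a)) =
      pairing k H f (antipodeInv k H (antipodeInv k H a)) := by
  rw [comul₃, LinearMap.comp_apply, ← coassoc_apply]
  have h := congr(TensorProduct.lid k _ $(rTensor_counit_comul (R := k) a))
  simp only [TensorProduct.lid_tmul, one_smul] at h
  conv_rhs => rw [← h]
  induction comul (R := k) a using TensorProduct.induction_on with
  | zero => simp
  | add s s' hs hs' => simp only [map_add, hs, hs']
  | tmul c r =>
    have h1 (t : H ⊗[k] H) : pairing₂ k H (comul f)
        (coadjArgs k H (TensorProduct.assoc k H H H (t ⊗ₜ r))) = pairing k H f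
          (LinearMap.mul' k H ((antipodeInv k H).lTensor H (TensorProduct.comm k H H t)) *
            antipodeInv k H (antipodeInv k H r)) := by
      induction t using TensorProduct.induction_on with
      | zero => simp
      | add s s' hs hs' => simp only [map_add, add_tmul, add_mul, hs, hs']
      | tmul p q => simp [pairing₂_comul, antipodeInv_mul, mul_assoc]
    rw [LinearMap.rTensor_tmul, h1, mul_antipodeInv]
    simp [Algebra.algebraMap_eq_smul_one]

/-- On `d = f ⊗ h`, the functional `d ↦ J(d₍₂₎, S(d₍₁₎))` has the value `f(S⁻¹(h))`. -/
lemma skew_lTensor_antipode (hJ : pairing₂ k (DualCop k H ⊗[k] H) J = skew LinearMap.id)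
    (d : DrinfeldDouble k H) :
    pairing₂ k _ (Algebra.TensorProduct.map (dualDoubleEquiv k H).toAlgHom
      (dualDoubleEquiv k H).toAlgHom J) ((antipode k).lTensor _
        (TensorProduct.comm k _ _ (comul d))) = pairing k _ (evalAlong (antipodeInv k H)) d := by
  induction d using DrinfeldDouble.induction_on with
  | zero => simp
  | add x y hx hy => simp only [map_add, hx, hy]
  | tmul f h =>
  rw [← toDouble_tmul, pairing_evalAlong, comul_toDouble, TensorProduct.comul_tmul]
  have h1 (u v : DualCop k H) (a b : H) :
      pairing₂ k _ (Algebra.TensorProduct.map (dualDoubleEquiv k H).toAlgHom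
        (dualDoubleEquiv k H).toAlgHom J) (toDouble k H (v ⊗ₜ b) ⊗ₜ
          antipode k (toDouble k H (u ⊗ₜ a))) = counit (R := k) b *
      pairing₂ k H (u ⊗ₜ v) (coadjArgs k H (comul₃ k H (antipode k a))) := by
    have h2 := pairing₂_dualDoubleEquiv J
      ((v ⊗ₜ b) ⊗ₜ leftH (antipode k a) (antipode k u ⊗ₜ 1))
    rw [map_tmul, LinearEquiv.coe_coe] at h2
    rw [antipode_toDouble, h2, hJ, skew_tmul, LinearMap.id_apply, leftH, LinearMap.comp_apply,
      pairing_contr_act₃]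
  have hh := congr(TensorProduct.rid k _ $(lTensor_counit_comul (R := k) h))
  simp only [TensorProduct.rid_tmul, one_smul] at hh
  have h3 : pairing k H f (antipodeInv k H h) = pairing₂ k H (comul f)
      (coadjArgs k H (comul₃ k H (antipode k h))) := by
    rw [pairing₂_comul_coadjArgs, antipodeInv_antipode]
  rw [h3]
  conv_rhs => rw [← hh]
  generalize comul (R := k) f = s
  induction s using TensorProduct.induction_on with
  | zero => simp
  | add s s' hs hs' => simp only [map_add, LinearMap.add_apply, add_tmul, hs, hs']
  | tmul u v =>
  induction comul (R := k) h using TensorProduct.induction_on with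
  | zero => simp
  | add s s' hs hs' => simp only [map_add, tmul_add, hs, hs']
  | tmul a b =>
    simp only [AlgebraTensorModule.tensorTensorTensorComm_tmul,
      map_tmul, LinearEquiv.coe_coe, comm_tmul,
      LinearMap.lTensor_tmul, h1, TensorProduct.rid_tmul, map_smul, smul_eq_mul]

/-- On `d = f ⊗ h`, the functional `d ↦ J(S⁻¹(d₍₁₎), d₍₂₎)` has the same value `f(S⁻¹(h))`. -/
lemma skew_rTensor_antipodeInv (hJ : pairing₂ k (DualCop k H ⊗[k] H) J = skew LinearMap.id)
    (d : DrinfeldDouble k H) :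
    pairing₂ k _ (Algebra.TensorProduct.map (dualDoubleEquiv k H).toAlgHom
      (dualDoubleEquiv k H).toAlgHom J) ((antipodeInv k _).rTensor _ (comul d)) =
      pairing k _ (evalAlong (antipodeInv k H)) d := by
  have h1 : (antipodeInv k _).rTensor _ (comul (R := k) d) = (antipode k).lTensor _
      (TensorProduct.comm k _ _ (comul (antipodeInv k _ d))) := by
    rw [comul_antipodeInv]
    hopf_tensor_induction comul (R := k) d with x y
    simp
  rw [h1, skew_lTensor_antipode hJ,
    ← LinearMap.congr_fun antipode_evalAlong (antipodeInv k _ d), LinearMap.comp_apply,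
    antipode_antipodeInv]

/-- The functional `f ⊗ h ↦ f(S⁻¹(h))` is invertible in the dual of the double. -/
lemma evalAlong_mul_evalAlong :
    (evalAlong LinearMap.id * evalAlong (antipodeInv k H) :
      DualCop k (DrinfeldDouble k H)) = 1 := by
  ext d
  induction d using DrinfeldDouble.induction_on with
  | zero => simp
  | add x y hx hy => simp only [map_add, hx, hy]
  | tmul f h =>
  rw [← toDouble_tmul, pairing_mul, comul_toDouble, TensorProduct.comul_tmul, pairing_one]
  have h1 := congr(pairing k H f $(antipodeInv_mul_self (k := k) h))
  have h2 (s : DualCop k H ⊗[k] DualCop k H) : LinearMap.mul' k k (TensorProduct.map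
      (pairing k _ (evalAlong LinearMap.id)) (pairing k _ (evalAlong (antipodeInv k H)))
        (TensorProduct.map (toDouble k H).toLinearMap (toDouble k H).toLinearMap
          (AlgebraTensorModule.tensorTensorTensorComm k k k k _ _ _ _
            (s ⊗ₜ[k] comul (R := k) h)))) =
      pairing₂ k H s ((antipodeInv k H).lTensor H (comul h)) := by
    induction s using TensorProduct.induction_on with
    | zero => simp
    | add s s' hs hs' => simp only [map_add, LinearMap.add_apply, add_tmul, hs, hs']
    | tmul u v =>
    hopf_tensor_induction comul (R := k) h with a b
    simp
  rw [h2]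
  have h3 : pairing₂ k H (comul f) ((antipodeInv k H).lTensor H (comul h)) =
      pairing k H f (LinearMap.mul' k H ((antipodeInv k H).rTensor H
        (TensorProduct.comm k H H (comul h)))) := by
    hopf_tensor_induction comul (R := k) h with a b
    simp [pairing₂_comul]
  rw [h3, h1, toDouble_tmul, DrinfeldDouble.counit_tmul, counit_apply]
  simp [Algebra.algebraMap_eq_smul_one, mul_comm]

/-- Traces of the inverse rotations only depend on the dual up to twisting, and the dual of the
double is a twist of the dual of `H^{*cop} ⊗ H`. -/
theorem indicator_drinfeldDouble (m : ℕ) : indicator k (DrinfeldDouble k H) (m + 1) =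
    indicator k (DualCop k H) (m + 1) * indicator k H (m + 1) := by
  obtain ⟨J, hJ⟩ := exists_pairing₂_eq (k := k) (H := DualCop k H ⊗[k] H) (skew LinearMap.id)
  have h1 : twistElement (dualDoubleEquiv k H) J = evalAlong (antipodeInv k H) := by
    ext d
    rw [twistElement, pairing_mul_antipode_rTensor, skew_rTensor_antipodeInv hJ]
  have h2 : LinearMap.mul' k _ ((antipodeInv k _).rTensor _ (TensorProduct.comm k _ _
      (Algebra.TensorProduct.map (dualDoubleEquiv k H).toAlgHom
        (dualDoubleEquiv k H).toAlgHom J))) = evalAlong (antipodeInv k H) := by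
    ext d
    rw [pairing_mul_antipodeInv_comm, skew_lTensor_antipode hJ]
  rw [← indicator_tensor, indicator_eq_trace_rotInv_dualCop, indicator_eq_trace_rotInv_dualCop]
  exact (trace_rotInv_eq_of_isTwist (isTwist_dualDoubleEquiv hJ) (h2.trans h1.symm)
    ⟨_, by rw [h1]; exact evalAlong_mul_evalAlong⟩ m).symm

end DoubleTwistElement

/-! ### Integrals and modular functions -/

section Radford

open DualCop

variable {k : Type u} {H : Type v} [Field k] [Ring H] [HopfAlgebra k H]

/-- `hitLeft g z = g(z₍₁₎) z₍₂₎` -/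
def hitLeft (g : Module.Dual k H) : H →ₗ[k] H :=
  (TensorProduct.lid k H).toLinearMap ∘ₗ g.rTensor H ∘ₗ comul

/-- `hitLeft g z = g(z₍₁₎) z₍₂₎` as a linear function of `g`. -/
def hitLeftHom (z : H) : Module.Dual k H →ₗ[k] H :=
  (TensorProduct.lid k H).toLinearMap ∘ₗ LinearMap.applyₗ (comul z) ∘ₗ LinearMap.rTensorHom H

lemma hitLeftHom_apply (z : H) (g : Module.Dual k H) : hitLeftHom z g = hitLeft g z := rfl

/-- `hit g z = z₍₁₎ g(z₍₂₎)` as a linear function of `g`. -/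
def hitHom (z : H) : Module.Dual k H →ₗ[k] H :=
  (TensorProduct.rid k H).toLinearMap ∘ₗ LinearMap.applyₗ (comul z) ∘ₗ LinearMap.lTensorHom H

lemma hitHom_apply (z : H) (g : Module.Dual k H) : hitHom z g = hit g z := rfl

/-- The functional `y ↦ g(x y)` as a linear function of `x`. -/
def lshiftHom (g : Module.Dual k H) : H →ₗ[k] Module.Dual k H := (LinearMap.mul k H).compr₂ g

/-- The functional `y ↦ g(y x)` as a linear function of `x`. -/
def rshiftHom (g : Module.Dual k H) : H →ₗ[k] Module.Dual k H :=
  (LinearMap.mul k H).flip.compr₂ g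

@[simp] lemma lshiftHom_apply (g : Module.Dual k H) (x y : H) : lshiftHom g x y = g (x * y) := rfl

@[simp] lemma rshiftHom_apply (g : Module.Dual k H) (x y : H) : rshiftHom g x y = g (y * x) := rfl

/-- A left integral `t` of `H` and a left integral `l` of `H^*` with `l(t) = 1`, such that the
bilinear form `l(x y)` has a Nakayama automorphism. -/
lemma exists_integral_pair [FiniteDimensional k H] : ∃ (l : Module.Dual k H) (t : H),
    t ≠ 0 ∧ (∀ h : H, h * t = counit (R := k) h • t) ∧ l t = 1 ∧ (∀ z, hit l z = l z • 1) ∧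
      ∀ h, ∃ x, lshiftHom l h = rshiftHom l x := by
  obtain ⟨t, ht0, ht⟩ := exists_integral (k := k) (H := H)
  have hc : Function.Injective (hitHom (k := k) t) :=
    (injective_iff_map_eq_zero _).2 fun g hg => nondeg_of_integral ht0 ht hg
  obtain ⟨l, hl⟩ := (LinearMap.injective_iff_surjective_of_finrank_eq_finrank
    (Subspace.dual_finrank_eq)).1 hc 1
  rw [hitHom_apply] at hl
  have hint : ∀ z, hit l z = l z • 1 := by
    intro z
    refine sub_eq_zero.1 ((Module.forall_dual_apply_eq_zero_iff k _).1 fun φ => ?_)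
    rw [map_sub, sub_eq_zero]
    have h1 : (φ ∘ₗ hit l - φ 1 • l : Module.Dual k H) = 0 := by
      refine hc ?_
      rw [map_sub, map_smul, map_zero, hitHom_apply, hitHom_apply, hit_comp, hl]
      simp [hit, Algebra.TensorProduct.one_def]
    have h2 := congr($h1 z)
    simp only [LinearMap.sub_apply, LinearMap.comp_apply, LinearMap.smul_apply,
      LinearMap.zero_apply, sub_eq_zero] at h2
    rw [h2, map_smul, smul_eq_mul, smul_eq_mul, mul_comm]
  have hlt : l t = 1 := by
    have h := congr(counit (R := k) $((hint t).symm.trans hl))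
    simpa using h
  have hθ : Function.Injective (rshiftHom l) := by
    refine (injective_iff_map_eq_zero _).2 fun x hx => ?_
    have h0 : ∀ u, hit (lshift l u) x = 0 := fun u => by
      rw [hitShift_repr l x (ℛ k u)]
      simp [hint, show ∀ y, l (y * x) = 0 from fun y => LinearMap.congr_fun hx y]
    have h1 := sum_hit_hit (Module.finBasis k H) (lshift l t) x
    have h2 : ∀ u, lshift (lshift l t) u = lshift l (t * u) := fun u => by ext; simp [mul_assoc]
    simp only [h2, h0, map_zero, Finset.sum_const_zero, lshift_apply, mul_one, hlt, one_smul] at h1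
    exact h1.symm
  refine ⟨l, t, ht0, ht, hlt, hint, fun h => ?_⟩
  obtain ⟨x, hx⟩ := (LinearMap.injective_iff_surjective_of_finrank_eq_finrank
    (Subspace.dual_finrank_eq).symm).1 hθ (lshiftHom l h)
  exact ⟨x, hx.symm⟩

/-- `S(x₍₁₎) S(t₍₁₎) l(t₍₂₎ x₍₂₎) = S((t x)₍₁₎) l((t x)₍₂₎)` -/
lemma antipode_conv_hit_rshift (l : Module.Dual k H) (t : H) :
    toConv (antipode k) * toConv (antipode k ∘ₗ hitHom t ∘ₗ rshiftHom l) =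
      toConv (antipode k ∘ₗ hit l ∘ₗ LinearMap.mulLeft k t) := by
  ext x
  simp only [LinearMap.convMul_apply, hit, LinearMap.comp_apply, LinearMap.mulLeft_apply,
    Bialgebra.comul_mul]
  hopf_tensor_induction comul (R := k) x with a b
  simp only [map_tmul, LinearMap.mul'_apply, hitHom_apply, hit, LinearMap.comp_apply]
  hopf_tensor_induction comul (R := k) t with c d
  simp [antipode_mul_antidistrib]

/-- `S(l(h₍₁₎ t₍₁₎) t₍₂₎) S(h₍₂₎) = l((h t)₍₁₎) S((h t)₍₂₎)` -/
lemma hitLeft_lshift_conv_antipode (l : Module.Dual k H) (t : H) :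
    toConv (antipode k ∘ₗ hitLeftHom t ∘ₗ lshiftHom l) * toConv (antipode k) =
      toConv (antipode k ∘ₗ hitLeft l ∘ₗ LinearMap.mulRight k t) := by
  ext x
  simp only [LinearMap.convMul_apply, hitLeft, LinearMap.comp_apply, LinearMap.mulRight_apply,
    Bialgebra.comul_mul]
  hopf_tensor_induction comul (R := k) x with a b
  simp only [map_tmul, LinearMap.mul'_apply, hitLeftHom_apply, hitLeft, LinearMap.comp_apply]
  hopf_tensor_induction comul (R := k) t with c d
  simp [antipode_mul_antidistrib]

/-- `l(t₍₁₎ x₍₁₎) t₍₂₎ x₍₂₎ = l((t x)₍₁₎) (t x)₍₂₎` -/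
lemma hitLeft_rshift_conv_id (l : Module.Dual k H) (t : H) :
    toConv (hitLeftHom t ∘ₗ rshiftHom l) * toConv LinearMap.id =
      toConv (hitLeft l ∘ₗ LinearMap.mulLeft k t) := by
  ext x
  simp only [LinearMap.convMul_apply, hitLeft, LinearMap.comp_apply, LinearMap.mulLeft_apply,
    Bialgebra.comul_mul]
  hopf_tensor_induction comul (R := k) x with a b
  simp only [map_tmul, LinearMap.mul'_apply, hitLeftHom_apply, hitLeft, LinearMap.comp_apply]
  hopf_tensor_induction comul (R := k) t with c d
  simp

lemma hit_hitLeft (f g : Module.Dual k H) (z : H) :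
    hit f (hitLeft g z) = hitLeft g (hit f z) := by
  let Φ : H ⊗[k] (H ⊗[k] H) →ₗ[k] H := (TensorProduct.lid k H).toLinearMap ∘ₗ
    TensorProduct.map g ((TensorProduct.rid k H).toLinearMap ∘ₗ f.lTensor H)
  have h1 : hit f (hitLeft g z) = Φ (comul.lTensor H (comul z)) := by
    simp only [hit, hitLeft, Φ, LinearMap.comp_apply]
    hopf_tensor_induction comul (R := k) z with a c
    simp
  have h2 : hitLeft g (hit f z) = Φ (TensorProduct.assoc k H H H (comul.rTensor H (comul z))) := by
    simp only [hit, hitLeft, LinearMap.comp_apply]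
    hopf_tensor_induction comul (R := k) z with a c
    simp only [LinearMap.lTensor_tmul, LinearEquiv.coe_coe, TensorProduct.rid_tmul, map_smul,
      LinearMap.rTensor_tmul]
    induction comul (R := k) a using TensorProduct.induction_on with
    | zero => simp
    | add x y hx hy => simp only [map_add, hx, hy, add_tmul, smul_add]
    | tmul p q =>
      simp only [Φ, LinearMap.lTensor_tmul, LinearMap.comp_apply, LinearEquiv.coe_coe,
        TensorProduct.rid_tmul, TensorProduct.assoc_tmul, map_tmul, TensorProduct.lid_tmul,
        LinearMap.rTensor_tmul]
      rw [smul_comm]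
  rw [h1, h2, coassoc_apply]

lemma hitLeft_comp (f g : Module.Dual k H) (z : H) :
    hitLeft (f ∘ₗ hitLeft g) z = hitLeft f (hitLeft g z) := by
  let Φ : H ⊗[k] (H ⊗[k] H) →ₗ[k] H := (TensorProduct.lid k H).toLinearMap ∘ₗ
    TensorProduct.map g ((TensorProduct.lid k H).toLinearMap ∘ₗ f.rTensor H)
  have h1 : hitLeft f (hitLeft g z) = Φ (comul.lTensor H (comul z)) := by
    simp only [hitLeft, Φ, LinearMap.comp_apply]
    hopf_tensor_induction comul (R := k) z with a c
    simp
  have h2 : hitLeft (f ∘ₗ hitLeft g) z =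
      Φ (TensorProduct.assoc k H H H (comul.rTensor H (comul z))) := by
    simp only [hitLeft, LinearMap.comp_apply]
    hopf_tensor_induction comul (R := k) z with a c
    simp only [LinearEquiv.coe_coe, LinearMap.rTensor_tmul, LinearMap.comp_apply]
    induction comul (R := k) a using TensorProduct.induction_on with
    | zero => simp
    | add x y hx hy => simp only [map_add, hx, hy, add_tmul]
    | tmul p q =>
      simp [Φ, mul_smul]
      rw [smul_comm]
  rw [h1, h2, coassoc_apply]

lemma hit_pairing_mul (f g : DualCop k H) :
    hit (pairing k H (f * g)) = hit (pairing k H f) ∘ₗ hit (pairing k H g) := by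
  ext z
  rw [LinearMap.comp_apply, ← hit_comp]
  refine congr_arg (hit · z) ?_
  ext x
  rw [pairing_mul, LinearMap.comp_apply, hit]
  simp only [LinearMap.comp_apply]
  hopf_tensor_induction comul (R := k) x with a b
  simp [mul_comm]

lemma hitLeft_pairing_mul (f g : DualCop k H) :
    hitLeft (pairing k H (f * g)) = hitLeft (pairing k H g) ∘ₗ hitLeft (pairing k H f) := by
  ext z
  rw [LinearMap.comp_apply, ← hitLeft_comp]
  refine congr_arg (hitLeft · z) ?_
  ext x
  rw [pairing_mul, LinearMap.comp_apply, hitLeft]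
  simp only [LinearMap.comp_apply]
  hopf_tensor_induction comul (R := k) x with a b
  simp

lemma hit_pairing_one : hit (pairing k H 1) = LinearMap.id := by
  ext z
  exact (congr(TensorProduct.rid k H $(lTensor_counit_comul (R := k) z))).trans (by simp)

lemma hitLeft_pairing_one : hitLeft (pairing k H 1) = LinearMap.id := by
  ext z
  exact (congr(TensorProduct.lid k H $(rTensor_counit_comul (R := k) z))).trans (by simp)

lemma hit_pairing_pow (f : DualCop k H) (n : ℕ) :
    hit (pairing k H (f ^ n)) = (hit (pairing k H f) : Module.End k H) ^ n := by
  induction n with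
  | zero => rw [pow_zero, pow_zero, hit_pairing_one]; rfl
  | succ n ih => rw [pow_succ, pow_succ, hit_pairing_mul, ih]; rfl

lemma hitLeft_pairing_pow (f : DualCop k H) (n : ℕ) :
    hitLeft (pairing k H (f ^ n)) = (hitLeft (pairing k H f) : Module.End k H) ^ n := by
  induction n with
  | zero => rw [pow_zero, pow_zero, hitLeft_pairing_one]; rfl
  | succ n ih => rw [pow_succ, pow_succ', hitLeft_pairing_mul, ih]; rfl

/-- A group-like element of a finite-dimensional Hopf algebra has finite order, because distinct
group-like elements are linearly independent. -/
lemma exists_pow_eq_one_of_isGroupLikeElem [FiniteDimensional k H] {g : H}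
    (hg : IsGroupLikeElem k g) : ∃ n, 0 < n ∧ g ^ n = 1 := by
  have : Finite (GroupLike k H) := (linearIndep_groupLikeVal (R := k) (A := H)).finite
  refine ⟨Nat.card (GroupLike k H), Nat.card_pos, ?_⟩
  exact congr_arg GroupLike.val (pow_card_eq_one' (x := (⟨g, hg⟩ : GroupLike k H)))

/-- If `l` is a left integral of `H^*`, then so is its product with any functional `φ`. -/
lemma hit_comp_hitLeft {l : Module.Dual k H} (hl : ∀ z, hit l z = l z • 1) (φ : Module.Dual k H)
    (z : H) : hit (φ ∘ₗ hitLeft l) z = φ (hitLeft l z) • 1 := by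
  let Φ : H ⊗[k] (H ⊗[k] H) →ₗ[k] H := (TensorProduct.rid k H).toLinearMap ∘ₗ
    (φ ∘ₗ (TensorProduct.lid k H).toLinearMap ∘ₗ l.rTensor H).lTensor H
  have h1 : hit (φ ∘ₗ hitLeft l) z = Φ (comul.lTensor H (comul z)) := by
    simp only [hit, hitLeft, Φ, LinearMap.comp_apply]
    hopf_tensor_induction comul (R := k) z with a c
    simp
  have h2 : φ (hitLeft l z) • 1 = Φ (TensorProduct.assoc k H H H (comul.rTensor H (comul z))) := by
    simp only [hitLeft, LinearMap.comp_apply]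
    induction comul (R := k) z using TensorProduct.induction_on with
    | zero => simp
    | add x y hx hy => simp only [map_add, hx, hy, add_smul]
    | tmul a c =>
      have h3 (s : H ⊗[k] H) : Φ (TensorProduct.assoc k H H H (s ⊗ₜ c)) =
          φ c • TensorProduct.rid k H (l.lTensor H s) := by
        induction s using TensorProduct.induction_on with
        | zero => simp
        | add x y hx hy => simp only [map_add, hx, hy, add_tmul, smul_add]
        | tmul p q =>
          simp [Φ, mul_smul]
          rw [smul_comm]
      have h4 : TensorProduct.rid k H (l.lTensor H (comul a)) = l a • 1 := hl a
      simp [h3, h4, smul_smul, mul_comm]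
  rw [h1, h2, coassoc_apply]

lemma comul_hitLeft (l : Module.Dual k H) (z : H) :
    comul (hitLeft l z) = (hitLeft l).rTensor H (comul (R := k) z) := by
  let Φ : H ⊗[k] (H ⊗[k] H) →ₗ[k] H ⊗[k] H := (TensorProduct.lid k _).toLinearMap ∘ₗ
    l.rTensor (H ⊗[k] H)
  have h1 : comul (hitLeft l z) = Φ (comul.lTensor H (comul z)) := by
    simp only [hitLeft, Φ, LinearMap.comp_apply]
    hopf_tensor_induction comul (R := k) z with a c
    simp
  have h2 : (hitLeft l).rTensor H (comul (R := k) z) =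
      Φ (TensorProduct.assoc k H H H (comul.rTensor H (comul z))) := by
    hopf_tensor_induction comul (R := k) z with a c
    simp only [LinearMap.rTensor_tmul, hitLeft, LinearMap.comp_apply]
    induction comul (R := k) a using TensorProduct.induction_on with
    | zero => simp
    | add x y hx hy => simp only [map_add, hx, hy, add_tmul]
    | tmul p q => simp [Φ, smul_tmul']
  rw [h1, h2, coassoc_apply]

variable [FiniteDimensional k H] {l : Module.Dual k H} {t : H}

/-- The modular function `α` of `H`, by which `H` acts from the right on the left integrals. -/
lemma exists_modular (ht : ∀ h : H, h * t = counit (R := k) h • t)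
    (hlt : l t = 1) (hl : ∀ z, hit l z = l z • 1) :
    ∃ α : DualCop k H, IsGroupLikeElem k α ∧ ∀ h, t * h = pairing k H α h • t := by
  have h1 (h : H) : t * h = l (t * h) • t := by
    by_contra hne
    have h2 (y : H) : y * (t * h - l (t * h) • t) =
        counit (R := k) y • (t * h - l (t * h) • t) := by
      rw [mul_sub, ← mul_assoc, ht, mul_smul_comm, ht, smul_sub, smul_mul_assoc, smul_comm]
    have h3 : hit l (t * h - l (t * h) • t) = 0 := by
      rw [hl, map_sub, map_smul, hlt]
      simp
    refine one_ne_zero (α := k) ?_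
    rw [← hlt, nondeg_of_integral (sub_ne_zero.2 hne) h2 h3, LinearMap.zero_apply]
  refine ⟨(pairing k H).symm (lshiftHom l t), ⟨?_, ?_⟩, fun h => ?_⟩
  · simpa [counit_apply] using hlt
  · refine contr_ext fun x => DualCop.ext fun y => ?_
    rw [pairing_comul]
    simp only [LinearEquiv.apply_symm_apply, lshiftHom_apply, contr_tmul, map_smul,
      LinearMap.smul_apply, smul_eq_mul]
    rw [← mul_assoc, h1 y, smul_mul_assoc, map_smul, smul_eq_mul, ← h1, mul_comm]
  · simpa using h1 h

/-- The distinguished group-like element `g` of `H`: the modular function of `H^*`. -/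
lemma isGroupLikeElem_hitLeft (ht0 : t ≠ 0) (ht : ∀ h : H, h * t = counit (R := k) h • t)
    (hlt : l t = 1) (hl : ∀ z, hit l z = l z • 1) :
    IsGroupLikeElem k (hitLeft l t) ∧ ∀ z, hitLeft l z = l z • hitLeft l t := by
  have h1 (z : H) : hitLeft l z = l z • hitLeft l t := by
    refine sub_eq_zero.1 ((Module.forall_dual_apply_eq_zero_iff k _).1 fun φ => ?_)
    have h2 : φ ∘ₗ hitLeft l - φ (hitLeft l t) • l = 0 := by
      refine nondeg_of_integral ht0 ht ?_
      rw [← hitHom_apply, map_sub, map_smul, hitHom_apply, hitHom_apply, hit_comp_hitLeft hl, hl,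
        hlt, one_smul, sub_self]
    have h3 := LinearMap.congr_fun h2 z
    simpa [mul_comm] using h3
  refine ⟨⟨?_, ?_⟩, h1⟩
  · have h2 (s : H ⊗[k] H) : counit (R := k) (TensorProduct.lid k H (l.rTensor H s)) =
        l (TensorProduct.rid k H (counit.lTensor H s)) := by
      hopf_tensor_induction s with a c
      simp [mul_comm]
    refine (h2 _).trans ?_
    simpa using hlt
  · have h2 : hitLeft l = l.smulRight (hitLeft l t) := LinearMap.ext h1
    have h3 (s : H ⊗[k] H) : (l.smulRight (hitLeft l t)).rTensor H s =
        hitLeft l t ⊗ₜ TensorProduct.lid k H (l.rTensor H s) := by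
      induction s using TensorProduct.induction_on with
      | zero => simp
      | add x y hx hy => simp only [map_add, hx, hy, tmul_add]
      | tmul a c => simp [smul_tmul]
    rw [comul_hitLeft, h2, h3, ← h2]
    rfl

end Radford

/-! ### Radford's theorem on the order of the antipode -/

section Radford

open DualCop

variable {k : Type u} {H : Type v} [Field k] [Ring H] [HopfAlgebra k H]

lemma id_conv_apply (f : Module.Dual k H) (a : H) (φ : H →ₗ[k] H) (hφ : ∀ x, φ x = f x • a)
    (x : H) :
    (toConv (LinearMap.id : H →ₗ[k] H) * toConv φ) x = hit f x * a := by
  simp only [LinearMap.convMul_apply, hit, LinearMap.comp_apply]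
  hopf_tensor_induction comul (R := k) x with p q
  simp [hφ]

lemma conv_apply (f : Module.Dual k H) (a : H) (φ ψ : H →ₗ[k] H) (hφ : ∀ x, φ x = f x • a)
    (x : H) :
    (toConv φ * toConv ψ) x = a * ψ (hitLeft f x) := by
  simp only [LinearMap.convMul_apply, hitLeft, LinearMap.comp_apply]
  hopf_tensor_induction comul (R := k) x with p q
  simp [hφ]

lemma hit_of_isGroupLikeElem {f : Module.Dual k H} {g : H} (hg : IsGroupLikeElem k g) :
    hit f g = f g • g := by
  simp [hit, hg.comul_eq_tmul_self]

variable [FiniteDimensional k H]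

/-- The comparison of the two descriptions of the Nakayama automorphism `h ↦ x` of the Frobenius
form of `H` that come from the two legs of `Δ(t)`. -/
lemma exists_nakayama : ∃ (α : DualCop k H) (g : H), IsGroupLikeElem k α ∧ IsGroupLikeElem k g ∧
    ∀ h : H, ∃ x : H, hit (pairing k H α) x = antipode k (antipode k h) ∧
      antipode k (antipode k (hitLeft (pairing k H α) x)) * antipode k g = antipode k g * h := by
  obtain ⟨l, t, ht0, ht, hlt, hl, hν⟩ := exists_integral_pair (k := k) (H := H)
  obtain ⟨α, hα, hα'⟩ := exists_modular ht hlt hl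
  obtain ⟨hg, hg'⟩ := isGroupLikeElem_hitLeft ht0 ht hlt hl
  set g := hitLeft l t
  have hlα (x : H) : l (t * x) = pairing k H α x := by
    rw [hα', map_smul, hlt, smul_eq_mul, mul_one]
  have e1 : toConv (antipode k ∘ₗ hitHom t ∘ₗ rshiftHom l) = toConv LinearMap.id *
      toConv (antipode k ∘ₗ hit l ∘ₗ LinearMap.mulLeft k t) := by
    rw [← antipode_conv_hit_rshift, ← mul_assoc, LinearMap.id_mul_antipode, one_mul]
  have e2 : toConv (antipode k ∘ₗ hitLeftHom t ∘ₗ lshiftHom l) =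
      toConv (antipode k ∘ₗ hitLeft l ∘ₗ LinearMap.mulRight k t) * toConv LinearMap.id := by
    rw [← hitLeft_lshift_conv_antipode, mul_assoc, LinearMap.antipode_mul_id, mul_one]
  have e3 : toConv (hitLeftHom t ∘ₗ rshiftHom l) =
      toConv (hitLeft l ∘ₗ LinearMap.mulLeft k t) * toConv (antipode k) := by
    rw [← hitLeft_rshift_conv_id, mul_assoc, LinearMap.id_mul_antipode, mul_one]
  refine ⟨α, g, hα, hg, fun h => ?_⟩
  obtain ⟨x, hx⟩ := hν h
  refine ⟨x, ?_, ?_⟩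
  · have h1 : antipode k (hitHom t (rshiftHom l x)) = hit (pairing k H α) x * 1 :=
      (congr($e1 x)).trans (id_conv_apply _ _ _ (fun y => by simp [hl, hlα]) x)
    have h2 : hitHom t (lshiftHom l h) = antipode k h * hit l t := hit_lshift_of_integral l ht h
    rw [← mul_one (hit _ x), ← h1, ← hx, h2, hl, hlt, one_smul, mul_one]
  · have h1 : antipode k (hitLeftHom t (lshiftHom l h)) = antipode k g * hitLeft counit h :=
      (congr($e2 h)).trans (conv_apply _ _ _ _ (fun y => by simp [hg', ht, hlt]) h)
    have h2 : hitLeftHom t (rshiftHom l x) = g * antipode k (hitLeft (pairing k H α) x) :=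
      (congr($e3 x)).trans (conv_apply _ _ _ _ (fun y => by simp [hg', hlα]) x)
    have h3 : hitLeft counit h = h := LinearMap.congr_fun (hitLeft_pairing_one (k := k)) h
    rw [h3] at h1
    rw [← h1, hx, h2, antipode_mul_antidistrib]

/-- A group-like element of `H^{*cop}` is a character of `H`. -/
lemma pairing_mul_of_isGroupLikeElem {α : DualCop k H} (hα : IsGroupLikeElem k α) (x y : H) :
    pairing k H α (x * y) = pairing k H α x * pairing k H α y := by
  rw [← pairing_comul, hα.comul_eq_tmul_self]
  simp [mul_comm]

lemma hit_pairing_mul_mul {α : DualCop k H} (hα : IsGroupLikeElem k α) (x y : H) :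
    hit (pairing k H α) (x * y) = hit (pairing k H α) x * hit (pairing k H α) y := by
  simp only [hit, LinearMap.comp_apply, Bialgebra.comul_mul]
  hopf_tensor_induction comul (R := k) x with a b
  hopf_tensor_induction comul (R := k) y with c d
  simp [pairing_mul_of_isGroupLikeElem hα, smul_smul, mul_comm]

lemma pairing_antipode_antipode {α : DualCop k H} (hα : IsGroupLikeElem k α) (x : H) :
    pairing k H α (antipode k (antipode k x)) = pairing k H α x := by
  conv_lhs => rw [← hα.antipode_antipode]
  rw [pairing_antipode, pairing_antipode, antipodeInv_antipode, antipodeInv_antipode]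

lemma hit_antipode_antipode {α : DualCop k H} (hα : IsGroupLikeElem k α) (x : H) :
    hit (pairing k H α) (antipode k (antipode k x)) =
      antipode k (antipode k (hit (pairing k H α) x)) := by
  simp only [hit, LinearMap.comp_apply, comul_antipode]
  hopf_tensor_induction comul (R := k) x with a b
  simp [pairing_antipode_antipode hα]

lemma hitLeft_antipode_antipode {α : DualCop k H} (hα : IsGroupLikeElem k α) (x : H) :
    hitLeft (pairing k H α) (antipode k (antipode k x)) =
      antipode k (antipode k (hitLeft (pairing k H α) x)) := by
  simp only [hitLeft, LinearMap.comp_apply, comul_antipode]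
  hopf_tensor_induction comul (R := k) x with a b
  simp [pairing_antipode_antipode hα]

variable (k H) in
/-- Radford's theorem: the antipode of a finite-dimensional Hopf algebra has finite order. -/
theorem orderOf_antipode_sq_ne_zero :
    orderOf (antipode k ∘ₗ antipode k : Module.End k H) ≠ 0 := by
  obtain ⟨α, g, hα, hg, hx⟩ := exists_nakayama (k := k) (H := H)
  let S₂ : Module.End k H := antipode k ∘ₗ antipode k
  let L : Module.End k H := hitLeft (pairing k H α)
  let R : Module.End k H := hit (pairing k H α)
  let C : Module.End k H := LinearMap.mulLeft k (antipode k g) * LinearMap.mulRight k g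
  have hgg : antipode k g * g = 1 := hg.antipode_mul_cancel
  have hcg : Commute (LinearMap.mulLeft k (antipode k g)) (LinearMap.mulRight k g) :=
    LinearMap.ext fun x => by simp [mul_assoc]
  have hLS : Commute L S₂ := LinearMap.ext fun x => hitLeft_antipode_antipode hα x
  have hRL : Commute R L := LinearMap.ext fun x => hit_hitLeft _ _ x
  have hRC : Commute R C := LinearMap.ext fun x => by
    have h1 : pairing k H α g * pairing k H α (antipode k g) = 1 := by
      rw [← pairing_mul_of_isGroupLikeElem hα, hg.mul_antipode_cancel]
      exact hα.counit_eq_one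
    simp only [R, C, Module.End.mul_apply, LinearMap.mulLeft_apply, LinearMap.mulRight_apply,
      hit_pairing_mul_mul hα, hit_of_isGroupLikeElem hg, hit_of_isGroupLikeElem hg.antipode,
      smul_mul_assoc, mul_smul_comm, smul_smul, h1, one_smul]
  -- `S⁴` agrees with `C` up to the left and right actions of `α`
  have key : L * (S₂ * S₂) = R * C := LinearMap.ext fun h => by
    obtain ⟨x, h1, h2⟩ := hx h
    have h3 : C h = S₂ (L x) := by
      simp only [C, Module.End.mul_apply, LinearMap.mulLeft_apply, LinearMap.mulRight_apply]
      rw [← mul_assoc, ← h2, mul_assoc, hgg, mul_one]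
      rfl
    have h4 : S₂ h = R x := h1.symm
    rw [Module.End.mul_apply, Module.End.mul_apply, Module.End.mul_apply, h3, h4]
    calc L (S₂ (R x)) = S₂ (L (R x)) := LinearMap.congr_fun hLS (R x)
      _ = S₂ (R (L x)) := congr_arg S₂ (LinearMap.congr_fun hRL x).symm
      _ = R (S₂ (L x)) := (hit_antipode_antipode hα (L x)).symm
  obtain ⟨a, ha, ha'⟩ := exists_pow_eq_one_of_isGroupLikeElem hα
  obtain ⟨b, hb, hb'⟩ := exists_pow_eq_one_of_isGroupLikeElem hg
  have hL : L ^ (a * b) = 1 := by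
    rw [pow_mul, ← hitLeft_pairing_pow, ha', hitLeft_pairing_one]
    exact one_pow b
  have hR : R ^ (a * b) = 1 := by
    rw [pow_mul, ← hit_pairing_pow, ha', hit_pairing_one]
    exact one_pow b
  have hgb : antipode k g ^ b = 1 := by
    have h1 : antipode k g ^ b * g ^ b = 1 := by
      have hcomm : Commute (antipode k g) g := by
        rw [Commute, SemiconjBy, hgg, hg.mul_antipode_cancel]
      rw [← hcomm.mul_pow, hgg, one_pow]
    rwa [hb', mul_one] at h1
  have hC : C ^ (a * b) = 1 := by
    rw [mul_comm a, pow_mul, hcg.mul_pow, LinearMap.pow_mulLeft, LinearMap.pow_mulRight, hb', hgb,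
      LinearMap.mulLeft_one, LinearMap.mulRight_one]
    exact one_pow a
  have hS : S₂ ^ (2 * (a * b)) = 1 := by
    have h1 : (L * (S₂ * S₂)) ^ (a * b) = (R * C) ^ (a * b) := by rw [key]
    rw [(hLS.mul_right hLS).mul_pow, hRC.mul_pow, hL, hR, hC, one_mul, one_mul, ← sq,
      ← pow_mul] at h1
    exact h1
  exact (orderOf_pos_iff.2 (isOfFinOrder_iff_pow_eq_one.2
    ⟨_, by positivity, hS⟩)).ne'

end Radford

/-! ### Eigenvalues of operators of finite order -/

section Eigenvalues

open DualCop

open Polynomial Ring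

lemma reverse_prod_X_sub_C {K : Type*} [Field K] (s : Multiset K) (hs : (0 : K) ∉ s) :
    ∃ c : K, c ≠ 0 ∧ (s.map fun a => X - C a).prod.reverse =
      C c * (s.map fun a => X - C a⁻¹).prod := by
  induction s using Multiset.induction_on with
  | empty => exact ⟨1, one_ne_zero, by simpa using reverse_C (1 : K)⟩
  | cons a s ih =>
    rw [Multiset.mem_cons, not_or] at hs
    obtain ⟨c, hc, h⟩ := ih hs.2
    have ha : a ≠ 0 := fun h => hs.1 h.symm
    refine ⟨-a * c, mul_ne_zero (neg_ne_zero.2 ha) hc, ?_⟩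
    have h1 : (X - C a : K[X]).reverse = C (-a) * (X - C a⁻¹) := by
      have h2 := reverse_add_C (X : K[X]) (-a)
      have h3 : (reverse X : K[X]) = 1 := by
        simpa only [one_mul, C_1] using (reverse_mul_X (1 : K[X])).trans (reverse_C 1)
      rw [h3, C_neg, ← sub_eq_add_neg, natDegree_X, pow_one] at h2
      have h4 : C (-a) * C a⁻¹ = -1 := by rw [← C_mul, neg_mul, mul_inv_cancel₀ ha, C_neg, C_1]
      rw [h2, mul_sub, h4, C_neg]
      ring
    rw [Multiset.map_cons, Multiset.prod_cons, reverse_mul_of_domain, h, h1, Multiset.map_cons,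
      Multiset.prod_cons, C_mul]
    ring

/-- The eigenvalues of the inverse of a matrix are the inverses of its eigenvalues. -/
lemma roots_charpoly_inv {K n : Type*} [Field K] [IsAlgClosed K] [Fintype n] [DecidableEq n]
    (A : Matrix n n K) (hA : IsUnit A) (h0 : (0 : K) ∉ A.charpoly.roots) :
    A⁻¹.charpoly.roots = A.charpoly.roots.map (·⁻¹) := by
  obtain ⟨c, hc, h⟩ := reverse_prod_X_sub_C _ h0
  have h1 : (A.charpoly.roots.map fun a => X - C a).prod = A.charpoly :=
    ((IsAlgClosed.splits A.charpoly).eq_prod_roots_of_monic A.charpoly_monic).symm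
  rw [h1] at h
  have h2 : ((-1) ^ Fintype.card n * C A.det⁻¹ʳ * C c : K[X]) =
      C ((-1) ^ Fintype.card n * A.det⁻¹ʳ * c) := by simp
  have h3 : ((-1) ^ Fintype.card n * A.det⁻¹ʳ * c) ≠ 0 := by
    have := (A.isUnit_iff_isUnit_det.1 hA).ne_zero
    simp [hc, this]
  have h4 : (A.charpoly.roots.map fun a => X - C a⁻¹) =
      (A.charpoly.roots.map (·⁻¹)).map fun a => X - C a := by
    rw [Multiset.map_map]; rfl
  rw [Matrix.charpoly_inv A hA, ← Matrix.reverse_charpoly, h, ← mul_assoc, h2, roots_C_mul _ h3,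
    h4, roots_multiset_prod_X_sub_C]

lemma pow_eq_one_of_mem_roots_charpoly {K n : Type*} [Field K] [Fintype n] [DecidableEq n]
    {A : Matrix n n K} {N : ℕ} (hA : A ^ N = 1) {x : K} (hx : x ∈ A.charpoly.roots) :
    x ^ N = 1 := by
  have h1 : x ∈ spectrum K A :=
    Matrix.mem_spectrum_iff_isRoot_charpoly.2 (isRoot_of_mem_roots hx)
  have h2 := spectrum.pow_mem_pow A N h1
  rw [hA, spectrum.mem_iff, Algebra.algebraMap_eq_smul_one] at h2
  by_contra hne
  refine h2 ?_
  have h3 : x ^ N • (1 : Matrix n n K) - 1 = (x ^ N - 1) • 1 := by rw [sub_smul, one_smul]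
  rw [h3]
  exact (isUnit_one).smul (Units.mk0 _ (sub_ne_zero.2 hne))

/-- The traces of an automorphism of finite order and of its inverse, in terms of the
eigenvalues. -/
lemma exists_eigenvalues {k V : Type*} [Field k] [AddCommGroup V] [Module k V]
    [FiniteDimensional k V] {E E' : Module.End k V} {N : ℕ} (hN : N ≠ 0) (hE : E ^ N = 1)
    (hE' : E * E' = 1) : ∃ (m : ℕ) (ω : Fin m → AlgebraicClosure k), (∀ i, ω i ^ N = 1) ∧
      algebraMap k (AlgebraicClosure k) (LinearMap.trace k V E) = ∑ i, ω i ∧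
      algebraMap k (AlgebraicClosure k) (LinearMap.trace k V E') = ∑ i, (ω i)⁻¹ := by
  let b := Module.finBasis k V
  let f : Module.End k V →+* Matrix _ _ (AlgebraicClosure k) :=
    (algebraMap k (AlgebraicClosure k)).mapMatrix.comp
      (LinearMap.toMatrixAlgEquiv b).toAlgHom.toRingHom
  have hf (F : Module.End k V) : algebraMap k (AlgebraicClosure k) (LinearMap.trace k V F) =
      (f F).trace := by
    rw [LinearMap.trace_eq_matrix_trace k b]
    exact AddMonoidHom.map_trace (algebraMap k (AlgebraicClosure k)).toAddMonoidHom _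
  have hA : f E ^ N = 1 := by rw [← map_pow, hE, map_one]
  have hAA : f E * f E' = 1 := by rw [← map_mul, hE', map_one]
  have hpow (x) (hx : x ∈ (f E).charpoly.roots) : x ^ N = 1 :=
    pow_eq_one_of_mem_roots_charpoly hA hx
  have h0 : (0 : AlgebraicClosure k) ∉ (f E).charpoly.roots := fun h => by
    simpa [hN] using hpow 0 h
  have hinv : f E' = (f E)⁻¹ := (Matrix.inv_eq_right_inv hAA).symm
  have hroots := roots_charpoly_inv (f E) (IsUnit.of_mul_eq_one _ hAA) h0
  let L := (f E).charpoly.roots.toList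
  refine ⟨L.length, L.get, fun i => hpow _ (Multiset.mem_toList.1 (L.get_mem i)), ?_, ?_⟩
  · rw [hf, Matrix.trace_eq_sum_roots_charpoly, ← Multiset.sum_toList]
    exact (Fin.sum_univ_getElem L).symm
  · rw [hf, hinv, Matrix.trace_eq_sum_roots_charpoly, hroots,
      ← Multiset.coe_toList (f E).charpoly.roots, Multiset.map_coe, Multiset.sum_coe]
    exact (Fin.sum_univ_fun_getElem L (·⁻¹)).symm

end Eigenvalues

/-! ### The conjugation of cyclotomic integers -/

section Conjugation

open DualCop

open Polynomial

variable {k : Type u} [Field k] {N : ℕ}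

lemma IsBar.ext {σ τ : cyclotomicSubring k N ≃+* cyclotomicSubring k N} (hσ : IsBar σ)
    (hτ : IsBar τ) : σ = τ := by
  refine RingEquiv.ext fun ⟨x, hx⟩ => ?_
  induction hx using Subring.closure_induction with
  | mem x h =>
    have h1 : (⟨x, Subring.subset_closure h⟩ : cyclotomicSubring k N) ^ N = 1 := Subtype.ext h
    exact Subtype.ext ((hσ _ h1).trans (hτ _ h1).symm)
  | zero => exact (map_zero σ).trans (map_zero τ).symm
  | one => exact (map_one σ).trans (map_one τ).symm
  | add x y hx hy h h' =>
    have h1 := map_add σ ⟨x, hx⟩ ⟨y, hy⟩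
    rw [h, h', ← map_add] at h1
    exact h1
  | neg x hx h =>
    have h1 := map_neg σ ⟨x, hx⟩
    rw [h, ← map_neg] at h1
    exact h1
  | mul x y hx hy h h' =>
    have h1 := map_mul σ ⟨x, hx⟩ ⟨y, hy⟩
    rw [h, h', ← map_mul] at h1
    exact h1

lemma range_eval₂_eq_cyclotomicSubring {ζ : AlgebraicClosure k} (hN : N ≠ 0)
    (hζ : IsPrimitiveRoot ζ N) :
    (eval₂RingHom (Int.castRingHom (AlgebraicClosure k)) ζ).range = cyclotomicSubring k N := by
  refine le_antisymm ?_ (Subring.closure_le.2 fun ω hω => ?_)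
  · rintro _ ⟨p, rfl⟩
    have hmem : ζ ∈ cyclotomicSubring k N := Subring.subset_closure hζ.pow_eq_one
    rw [coe_eval₂RingHom, eval₂_eq_sum_range]
    exact Subring.sum_mem _ fun i _ => Subring.mul_mem _ (intCast_mem _ _)
      (Subring.pow_mem _ hmem i)
  · have : NeZero N := ⟨hN⟩
    obtain ⟨i, -, rfl⟩ := hζ.eq_pow_of_pow_eq_one hω
    exact ⟨X ^ i, by simp⟩

lemma eval₂_eq_zero_iff_cyclotomic_dvd {K : Type*} [Field K] [CharZero K] {ξ : K} (hN : N ≠ 0)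
    (hξ : IsPrimitiveRoot ξ N) (p : ℤ[X]) :
    eval₂ (Int.castRingHom K) ξ p = 0 ↔ cyclotomic N ℤ ∣ p := by
  rw [cyclotomic_eq_minpoly hξ (Nat.pos_of_ne_zero hN),
    ← minpoly.isIntegrallyClosed_dvd_iff (hξ.isIntegral (Nat.pos_of_ne_zero hN)), aeval_def,
    algebraMap_int_eq]

/-- In characteristic zero, a primitive root of unity and its inverse have the same minimal
polynomial, hence there is an automorphism that exchanges them. -/
lemma exists_isBar [CharZero k] (hN : N ≠ 0) :
    ∃ σ : cyclotomicSubring k N ≃+* cyclotomicSubring k N, IsBar σ := by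
  have : NeZero N := ⟨hN⟩
  have : CharZero (AlgebraicClosure k) := charZero_of_injective_algebraMap
    (algebraMap k (AlgebraicClosure k)).injective
  have : NeZero (N : AlgebraicClosure k) := ⟨Nat.cast_ne_zero.2 hN⟩
  obtain ⟨ζ, hζ⟩ := HasEnoughRootsOfUnity.exists_primitiveRoot (AlgebraicClosure k) N
  have hζ' := hζ.inv
  let φ := eval₂RingHom (Int.castRingHom (AlgebraicClosure k)) ζ
  let ψ := eval₂RingHom (Int.castRingHom (AlgebraicClosure k)) ζ⁻¹
  have hker : RingHom.ker φ = RingHom.ker ψ := by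
    ext p
    exact (eval₂_eq_zero_iff_cyclotomic_dvd hN hζ p).trans
      (eval₂_eq_zero_iff_cyclotomic_dvd hN hζ' p).symm
  -- both ranges are the quotient of `ℤ[X]` by the same ideal
  let e : φ.range ≃+* ψ.range := φ.quotientKerEquivRange.symm.trans
    ((Ideal.quotEquivOfEq hker).trans ψ.quotientKerEquivRange)
  have he (p : ℤ[X]) : (e ⟨φ p, p, rfl⟩ : AlgebraicClosure k) = ψ p := by
    have h1 : (⟨φ p, p, rfl⟩ : φ.range) = φ.quotientKerEquivRange (Ideal.Quotient.mk _ p) := rfl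
    simp only [e, RingEquiv.trans_apply]
    rw [h1, RingEquiv.symm_apply_apply]
    rfl
  let σ := (RingEquiv.subringCongr (range_eval₂_eq_cyclotomicSubring hN hζ).symm).trans
    (e.trans (RingEquiv.subringCongr (range_eval₂_eq_cyclotomicSubring hN hζ')))
  refine ⟨σ, fun z hz => ?_⟩
  have hz' : (z : AlgebraicClosure k) ^ N = 1 := congr_arg Subtype.val hz
  obtain ⟨i, -, hi⟩ := hζ.eq_pow_of_pow_eq_one hz'
  have hφ : φ (X ^ i) = z := by simpa [φ] using hi
  have hψ : ψ (X ^ i) = (z : AlgebraicClosure k)⁻¹ := by simp [ψ, ← hi]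
  rw [← hψ, ← he]
  exact congr_arg (fun y => (e y : AlgebraicClosure k)) (Subtype.ext hφ.symm)

end Conjugation

end HopfDouble

end

theorem mainTheorem2 {k : Type*} {H : Type*} [Field k] [Ring H] [HopfAlgebra k H]
    [FiniteDimensional k H] (n : ℕ) (hn : 1 ≤ n) :
    (CharZero k → ∃! σ : HopfDouble.cyclotomicSubring k (HopfDouble.cyclotomicOrder k H n) ≃+*
        HopfDouble.cyclotomicSubring k (HopfDouble.cyclotomicOrder k H n), HopfDouble.IsBar σ) ∧
    (∃ ν : HopfDouble.cyclotomicSubring k (HopfDouble.cyclotomicOrder k H n),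
      (ν : AlgebraicClosure k) =
        algebraMap k (AlgebraicClosure k) (HopfDouble.indicator k H n) ∧
      ∀ σ : HopfDouble.cyclotomicSubring k (HopfDouble.cyclotomicOrder k H n) ≃+*
          HopfDouble.cyclotomicSubring k (HopfDouble.cyclotomicOrder k H n), HopfDouble.IsBar σ →
        algebraMap k (AlgebraicClosure k)
          (HopfDouble.indicator k (HopfDouble.DrinfeldDouble k H) n) =
          (ν : AlgebraicClosure k) * (σ ν : AlgebraicClosure k)) ∧
    ∃ (m : ℕ) (ω : Fin m → AlgebraicClosure k),
      (∀ i, ω i ^ HopfDouble.cyclotomicOrder k H n = 1) ∧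
      algebraMap k (AlgebraicClosure k) (HopfDouble.indicator k H n) = ∑ i, ω i ∧
      algebraMap k (AlgebraicClosure k) (HopfDouble.indicator k (HopfDouble.DualCop k H) n) =
        ∑ i, (ω i)⁻¹ ∧
      algebraMap k (AlgebraicClosure k)
          (HopfDouble.indicator k (HopfDouble.DrinfeldDouble k H) n) =
        (∑ i, ω i) * ∑ i, (ω i)⁻¹ := by
  open HopfDouble in
  -- `Tr(rot) = ν_n(H)` for the operator `rot` on `H^{⊗ m}` with `m = n - 1`
  obtain ⟨m, rfl⟩ : ∃ m, n = m + 1 := ⟨n - 1, by omega⟩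
  have hN : cyclotomicOrder k H (m + 1) ≠ 0 :=
    mul_ne_zero m.succ_ne_zero (orderOf_antipode_sq_ne_zero k H)
  obtain ⟨r, ω, hω, h1, h2⟩ := exists_eigenvalues hN
    (rot_pow_eq_one (m := m) (pow_orderOf_eq_one _)) (rot_mul_rotInv (k := k) (H := H) (m := m))
  rw [← indicator_succ] at h1
  rw [← indicator_dualCop] at h2
  have h3 : algebraMap k (AlgebraicClosure k) (indicator k (DrinfeldDouble k H) (m + 1)) =
      (∑ i, ω i) * ∑ i, (ω i)⁻¹ := by
    rw [indicator_drinfeldDouble, map_mul, h1, h2, mul_comm]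
  let z (i : Fin r) : cyclotomicSubring k (cyclotomicOrder k H (m + 1)) :=
    ⟨ω i, Subring.subset_closure (hω i)⟩
  have hz : ((∑ i, z i : cyclotomicSubring k (cyclotomicOrder k H (m + 1))) :
      AlgebraicClosure k) = ∑ i, ω i := map_sum (Subring.subtype _) _ _
  refine ⟨fun _ => ?_, ⟨∑ i, z i, hz.trans h1.symm, fun σ hσ => ?_⟩, r, ω, hω, h1, h2, h3⟩
  · obtain ⟨σ, hσ⟩ := exists_isBar (k := k) hN
    exact ⟨σ, hσ, fun τ hτ => hτ.ext hσ⟩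
  · have hσz : (σ (∑ i, z i) : AlgebraicClosure k) = ∑ i, (ω i)⁻¹ := by
      rw [map_sum]
      refine (map_sum (Subring.subtype _) _ _).trans (Finset.sum_congr rfl fun i _ => ?_)
      exact hσ (z i) (Subtype.ext (hω i))
    rw [h3, hz, hσz]
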